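/- Let $q\in\mathbb R\setminus\{0\}$. For $n\ge 0$ let $E_{ij}$ be the matrix units of $M_n(\mathbb C)$, put $\lambda_n=q^{1-1/n}$, $$R_n=q^{-1/n}\Big(q\sum_iE_{ii}\otimes E_{ii}+\sum_{i\ne j}E_{ii}\otimes E_{jj}+(q-q^{-1})\sum_{j>i}E_{ij}\otimes E_{ji}\Big),\qquad \widetilde R_n=\big((R_n^{t_2})^{-1}\big)^{t_2},$$ where $t_2$ is transposition in the second tensor factor and $(A\otimes B)^{ab}{}_{cd}=A^a{}_cB^b{}_d$ (the choice of the root $q^{1/n}$ does not affect any of the relations below; repeated indices are summed). For a permutation with $l(\sigma)$ inversions put $\varepsilon_{\sigma(1)\dots\sigma(n)}=\varepsilon^{\sigma(1)\dots\sigma(n)}=(-q)^{l(\sigma)}$, let $\varepsilon$ vanish on all other tuples, and put $$\mathrm{det}_{q,n}=\nu_n^{-1}\,\varepsilon_{a_1\dots a_n}t^{a_1}{}_{b_1}\cdots t^{a_n}{}_{b_n}\varepsilon^{b_n\dots b_1},\qquad \nu_n=\varepsilon_{a_1\dots a_n}\varepsilon^{a_n\dots a_1}.$$ * $U_q(n)$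 is the $\mathbb C$-algebra generated by $t^i{}_j$ $(1\le i,j\le n)$ and $\mathrm{det}_{q,n}^*$ with relations $R^{ij}{}_{kl}t^k{}_at^l{}_b=t^j{}_lt^i{}_kR^{kl}{}_{ab}$ and $\mathrm{det}_{q,n}\,\mathrm{det}_{q,n}^*=\mathrm{det}_{q,n}^*\,\mathrm{det}_{q,n}=1$ (so $U_q(0)=\mathbb C$). * For $n\ge 1$, $S^{2n-1}_q$ is the $\mathbb C$-algebra generated by $v^i,x_i$ $(1\le i\le n)$ with relations $v^iv^j=\lambda_n^{-1}R^{ij}{}_{kl}v^lv^k$, $x_ix_j=x_lx_k\lambda_n^{-1}R^{kl}{}_{ij}$, $x_iv^j=v^kx_l\lambda_n\widetilde R^{lj}{}_{ik}$ and $v^ag^b{}_ax_b=1$, where $g^b{}_a=\lambda_n\widetilde R^{bc}{}_{ca}$. **Theorem.** Let $n\ge 1$. 1. For $m=n$ and for $m=n-1$, $U_q(m)$ is a Hopf $*$-algebra with $\Delta t^i{}_j=t^i{}_k\otimes t^k{}_j$, $\varepsilon(t^i{}_j)=\delta^i{}_j$, $(t^i{}_j)^*=S(t^j{}_i)$, and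 $(\mathrm{det}_{q,m})^*$ equal to the adjoined generator $\mathrm{det}_{q,m}^*$. There is a surjective homomorphism of Hopf $*$-algebras $\alpha_n:U_q(n)\to U_q(n-1)$ with $t^1{}_1\mapsto1$, $t^1{}_i,t^i{}_1\mapsto0$ for $i>1$, and $t^{i+1}{}_{j+1}\mapsto t^i{}_j$ for $1\le i,j\le n-1$. 2. With the coaction $\beta=(\alpha_n\otimes\mathrm{id})\circ\Delta$, $U_q(n)$ is a quantum principal bundle in the sense of Brzeziński and Majid (with the universal differential calculus) with structure quantum group $A=U_q(n-1)$. That is, with $P=U_q(n)$: $P$ is a left $A$-comodule algebra; the base is $B=P^A=\{u\in P:\beta(u)=1\otimes u\}$; the map $\chi:P\otimes P\to A\otimes P$, $\chi(u\otimes w)=\beta(u)(1\otimes w)$, is surjective (freeness); and, writing $\Omega^1P=\ker(\cdot:P\otimes P\to P)$ and $\Omega^1B=\ker(\cdot:B\otimes B\to B)$, one has $\ker(\chi|_{\Omega^1P})=P\,(\Omega^1B)\,P$, the span in $P\otimes P$ of the elements $u\,\omega\,w$ with $u,w\in P$ and $\omega$ in the image of $\Omega^1B$ (exactness). 3. $S^{2n-1}_q$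 is a $*$-algebra with $x_i^*=v^i$, and $S^{2n-1}_q\cong U_q(n)^{U_q(n-1)}$ as $*$-algebras. -/

import Mathlib

open scoped TensorProduct Kronecker ComplexConjugate

noncomputable section

namespace QBundle

/-! ### Hopf algebras and Hopf `*`-algebras over `ℂ` -/

/-- A Hopf algebra structure on a given `ℂ`-algebra `A`: comultiplication and counit are algebra
homomorphisms, subject to coassociativity and counitality, and `antipode` is a two-sided
convolution inverse of the identity. (This is the same thing as a Mathlib `HopfAlgebra ℂ A` which
extends the given algebra structure, see `HopfStructure.toHopfAlgebra`.) -/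
structure HopfStructure (A : Type) [Ring A] [Algebra ℂ A] where
  comul : A →ₐ[ℂ] A ⊗[ℂ] A
  counit : A →ₐ[ℂ] ℂ
  antipode : A →ₗ[ℂ] A
  coassoc :
    (TensorProduct.assoc ℂ A A A).toLinearMap ∘ₗ comul.toLinearMap.rTensor A ∘ₗ comul.toLinearMap
      = comul.toLinearMap.lTensor A ∘ₗ comul.toLinearMap
  counit_left : counit.toLinearMap.rTensor A ∘ₗ comul.toLinearMap = TensorProduct.mk ℂ ℂ A 1
  counit_right : counit.toLinearMap.lTensor A ∘ₗ comul.toLinearMap =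
    (TensorProduct.mk ℂ A ℂ).flip 1
  antipode_left : LinearMap.mul' ℂ A ∘ₗ antipode.rTensor A ∘ₗ comul.toLinearMap
    = Algebra.linearMap ℂ A ∘ₗ counit.toLinearMap
  antipode_right : LinearMap.mul' ℂ A ∘ₗ antipode.lTensor A ∘ₗ comul.toLinearMap
    = Algebra.linearMap ℂ A ∘ₗ counit.toLinearMap

/-- The Mathlib Hopf algebra given by a `HopfStructure`. -/
abbrev HopfStructure.toHopfAlgebra {A : Type} [Ring A] [Algebra ℂ A] (H : HopfStructure A) :
    HopfAlgebra ℂ A where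
  comul := H.comul.toLinearMap
  counit := H.counit.toLinearMap
  antipode := H.antipode
  coassoc := H.coassoc
  rTensor_counit_comp_comul := H.counit_left
  lTensor_counit_comp_comul := H.counit_right
  counit_one := by simp
  mul_compr₂_counit := by ext; simp
  comul_one := by simp
  mul_compr₂_comul := by ext; simp
  mul_antipode_rTensor_comul := H.antipode_left
  mul_antipode_lTensor_comul := H.antipode_right

/-- A Hopf `*`-algebra structure on a given `ℂ`-algebra: a Hopf algebra structure together with a
conjugate linear, involutive antimultiplicative `*` such that `Δ` and `ε` are `*`-homomorphisms
(with `(a ⊗ b)* = a* ⊗ b*`). -/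
structure HopfStarStructure (A : Type) [Ring A] [Algebra ℂ A] extends HopfStructure A where
  starRing : StarRing A
  starModule : StarModule ℂ A
  comul_star : ∀ a : A, comul (star a) = star (comul a)
  counit_star : ∀ a : A, counit (star a) = conj (counit a)

/-- Homomorphisms of Hopf `*`-algebras: algebra homomorphisms which commute with
comultiplication, counit, antipode and `*`. -/
structure IsHopfStarHom {P A : Type} [Ring P] [Algebra ℂ P] [Ring A] [Algebra ℂ A]
    (HP : HopfStarStructure P) (HA : HopfStarStructure A) (π : P →ₐ[ℂ] A) : Prop where
  map_comul : ∀ p, HA.comul (π p) = Algebra.TensorProduct.map π π (HP.comul p)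
  map_counit : ∀ p, HA.counit (π p) = HP.counit p
  map_antipode : ∀ p, HA.antipode (π p) = π (HP.antipode p)
  map_star : ∀ p, HA.starRing.star (π p) = π (HP.starRing.star p)

/-! ### Quantum principal bundles (with the universal differential calculus) -/

section Bundle

variable {A P : Type} [Ring A] [Algebra ℂ A] [Ring P] [Algebra ℂ P]

/-- The subalgebra `{u ∈ P : β u = 1 ⊗ u}` of invariant elements of a left coaction. -/
def coinvariants (β : P →ₐ[ℂ] A ⊗[ℂ] P) : Subalgebra ℂ P :=
  AlgHom.equalizer β Algebra.TensorProduct.includeRight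

/-- The map `(id ⊗ ·)(β ⊗ id) : P ⊗ P → A ⊗ P`, that is, `u ⊗ w ↦ β(u) (1 ⊗ w)`. -/
def bundleMap (β : P →ₐ[ℂ] A ⊗[ℂ] P) : P ⊗[ℂ] P →ₗ[ℂ] A ⊗[ℂ] P :=
  LinearMap.mul' ℂ (A ⊗[ℂ] P) ∘ₗ TensorProduct.map β.toLinearMap
    (Algebra.TensorProduct.includeRight : P →ₐ[ℂ] A ⊗[ℂ] P).toLinearMap

/-- The universal one-forms `ker (· : P ⊗ P → P)`. -/
def universalForms (P : Type) [Ring P] [Algebra ℂ P] : Submodule ℂ (P ⊗[ℂ] P) :=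
  LinearMap.ker (LinearMap.mul' ℂ P)

/-- The horizontal one-forms `P · j(Ω¹B) · P`, where `j : B ⊗ B → P ⊗ P` is induced by the
inclusion of the subalgebra `B` and `u · (b ⊗ b') · w = u b ⊗ b' w`. -/
def horizontalForms (B : Subalgebra ℂ P) : Submodule ℂ (P ⊗[ℂ] P) :=
  Submodule.span ℂ {ω | ∃ (u w : P) (η : B ⊗[ℂ] B), η ∈ universalForms B ∧
    ω = (u ⊗ₜ[ℂ] (1 : P)) * Algebra.TensorProduct.map B.val B.val η * ((1 : P) ⊗ₜ[ℂ] w)}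

/-- The Brzeziński–Majid definition: `P` with the left coaction `β` of the Hopf algebra `A` is a
quantum principal bundle with structure quantum group `A` and base `B`. -/
structure IsQuantumPrincipalBundle (H : HopfStructure A) (β : P →ₐ[ℂ] A ⊗[ℂ] P)
    (B : Subalgebra ℂ P) : Prop where
  /-- `(Δ ⊗ id) β = (id ⊗ β) β` -/
  coassoc : (TensorProduct.assoc ℂ A A P).toLinearMap ∘ₗ
      H.comul.toLinearMap.rTensor P ∘ₗ β.toLinearMap = β.toLinearMap.lTensor A ∘ₗ β.toLinearMap
  /-- `(ε ⊗ id) β = id` -/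
  counit : H.counit.toLinearMap.rTensor P ∘ₗ β.toLinearMap = TensorProduct.mk ℂ ℂ P 1
  /-- the base is the algebra of invariants -/
  base : B = coinvariants β
  /-- freeness of the coaction -/
  free : Function.Surjective (bundleMap β)
  /-- exactness: a universal one-form is vertically trivial iff it is horizontal -/
  exact : universalForms P ⊓ LinearMap.ker (bundleMap β) = horizontalForms B

end Bundle

/-! ### The standard `R`-matrices -/

/-- The factor `q^{-1/n}`. For negative `q` this is the principal complex value; the factor drops
out of all the relations below. -/
def rootFactor (q : ℝ) (n : ℕ) : ℂ := (q : ℂ) ^ (-(1 : ℂ) / n)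

/-- `λ_n = q^{1 - 1/n}`. -/
def lam (q : ℝ) (n : ℕ) : ℂ := (q : ℂ) ^ ((1 : ℂ) - 1 / n)

/-- `R_n = q^{-1/n} (q ∑ᵢ Eᵢᵢ ⊗ Eᵢᵢ + ∑_{i ≠ j} Eᵢᵢ ⊗ Eⱼⱼ + (q - q⁻¹) ∑_{j > i} Eᵢⱼ ⊗ Eⱼᵢ)`,
whose entry `R^{ab}_{cd}` is `stdR q n (a, b) (c, d)`. -/
def stdR (q : ℝ) (n : ℕ) : Matrix (Fin n × Fin n) (Fin n × Fin n) ℂ :=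
  rootFactor q n •
    ((q : ℂ) • ∑ i : Fin n, Matrix.single i i (1 : ℂ) ⊗ₖ Matrix.single i i (1 : ℂ)
      + ∑ i : Fin n, ∑ j ∈ Finset.univ.filter (fun j => i ≠ j),
          Matrix.single i i (1 : ℂ) ⊗ₖ Matrix.single j j (1 : ℂ)
      + ((q : ℂ) - (q : ℂ)⁻¹) • ∑ i : Fin n, ∑ j ∈ Finset.univ.filter (fun j => i < j),
          Matrix.single i j (1 : ℂ) ⊗ₖ Matrix.single j i (1 : ℂ))

/-- Transposition in the second tensor factor. -/
def transpose₂ {n : ℕ} (M : Matrix (Fin n × Fin n) (Fin n × Fin n) ℂ) :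
    Matrix (Fin n × Fin n) (Fin n × Fin n) ℂ :=
  Matrix.of fun x y => M (x.1, y.2) (y.1, x.2)

/-- `R̃ = ((R^{t₂})⁻¹)^{t₂}`. -/
def tildeR (q : ℝ) (n : ℕ) : Matrix (Fin n × Fin n) (Fin n × Fin n) ℂ :=
  transpose₂ (transpose₂ (stdR q n))⁻¹

/-- The metric `g^b_a = λ_n R̃^{bc}_{ca}` (summed over `c`), as `metric q n b a`. -/
def metric (q : ℝ) (n : ℕ) : Matrix (Fin n) (Fin n) ℂ :=
  Matrix.of fun b a => lam q n * ∑ c, tildeR q n (b, c) (c, a)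

/-! ### Quantum determinants -/

/-- `ε_{σ(1)…σ(n)} = (-q)^{l(σ)}`, with `l(σ)` the number of inversions. -/
def qEps (q : ℝ) {n : ℕ} (σ : Equiv.Perm (Fin n)) : ℂ :=
  (-(q : ℂ)) ^ (Finset.univ.filter
    (fun p : Fin n × Fin n => p.1 < p.2 ∧ σ p.2 < σ p.1)).card

/-- `ε_{σ(n)…σ(1)}` -/
def qEpsRev (q : ℝ) {n : ℕ} (σ : Equiv.Perm (Fin n)) : ℂ := qEps q (Fin.revPerm.trans σ)

/-- The quantum determinant
`ν_n⁻¹ ε_{a₁…aₙ} t^{a₁}_{b₁} ⋯ t^{aₙ}_{bₙ} ε^{bₙ…b₁}` with `ν_n = ε_{a₁…aₙ} ε^{aₙ…a₁}`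
(`ε` vanishes on tuples which are not permutations). -/
def qDet (q : ℝ) {n : ℕ} {A : Type} [Ring A] [Algebra ℂ A] (t : Fin n → Fin n → A) : A :=
  (∑ σ : Equiv.Perm (Fin n), qEps q σ * qEpsRev q σ)⁻¹ •
    ∑ σ : Equiv.Perm (Fin n), ∑ τ : Equiv.Perm (Fin n),
      (qEps q σ * qEpsRev q τ) • (List.ofFn fun k => t (σ k) (τ k)).prod

/-! ### The quantum groups `U_q(n)` -/

/-- Generators `t^i_j` of `A(R_n)`, and an additional generator for `det_{q,n}*`. -/
inductive UqGen (n : ℕ) : Type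
  | t (i j : Fin n) : UqGen n
  | detStar : UqGen n

/-- The relations of `U_q(n)`: the relations
`R^{ij}_{kl} t^k_a t^l_b = t^j_l t^i_k R^{kl}_{ab}` of `A(R_n)`, and
`det det* = det* det = 1`. -/
inductive UqRel (q : ℝ) (n : ℕ) :
    FreeAlgebra ℂ (UqGen n) → FreeAlgebra ℂ (UqGen n) → Prop
  | rtt (i j a b : Fin n) : UqRel q n
      (∑ k, ∑ l, stdR q n (i, j) (k, l) •
        (FreeAlgebra.ι ℂ (UqGen.t k a) * FreeAlgebra.ι ℂ (UqGen.t l b)))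
      (∑ k, ∑ l, stdR q n (k, l) (a, b) •
        (FreeAlgebra.ι ℂ (UqGen.t j l) * FreeAlgebra.ι ℂ (UqGen.t i k)))
  | det_mul_detStar : UqRel q n
      (qDet q (fun i j => FreeAlgebra.ι ℂ (UqGen.t i j)) * FreeAlgebra.ι ℂ UqGen.detStar) 1
  | detStar_mul_det : UqRel q n
      (FreeAlgebra.ι ℂ UqGen.detStar * qDet q (fun i j => FreeAlgebra.ι ℂ (UqGen.t i j))) 1

/-- The algebra `U_q(n)`. -/
abbrev Uq (q : ℝ) (n : ℕ) : Type := RingQuot (UqRel q n)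

namespace Uq

/-- The generator `t^i_j` of `U_q(n)`. -/
def t (q : ℝ) {n : ℕ} (i j : Fin n) : Uq q n :=
  RingQuot.mkAlgHom ℂ (UqRel q n) (FreeAlgebra.ι ℂ (UqGen.t i j))

/-- The element `det_{q,n}` of `U_q(n)`. -/
def det (q : ℝ) (n : ℕ) : Uq q n := qDet q (fun i j => t q i j)

/-- The generator of `U_q(n)` which is inverse to the quantum determinant. -/
def detStar (q : ℝ) (n : ℕ) : Uq q n :=
  RingQuot.mkAlgHom ℂ (UqRel q n) (FreeAlgebra.ι ℂ UqGen.detStar)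

/-- The Hopf `*`-structure of `U_q(n)` is the one with `Δ t^i_j = t^i_k ⊗ t^k_j`,
`ε t^i_j = δ^i_j`, `(t^i_j)* = S t^j_i` and `(det_{q,n})*` the adjoined generator. As
`Δ`, `ε` are multiplicative, antipodes are unique and `*` is antimultiplicative and conjugate
linear, there is at most one such structure. -/
structure IsStandard {q : ℝ} {n : ℕ} (H : HopfStarStructure (Uq q n)) : Prop where
  comul_t : ∀ i j : Fin n, H.comul (t q i j) = ∑ k, t q i k ⊗ₜ[ℂ] t q k j
  counit_t : ∀ i j : Fin n, H.counit (t q i j) = if i = j then 1 else 0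
  star_t : ∀ i j : Fin n, H.starRing.star (t q i j) = H.antipode (t q j i)
  star_det : H.starRing.star (det q n) = detStar q n

end Uq

/-! ### Quantum spheres -/

/-- Generators `v^i` (quantum vectors) and `x_i` (quantum covectors) of `ℂ_q^n`. -/
inductive SphereGen (n : ℕ) : Type
  | v (i : Fin n) : SphereGen n
  | x (i : Fin n) : SphereGen n

/-- The relations of `S_q^{2n-1}`: those of `V(R_n)`, those of `V*(R_n)`, the cross relations of
the braided tensor product `V(R_n) ⊗ V*(R_n)` for the braiding
`Ψ(x_i ⊗ v^j) = v^k ⊗ x_l λ_n R̃^{lj}_{ik}`, and `N_{q,n} = v^a g^b_a x_b = 1`. -/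
inductive SphereRel (q : ℝ) (n : ℕ) :
    FreeAlgebra ℂ (SphereGen n) → FreeAlgebra ℂ (SphereGen n) → Prop
  | vv (i j : Fin n) : SphereRel q n
      (FreeAlgebra.ι ℂ (SphereGen.v i) * FreeAlgebra.ι ℂ (SphereGen.v j))
      (∑ k, ∑ l, ((lam q n)⁻¹ * stdR q n (i, j) (k, l)) •
        (FreeAlgebra.ι ℂ (SphereGen.v l) * FreeAlgebra.ι ℂ (SphereGen.v k)))
  | xx (i j : Fin n) : SphereRel q n
      (FreeAlgebra.ι ℂ (SphereGen.x i) * FreeAlgebra.ι ℂ (SphereGen.x j))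
      (∑ k, ∑ l, ((lam q n)⁻¹ * stdR q n (k, l) (i, j)) •
        (FreeAlgebra.ι ℂ (SphereGen.x l) * FreeAlgebra.ι ℂ (SphereGen.x k)))
  | xv (i j : Fin n) : SphereRel q n
      (FreeAlgebra.ι ℂ (SphereGen.x i) * FreeAlgebra.ι ℂ (SphereGen.v j))
      (∑ k, ∑ l, (lam q n * tildeR q n (l, j) (i, k)) •
        (FreeAlgebra.ι ℂ (SphereGen.v k) * FreeAlgebra.ι ℂ (SphereGen.x l)))
  | norm : SphereRel q n
      (∑ a, ∑ b, metric q n b a •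
        (FreeAlgebra.ι ℂ (SphereGen.v a) * FreeAlgebra.ι ℂ (SphereGen.x b))) 1

/-- The quantum sphere `S_q^{2n-1}`. -/
abbrev Sphere (q : ℝ) (n : ℕ) : Type := RingQuot (SphereRel q n)

namespace Sphere

/-- The generator `v^i` of the quantum sphere. -/
def v (q : ℝ) {n : ℕ} (i : Fin n) : Sphere q n :=
  RingQuot.mkAlgHom ℂ (SphereRel q n) (FreeAlgebra.ι ℂ (SphereGen.v i))

/-- The generator `x_i` of the quantum sphere. -/
def x (q : ℝ) {n : ℕ} (i : Fin n) : Sphere q n :=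
  RingQuot.mkAlgHom ℂ (SphereRel q n) (FreeAlgebra.ι ℂ (SphereGen.x i))

end Sphere

/-- The defining values of the map `α : U_q(n+1) → U_q(n)` on generators:
`t^1_1 ↦ 1`, `t^1_i, t^i_1 ↦ 0` for `i > 1`, and `t^{i+1}_{j+1} ↦ t^i_j`. -/
structure IsRestriction {q : ℝ} {n : ℕ} (α : Uq q (n + 1) →ₐ[ℂ] Uq q n) : Prop where
  zero_zero : α (Uq.t q 0 0) = 1
  zero_succ : ∀ i : Fin n, α (Uq.t q 0 i.succ) = 0
  succ_zero : ∀ i : Fin n, α (Uq.t q i.succ 0) = 0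
  succ_succ : ∀ i j : Fin n, α (Uq.t q i.succ j.succ) = Uq.t q i j

end QBundle

end

noncomputable section

namespace QBundle

set_option linter.unusedSectionVars false

/-! ### The normalised `R`-matrix -/

/-! Up to a scalar that cancels, the relations R T₁T₂ = T₂T₁R are the four quadratic relations of
`IsQMatrix`. They make ∑_c ε(c) t^{r₁}_{c₁}⋯t^{rₙ}_{cₙ} alternate in the rows r
(`IsQMatrix.rowSum_eq`). Hence the determinant is multiplicative and has Laplace expansions, and the
matrix of generators has a two-sided inverse with entries `s`. The universal property of U_q(n) then
yields Δ, ε, S, α and, over the conjugate of the opposite algebra, the involution.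

Freeness and exactness. The map u ⊗ w ↦ u₁ ⊗ u₂w of P ⊗ P has the inverse u ⊗ w ↦ u₁ ⊗ S(u₂)w, and χ
is this map followed by α ⊗ id. So ker χ is spanned by the elements x₁ ⊗ S(x₂)w with x in ker α. As
a left ideal, ker α is generated by the elements t 0 j − δ and s j 0 − δ
(`Uq.mem_of_restrict_eq_zero`): modulo these, every vector satisfies the same equations as the class
of 1, so the action factors through α. For these generators, x₁ ⊗ S(x₂) is visibly horizontal over
the subalgebra C generated by the first row t 0 j and the first column s j 0.

The sphere. After rescaling and reversal of the order, this row and column satisfy the relations of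
the sphere, which therefore maps onto C. Injectivity comes from a representation by weighted shifts
of a lattice, an iterated product of 2 × 2 blocks. Put x_i = t 0 i, v_i = s i 0 and T_k = ∑_{l ≥ k}
x_l v_l. The x_i and T_k act by shifts, and x_i v_i = T_i − T_{i+1} gives v_i a leading term.
Monomials in T_k, x_i, v_i span the sphere and have different leading degrees, so even a single
vector separates its elements (`IsSpherePair.eq_zero_of_map_eq_zero`).

The coinvariants are C. For b coinvariant, b ⊗ 1 − 1 ⊗ b lies in ker χ, so it is horizontal over C.
The shift representation provides a map E from P to C which is C-linear on the finitely many
elements involved and has E(1) ≠ 0; applying it to the second factor and multiplying gives b E(1) =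
E(b). So coinvariants have right denominators in C (`Uq.exists_mul_mem_sphereSubalgebra`). If V is
the subcomodule generated by b, then {p ∈ C : Vp ⊆ C} is a nonzero right ideal of C and a
subcomodule. Such an ideal contains 1 (`Uq.one_mem_of_act_mem`), because it contains a family y_a
with unitary matrix coefficients for which ∑ y_a y_a* is a positive scalar. Hence b lies in C. -/

/-- Diagonal coefficients of the normalised `R`-matrix. -/
def dg (q : ℝ) {n : ℕ} (i j : Fin n) : ℂ := if i = j then (q : ℂ) else 1

/-- The coefficient `q - q⁻¹`. -/
def wq (q : ℝ) : ℂ := (q : ℂ) - (q : ℂ)⁻¹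

/-- The normalised `R`-matrix. -/
def normR (q : ℝ) (n : ℕ) : Matrix (Fin n × Fin n) (Fin n × Fin n) ℂ :=
  Matrix.of fun x y => (if x = y then dg q x.1 x.2 else 0) +
    if x.1 < x.2 ∧ x.1 = y.2 ∧ x.2 = y.1 then wq q else 0

theorem normR_apply (q : ℝ) {n : ℕ} (i j k l : Fin n) :
    normR q n (i, j) (k, l) = (if i = k ∧ j = l then dg q i j else 0) +
      if i < j ∧ i = l ∧ j = k then wq q else 0 := by
  simp [normR, Prod.ext_iff]

/-- The root q^{-1/n} is a common factor of both sides of the RTT relations, so all computations can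
use `normR`, whose entries are rational in q. -/
theorem stdR_eq (q : ℝ) (n : ℕ) : stdR q n = rootFactor q n • normR q n := by
  unfold stdR
  congr 1
  ext ⟨i, j⟩ ⟨k, l⟩
  rw [normR_apply]
  have h1 : (∑ i' : Fin n, Matrix.single i' i' (1 : ℂ) ⊗ₖ Matrix.single i' i' (1 : ℂ)) (i, j) (k, l)
      = if i = k ∧ j = l ∧ i = j then 1 else 0 := by
    rw [Matrix.sum_apply, Finset.sum_eq_single i]
    · simp only [Matrix.kroneckerMap_apply, Matrix.single_apply]
      split_ifs <;> grind
    · intro b _ hb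
      simp [Matrix.kroneckerMap_apply, Matrix.single_apply, hb]
    · simp
  have h2 : (∑ i' : Fin n, ∑ j' ∈ Finset.univ.filter (fun j => i' ≠ j),
      Matrix.single i' i' (1 : ℂ) ⊗ₖ Matrix.single j' j' (1 : ℂ)) (i, j) (k, l)
      = if i = k ∧ j = l ∧ i ≠ j then 1 else 0 := by
    rw [Matrix.sum_apply, Finset.sum_eq_single i]
    · rw [Matrix.sum_apply, Finset.sum_filter, Finset.sum_eq_single j]
      · simp only [Matrix.kroneckerMap_apply, Matrix.single_apply]
        split_ifs <;> grind
      · intro b _ hb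
        simp [Matrix.kroneckerMap_apply, Matrix.single_apply, hb]
      · simp
    · intro b _ hb
      rw [Matrix.sum_apply]
      exact Finset.sum_eq_zero fun c _ => by
        simp [Matrix.kroneckerMap_apply, Matrix.single_apply, hb]
    · simp
  have h3 : (∑ i' : Fin n, ∑ j' ∈ Finset.univ.filter (fun j => i' < j),
      Matrix.single i' j' (1 : ℂ) ⊗ₖ Matrix.single j' i' (1 : ℂ)) (i, j) (k, l)
      = if i < j ∧ i = l ∧ j = k then 1 else 0 := by
    rw [Matrix.sum_apply, Finset.sum_eq_single i]
    · rw [Matrix.sum_apply, Finset.sum_filter, Finset.sum_eq_single j]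
      · simp only [Matrix.kroneckerMap_apply, Matrix.single_apply]
        split_ifs <;> grind
      · intro b _ hb
        simp [Matrix.kroneckerMap_apply, Matrix.single_apply, hb]
      · simp
    · intro b _ hb
      rw [Matrix.sum_apply]
      exact Finset.sum_eq_zero fun c _ => by
        simp [Matrix.kroneckerMap_apply, Matrix.single_apply, hb]
    · simp
  rw [Matrix.add_apply, Matrix.add_apply, Matrix.smul_apply, Matrix.smul_apply, h1, h2, h3]
  unfold dg wq
  by_cases hij : i = j <;> simp [hij]

section Sums

variable {M : Type*} [AddCommGroup M] [Module ℂ M] (q : ℝ) {n : ℕ}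

theorem sum_normR_left (f : Fin n → Fin n → M) (i j : Fin n) :
    ∑ k, ∑ l, normR q n (i, j) (k, l) • f k l =
      dg q i j • f i j + if i < j then wq q • f j i else 0 := by
  simp only [normR_apply, add_smul, Finset.sum_add_distrib]
  congr 1
  · rw [Finset.sum_eq_single i, Finset.sum_eq_single j] <;> simp +contextual [eq_comm]
  · rw [Finset.sum_eq_single j, Finset.sum_eq_single i] <;> simp +contextual [eq_comm, ite_smul]

theorem sum_normR_right (f : Fin n → Fin n → M) (a b : Fin n) :
    ∑ k, ∑ l, normR q n (k, l) (a, b) • f k l =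
      dg q a b • f a b + if b < a then wq q • f b a else 0 := by
  simp only [normR_apply, add_smul, Finset.sum_add_distrib]
  congr 1
  · rw [Finset.sum_eq_single a, Finset.sum_eq_single b] <;> simp +contextual [eq_comm]
  · rw [Finset.sum_eq_single b, Finset.sum_eq_single a] <;> simp +contextual [eq_comm, ite_smul]

end Sums

theorem rootFactor_ne_zero {q : ℝ} (hq : q ≠ 0) (n : ℕ) : rootFactor q n ≠ 0 := by
  simp [rootFactor, Complex.cpow_eq_zero_iff, hq]

/-! ### Quantum matrices -/

/-- The relations between the entries of a quantum matrix. -/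
structure IsQMatrix (q : ℝ) {n : ℕ} {A : Type*} [Ring A] [Algebra ℂ A] (t : Fin n → Fin n → A) :
    Prop where
  row : ∀ i {a b}, a < b → t i b * t i a = (q : ℂ) • (t i a * t i b)
  col : ∀ {i j} a, i < j → t j a * t i a = (q : ℂ) • (t i a * t j a)
  comm : ∀ {i j a b}, i < j → a < b → t i b * t j a = t j a * t i b
  cross : ∀ {i j a b}, i < j → a < b → t j b * t i a = t i a * t j b + wq q • (t j a * t i b)

section QMatrix

variable {q : ℝ} {n : ℕ} {A : Type*} [Ring A] [Algebra ℂ A] {t : Fin n → Fin n → A}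

/-- Rows and columns play symmetric roles in the four relations; for `cross` the two mixed factors
commute by `comm`. -/
theorem IsQMatrix.transpose (h : IsQMatrix q t) : IsQMatrix q fun i j => t j i where
  row i _ _ hab := h.col i hab
  col a hij := h.row a hij
  comm hij hab := (h.comm hab hij).symm
  cross hij hab := by rw [h.cross hab hij, ← h.comm hab hij]

theorem IsQMatrix.map {B : Type*} [Ring B] [Algebra ℂ B] (h : IsQMatrix q t) (f : A →ₐ[ℂ] B) :
    IsQMatrix q fun i j => f (t i j) where
  row i _ _ hab := by rw [← map_mul, h.row i hab, map_smul, map_mul]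
  col a hij := by rw [← map_mul, h.col a hij, map_smul, map_mul]
  comm hij hab := by rw [← map_mul, h.comm hij hab, map_mul]
  cross hij hab := by rw [← map_mul, h.cross hij hab, map_add, map_smul, map_mul, map_mul]

theorem IsQMatrix.submatrix {m : ℕ} (h : IsQMatrix q t) {f : Fin m → Fin n} (hf : StrictMono f) :
    IsQMatrix q fun i j => t (f i) (f j) where
  row _ _ _ hab := h.row _ (hf hab)
  col _ hij := h.col _ (hf hij)
  comm hij hab := h.comm (hf hij) (hf hab)
  cross hij hab := h.cross (hf hij) (hf hab)

/-- The relations of a quantum matrix in the form `R T₁ T₂ = T₂ T₁ R`. -/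
def RTT (q : ℝ) (t : Fin n → Fin n → A) : Prop := ∀ i j a b,
  dg q i j • (t i a * t j b) + (if i < j then wq q • (t j a * t i b) else 0) =
    dg q a b • (t j b * t i a) + if b < a then wq q • (t j a * t i b) else 0

/-- Because q − (q − q⁻¹) = q⁻¹. In this form the RTT relation contains the column relation for i <
j and a = b, and likewise the row relation. -/
theorem smul_eq_iff_inv_add (hq : q ≠ 0) (x y : A) :
    x + wq q • y = (q : ℂ) • y ↔ y = (q : ℂ) • x := by
  have hq' : (q : ℂ) ≠ 0 := by exact_mod_cast hq
  have : x + wq q • y = (q : ℂ) • y ↔ x = (q : ℂ)⁻¹ • y := by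
    rw [← eq_sub_iff_add_eq, ← sub_smul, wq, sub_sub_cancel]
  rw [this, eq_inv_smul_iff₀ hq', eq_comm]

/-- The nine relative orders of (i, j) and (a, b) repeat the four kinds of relations. For the
converse one instance of each kind is enough; for `comm` the terms with q − q⁻¹ on the two sides
cancel. -/
theorem isQMatrix_iff (hq : q ≠ 0) : IsQMatrix q t ↔ RTT q t := by
  constructor
  · intro h i j a b
    rcases lt_trichotomy i j with hij | rfl | hij <;> rcases lt_trichotomy a b with hab | rfl | hab
    · simp [dg, hij, hij.ne, hab.ne, hab.not_gt, h.cross hij hab]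
    · simpa [dg, hij, hij.ne] using (smul_eq_iff_inv_add hq _ _).2 (h.col a hij)
    · simp [dg, hij, hab, hij.ne, hab.ne', h.comm hij hab]
    · simp [dg, hab.ne, hab.not_gt, h.row i hab]
    · simp [dg]
    · have := (smul_eq_iff_inv_add hq _ _).2 (h.row i hab)
      simpa [dg, hab, hab.ne'] using this.symm
    · simp [dg, hij.ne', hab.ne, hij.not_gt, hab.not_gt, h.comm hij hab]
    · simp [dg, hij.ne', hij.not_gt, h.col a hij]
    · simp [dg, hab, hij.ne', hab.ne', hij.not_gt, h.cross hij hab, h.comm hij hab]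
  · intro h
    constructor
    · intro i a b hab
      simpa [dg, hab.ne, hab.not_gt] using (h i i a b).symm
    · intro i j a hij
      refine (smul_eq_iff_inv_add hq _ _).1 ?_
      simpa [dg, hij, hij.ne] using h i j a a
    · intro i j a b hij hab
      simpa [dg, hij, hab, hij.ne', hij.ne, hab.ne', hab.ne, hij.not_gt, hab.not_gt] using h i j b a
    · intro i j a b hij hab
      simpa [dg, hij, hab, hij.ne', hij.ne, hab.ne', hab.ne, hij.not_gt, hab.not_gt] using
        (h i j a b).symm

/-- The relations of `A(R_n)` in their original form. -/
theorem isQMatrix_iff_stdR (hq : q ≠ 0) : IsQMatrix q t ↔ ∀ i j a b,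
    ∑ k, ∑ l, stdR q n (i, j) (k, l) • (t k a * t l b) =
      ∑ k, ∑ l, stdR q n (k, l) (a, b) • (t j l * t i k) := by
  rw [isQMatrix_iff hq]
  refine forall_congr' fun i => forall_congr' fun j => forall_congr' fun a => forall_congr' fun b =>
    ?_
  simp only [stdR_eq, Matrix.smul_apply, smul_eq_mul, mul_smul, ← Finset.smul_sum]
  rw [smul_right_inj (rootFactor_ne_zero hq n),
    sum_normR_left q (fun k l => t k a * t l b), sum_normR_right q (fun k l => t j l * t i k)]

end QMatrix

/-! ### Inversions and the `ε`-tensor -/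

/-- The number of inversions of a tuple. -/
def inversions {n m : ℕ} (c : Fin n → Fin m) : ℕ :=
  (Finset.univ.filter (fun p : Fin n × Fin n => p.1 < p.2 ∧ c p.2 < c p.1)).card

/-- The `ε`-tensor with weights `(-q)^{-l}`, which vanishes on tuples with repetitions. -/
def qSign (q : ℝ) {n m : ℕ} (c : Fin n → Fin m) : ℂ :=
  open Classical in if Function.Injective c then ((-(q : ℂ))⁻¹) ^ inversions c else 0

theorem swap_lt_swap_of_adjacent {n : ℕ} {k k' i j : Fin n} (hk : (k' : ℕ) = k + 1) (hij : i < j)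
    (h : ¬(i = k ∧ j = k')) : Equiv.swap k k' i < Equiv.swap k k' j := by
  simp only [Equiv.swap_apply_def, Fin.ext_iff, Fin.lt_def] at *
  split_ifs <;> omega

/-- An adjacent transposition reverses the order of the pair (k, k') only, so it matches the other
inversions of the two tuples bijectively. -/
theorem inversions_swap {n m : ℕ} {c : Fin n → Fin m} {k k' : Fin n} (hk : (k' : ℕ) = k + 1)
    (hc : c k' < c k) : inversions (c ∘ Equiv.swap k k') + 1 = inversions c := by
  have hkk : k < k' := by simp [Fin.lt_def, hk]
  have hmem : (k, k') ∈ Finset.univ.filter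
      (fun p : Fin n × Fin n => p.1 < p.2 ∧ c p.2 < c p.1) := by simp [hkk, hc]
  unfold inversions
  rw [← Finset.card_erase_add_one hmem]
  congr 1
  refine Finset.card_bij (fun p _ => (Equiv.swap k k' p.1, Equiv.swap k k' p.2)) ?_ ?_ ?_
  · rintro ⟨i, j⟩ h
    simp only [Finset.mem_filter, Finset.mem_univ, true_and, Function.comp_apply,
      Finset.mem_erase, ne_eq, Prod.mk.injEq] at h ⊢
    have hne : ¬(i = k ∧ j = k') := by
      rintro ⟨rfl, rfl⟩
      simp only [Equiv.swap_apply_left, Equiv.swap_apply_right] at h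
      exact absurd h.2 hc.not_gt
    refine ⟨?_, swap_lt_swap_of_adjacent hk h.1 hne, h.2⟩
    rintro ⟨h1, h2⟩
    rw [Equiv.swap_apply_eq_iff, Equiv.swap_apply_left] at h1
    rw [Equiv.swap_apply_eq_iff, Equiv.swap_apply_right] at h2
    exact absurd h.1 (by rw [h1, h2]; exact hkk.not_gt)
  · rintro ⟨i, j⟩ _ ⟨i', j'⟩ _ h
    simpa using h
  · rintro ⟨i, j⟩ h
    simp only [Finset.mem_filter, Finset.mem_univ, true_and, Function.comp_apply,
      Finset.mem_erase, ne_eq, Prod.mk.injEq] at h ⊢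
    refine ⟨(Equiv.swap k k' i, Equiv.swap k k' j), ?_, by simp⟩
    simp only [Equiv.swap_apply_self]
    exact ⟨swap_lt_swap_of_adjacent hk h.2.1 h.1, h.2.2⟩

section qSign

variable {q : ℝ} {n m : ℕ} {c : Fin n → Fin m} {k k' : Fin n}

theorem qSign_of_injective (q : ℝ) (hc : Function.Injective c) :
    qSign q c = ((-(q : ℂ))⁻¹) ^ inversions c := by
  simp [qSign, hc]

theorem qSign_of_not_injective (q : ℝ) (hc : ¬Function.Injective c) : qSign q c = 0 := by
  simp [qSign, hc]

theorem qSign_swap_of_gt (q : ℝ) (hk : (k' : ℕ) = k + 1) (hc : c k' < c k) :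
    qSign q c = (-(q : ℂ))⁻¹ * qSign q (c ∘ Equiv.swap k k') := by
  by_cases h : Function.Injective c
  · rw [qSign_of_injective q h, qSign_of_injective q (h.comp (Equiv.injective _)),
      ← inversions_swap hk hc, pow_succ, mul_comm]
  · rw [qSign_of_not_injective q h, qSign_of_not_injective, mul_zero]
    rwa [Equiv.injective_comp]

theorem qSign_swap_of_lt (q : ℝ) (hk : (k' : ℕ) = k + 1) (hc : c k < c k') :
    qSign q (c ∘ Equiv.swap k k') = (-(q : ℂ))⁻¹ * qSign q c := by
  have := qSign_swap_of_gt q (c := c ∘ Equiv.swap k k') hk (by simpa using hc)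
  rwa [Function.comp_assoc, ← Equiv.coe_trans, Equiv.swap_swap, Equiv.coe_refl,
    Function.comp_id] at this

theorem qSign_eq_zero (q : ℝ) (hkk : k ≠ k') (hc : c k = c k') : qSign q c = 0 :=
  qSign_of_not_injective q fun h => hkk (h hc)

theorem inversions_eq_zero (hc : StrictMono c) : inversions c = 0 := by
  unfold inversions
  rw [Finset.card_eq_zero, Finset.filter_eq_empty_iff]
  rintro ⟨i, j⟩ _ ⟨h1, h2⟩
  exact absurd (hc h1) h2.not_gt

theorem qSign_strictMono (q : ℝ) (hc : StrictMono c) : qSign q c = 1 := by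
  rw [qSign_of_injective q hc.injective, inversions_eq_zero hc, pow_zero]

end qSign

/-- A function of tuples which changes by the same factors as the `ε`-tensor under adjacent
transpositions is a multiple of the `ε`-tensor. -/
theorem eq_qSign_smul {M : Type*} [AddCommGroup M] [Module ℂ M] (q : ℝ) {n : ℕ}
    (F : (Fin n → Fin n) → M)
    (h0 : ∀ r (k k' : Fin n), (k' : ℕ) = k + 1 → r k = r k' → F r = 0)
    (h1 : ∀ r (k k' : Fin n), (k' : ℕ) = k + 1 → r k' < r k →
      F r = (-(q : ℂ))⁻¹ • F (r ∘ Equiv.swap k k')) (r : Fin n → Fin n) :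
    F r = qSign q r • F id := by
  -- Bubble sort: a tuple that is not increasing has adjacent entries which are equal or descending.
  -- Equal entries kill both sides, and exchanging a descent lowers the number of inversions. The
  -- only increasing self-map of `Fin n` is the identity.
  induction h : inversions r using Nat.strong_induction_on generalizing r with
  | _ N ih =>
    by_cases hr : StrictMono r
    · have : r = id := by
        have := Subsingleton.elim (hr.orderIsoOfSurjective r
          (Finite.injective_iff_surjective.1 hr.injective)) (OrderIso.refl _)
        ext i
        simpa using congrArg (fun f : Fin n ≃o Fin n => (f i : ℕ)) this
      rw [this, qSign_strictMono q strictMono_id, one_smul]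
    · obtain ⟨k, k', hk, hle⟩ : ∃ k k' : Fin n, (k' : ℕ) = k + 1 ∧ r k' ≤ r k := by
        by_contra! hcon
        apply hr
        cases n with
        | zero => exact fun i => i.elim0
        | succ n => exact Fin.strictMono_iff_lt_succ.2 fun i => hcon _ _ (by simp)
      rcases hle.eq_or_lt with heq | hlt
      · rw [h0 r k k' hk heq.symm, qSign_eq_zero q (k := k) (k' := k') _ heq.symm, zero_smul]
        simp [Fin.ext_iff, hk]
      · have := inversions_swap hk hlt
        rw [h1 r k k' hk hlt, ih _ (by omega) _ rfl, smul_smul, ← qSign_swap_of_gt q hk hlt]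

/-- Isolating two adjacent factors of an ordered product. -/
theorem exists_prod_ofFn_eq {A : Type*} [Ring A] {n : ℕ} (f : Fin n → A) {k k' : Fin n}
    (hk : (k' : ℕ) = k + 1) :
    ∃ P Q : A, ∀ g : Fin n → A, (∀ i, i ≠ k → i ≠ k' → g i = f i) →
      (List.ofFn g).prod = P * (g k * g k') * Q := by
  induction n with
  | zero => exact k.elim0
  | succ n ih =>
    cases k using Fin.cases with
    | zero =>
      cases n with
      | zero => simp at hk
      | succ n =>
        have hk' : k' = 1 := by ext; simpa using hk
        subst hk'
        refine ⟨1, (List.ofFn fun i => f i.succ.succ).prod, fun g hg => ?_⟩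
        rw [List.ofFn_succ, List.ofFn_succ, List.prod_cons, List.prod_cons, one_mul, mul_assoc]
        have : (fun i : Fin n => g i.succ.succ) = fun i => f i.succ.succ :=
          funext fun i => hg _ (Fin.succ_ne_zero _) (by simp [Fin.ext_iff])
        rw [this]
        rfl
    | succ k =>
      cases k' using Fin.cases with
      | zero => simp at hk
      | succ k' =>
        obtain ⟨P, Q, h⟩ := ih (fun i => f i.succ) (k := k) (k' := k') (by simpa using hk)
        refine ⟨f 0 * P, Q, fun g hg => ?_⟩
        rw [List.ofFn_succ, List.prod_cons, h (fun i => g i.succ)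
          (fun i h1 h2 => hg _ (by simpa using h1) (by simpa using h2)),
          hg 0 (Fin.succ_ne_zero _).symm (Fin.succ_ne_zero _).symm]
        simp only [mul_assoc]

/-! ### Alternation of the quantum determinant in its rows. -/

section Det

variable {q : ℝ} {n : ℕ} {A : Type*} [Ring A] [Algebra ℂ A] {t : Fin n → Fin n → A}

/-- The quantum minor-like sum `∑_c ε(c) t^{r₁}_{c₁} ⋯ t^{rₙ}_{cₙ}`. -/
def rowSum (q : ℝ) {m : ℕ} (t : Fin n → Fin n → A) (r : Fin m → Fin n) : A :=
  ∑ c : Fin m → Fin n, qSign q c • (List.ofFn fun k => t (r k) (c k)).prod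

/-- The row form of the quantum determinant. -/
def rowDet (q : ℝ) (t : Fin n → Fin n → A) : A := rowSum q t id

theorem neg_inv_ne_zero (hq : q ≠ 0) : (-(q : ℂ))⁻¹ ≠ 0 := by
  simpa using hq

/-- The column tuples c and c ∘ (k k') cancel: within a single row the reordering costs a factor q,
while the weights differ by −q⁻¹. -/
theorem IsQMatrix.rowSum_eq_zero (h : IsQMatrix q t) (hq : q ≠ 0) {r : Fin n → Fin n}
    {k k' : Fin n} (hk : (k' : ℕ) = k + 1) (hr : r k = r k') : rowSum q t r = 0 := by
  have hq' : (q : ℂ) ≠ 0 := by exact_mod_cast hq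
  have hkk : k ≠ k' := by simp [Fin.ext_iff, hk]
  have key : ∀ c : Fin n → Fin n, c k < c k' →
      qSign q c • (List.ofFn fun i => t (r i) (c i)).prod +
      qSign q (c ∘ Equiv.swap k k') •
        (List.ofFn fun i => t (r i) ((c ∘ Equiv.swap k k') i)).prod = 0 := by
    intro c hc
    obtain ⟨P, Q, hPQ⟩ := exists_prod_ofFn_eq (fun i => t (r i) (c i)) hk
    rw [hPQ (fun i => t (r i) (c i)) (fun _ _ _ => rfl),
      hPQ (fun i => t (r i) ((c ∘ Equiv.swap k k') i)) (fun i h1 h2 => by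
        simp [Equiv.swap_apply_of_ne_of_ne h1 h2])]
    simp only [Function.comp_apply, Equiv.swap_apply_left, Equiv.swap_apply_right]
    rw [qSign_swap_of_lt q hk hc, ← hr, h.row _ hc, mul_smul_comm, smul_mul_assoc, smul_smul,
      ← add_smul]
    convert zero_smul ℂ _
    field_simp
    ring
  unfold rowSum
  refine Finset.sum_involution (fun c _ => c ∘ Equiv.swap k k') ?_ ?_ (by simp) ?_
  · intro c _
    rcases lt_trichotomy (c k) (c k') with hc | hc | hc
    · exact key c hc
    · rw [qSign_eq_zero q hkk hc, qSign_eq_zero q hkk (by simp [hc])]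
      simp
    · have := key (c ∘ Equiv.swap k k') (by simpa using hc)
      rw [Function.comp_assoc, ← Equiv.coe_trans, Equiv.swap_swap, Equiv.coe_refl,
        Function.comp_id] at this
      rwa [add_comm]
  · intro c _ hne heq
    refine hne ?_
    have := congrFun heq k
    simp only [Function.comp_apply, Equiv.swap_apply_left] at this
    rw [qSign_eq_zero q hkk this.symm, zero_smul]
  · intro c _
    rw [Function.comp_assoc, ← Equiv.coe_trans, Equiv.swap_swap, Equiv.coe_refl, Function.comp_id]

/-- The difference of both sides cancels over the pairs {c, c ∘ (k k')}. The term with q − q⁻¹ in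
`cross` accounts exactly for the difference of the weights of the products that `comm` identifies.
-/
theorem IsQMatrix.rowSum_swap (h : IsQMatrix q t) (hq : q ≠ 0) {r : Fin n → Fin n}
    {k k' : Fin n} (hk : (k' : ℕ) = k + 1) (hr : r k' < r k) :
    rowSum q t r = (-(q : ℂ))⁻¹ • rowSum q t (r ∘ Equiv.swap k k') := by
  have hq' : (q : ℂ) ≠ 0 := by exact_mod_cast hq
  have hkk : k ≠ k' := by simp [Fin.ext_iff, hk]
  set X : (Fin n → Fin n) → A := fun c => qSign q c • (List.ofFn fun i => t (r i) (c i)).prod -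
    (-(q : ℂ))⁻¹ • qSign q c • (List.ofFn fun i => t ((r ∘ Equiv.swap k k') i) (c i)).prod with hX
  have key : ∀ c : Fin n → Fin n, c k < c k' → X c + X (c ∘ Equiv.swap k k') = 0 := by
    intro c hc
    obtain ⟨P, Q, hPQ⟩ := exists_prod_ofFn_eq (fun i => t (r i) (c i)) hk
    simp only [hX]
    rw [hPQ (fun i => t (r i) (c i)) (fun _ _ _ => rfl),
      hPQ (fun i => t ((r ∘ Equiv.swap k k') i) (c i)) (fun i h1 h2 => by
        simp [Equiv.swap_apply_of_ne_of_ne h1 h2]),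
      hPQ (fun i => t (r i) ((c ∘ Equiv.swap k k') i)) (fun i h1 h2 => by
        simp [Equiv.swap_apply_of_ne_of_ne h1 h2]),
      hPQ (fun i => t ((r ∘ Equiv.swap k k') i) ((c ∘ Equiv.swap k k') i)) (fun i h1 h2 => by
        simp [Equiv.swap_apply_of_ne_of_ne h1 h2])]
    simp only [Function.comp_apply, Equiv.swap_apply_left, Equiv.swap_apply_right]
    rw [qSign_swap_of_lt q hk hc, ← h.comm hr hc, h.cross hr hc]
    simp only [mul_add, add_mul, mul_smul_comm, smul_mul_assoc, smul_add, smul_smul]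
    rw [← h.comm hr hc]
    match_scalars
    · unfold wq
      field_simp
      ring
    · ring
  rw [← sub_eq_zero]
  have : rowSum q t r - (-(q : ℂ))⁻¹ • rowSum q t (r ∘ Equiv.swap k k') = ∑ c, X c := by
    simp only [rowSum, hX, Finset.sum_sub_distrib, Finset.smul_sum]
  rw [this]
  refine Finset.sum_involution (fun c _ => c ∘ Equiv.swap k k') ?_ ?_ (by simp) ?_
  · intro c _
    rcases lt_trichotomy (c k) (c k') with hc | hc | hc
    · exact key c hc
    · simp only [hX]
      rw [qSign_eq_zero q hkk hc, qSign_eq_zero q hkk (by simp [hc])]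
      simp
    · have := key (c ∘ Equiv.swap k k') (by simpa using hc)
      rw [Function.comp_assoc, ← Equiv.coe_trans, Equiv.swap_swap, Equiv.coe_refl,
        Function.comp_id] at this
      rwa [add_comm]
  · intro c _ hne heq
    refine hne ?_
    have := congrFun heq k
    simp only [Function.comp_apply, Equiv.swap_apply_left] at this
    simp only [hX]
    rw [qSign_eq_zero q hkk this.symm, zero_smul, zero_smul, smul_zero, sub_zero]
  · intro c _
    rw [Function.comp_assoc, ← Equiv.coe_trans, Equiv.swap_swap, Equiv.coe_refl, Function.comp_id]

/-- Rows enter only through their sign. Multiplicativity, Laplace expansion and invariance under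
transposition all follow from this. -/
theorem IsQMatrix.rowSum_eq (h : IsQMatrix q t) (hq : q ≠ 0) (r : Fin n → Fin n) :
    rowSum q t r = qSign q r • rowDet q t :=
  eq_qSign_smul q (rowSum q t) (fun _ _ _ hk hr => h.rowSum_eq_zero hq hk hr)
    (fun _ _ _ hk hr => h.rowSum_swap hq hk hr) r

end Det

/-! ### Matrix form of the relations -/

section MatrixForm

variable {q : ℝ} {n : ℕ} {A : Type*} [Ring A] [Algebra ℂ A]

/-- The normalised `R`-matrix over an algebra. -/
def algR (q : ℝ) (n : ℕ) (A : Type*) [Ring A] [Algebra ℂ A] :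
    Matrix (Fin n × Fin n) (Fin n × Fin n) A :=
  (normR q n).map (algebraMap ℂ A)

/-- The matrix `t` acting in the first leg. -/
def legOne (t : Matrix (Fin n) (Fin n) A) : Matrix (Fin n × Fin n) (Fin n × Fin n) A :=
  Matrix.of fun x y => if x.2 = y.2 then t x.1 y.1 else 0

/-- The matrix `t` acting in the second leg. -/
def legTwo (t : Matrix (Fin n) (Fin n) A) : Matrix (Fin n × Fin n) (Fin n × Fin n) A :=
  Matrix.of fun x y => if x.1 = y.1 then t x.2 y.2 else 0

theorem legOne_mul (t u : Matrix (Fin n) (Fin n) A) : legOne t * legOne u = legOne (t * u) := by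
  ext ⟨i, j⟩ ⟨a, b⟩
  simp [legOne, Matrix.mul_apply, Fintype.sum_prod_type, Finset.sum_ite_irrel]

theorem legTwo_mul (t u : Matrix (Fin n) (Fin n) A) : legTwo t * legTwo u = legTwo (t * u) := by
  ext ⟨i, j⟩ ⟨a, b⟩
  simp [legTwo, Matrix.mul_apply, Fintype.sum_prod_type, Finset.sum_ite_irrel]

theorem legOne_one : legOne (1 : Matrix (Fin n) (Fin n) A) = 1 := by
  ext ⟨i, j⟩ ⟨a, b⟩
  simp only [legOne, Matrix.of_apply, Matrix.one_apply, Prod.mk.injEq]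
  split_ifs <;> grind

theorem legTwo_one : legTwo (1 : Matrix (Fin n) (Fin n) A) = 1 := by
  ext ⟨i, j⟩ ⟨a, b⟩
  simp only [legTwo, Matrix.of_apply, Matrix.one_apply, Prod.mk.injEq]
  split_ifs <;> grind

theorem legOne_mul_legTwo_apply (t u : Matrix (Fin n) (Fin n) A) (i j a b : Fin n) :
    (legOne t * legTwo u) (i, j) (a, b) = t i a * u j b := by
  simp [legOne, legTwo, Matrix.mul_apply, Fintype.sum_prod_type]

theorem legTwo_mul_legOne_apply (t u : Matrix (Fin n) (Fin n) A) (i j a b : Fin n) :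
    (legTwo u * legOne t) (i, j) (a, b) = u j b * t i a := by
  simp [legOne, legTwo, Matrix.mul_apply, Fintype.sum_prod_type]

theorem legOne_comm_legTwo {t u : Matrix (Fin n) (Fin n) A}
    (h : ∀ i j k l, Commute (t i j) (u k l)) : legOne t * legTwo u = legTwo u * legOne t := by
  ext ⟨i, j⟩ ⟨a, b⟩
  rw [legOne_mul_legTwo_apply, legTwo_mul_legOne_apply, (h i a j b).eq]

theorem algR_mul_apply (X : Matrix (Fin n × Fin n) (Fin n × Fin n) A) (i j a b : Fin n) :
    (algR q n A * X) (i, j) (a, b) = dg q i j • X (i, j) (a, b) +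
      if i < j then wq q • X (j, i) (a, b) else 0 := by
  rw [Matrix.mul_apply, Fintype.sum_prod_type]
  simp only [algR, Matrix.map_apply, ← Algebra.smul_def]
  exact sum_normR_left q (fun k l => X (k, l) (a, b)) i j

theorem mul_algR_apply (X : Matrix (Fin n × Fin n) (Fin n × Fin n) A) (i j a b : Fin n) :
    (X * algR q n A) (i, j) (a, b) = dg q a b • X (i, j) (a, b) +
      if b < a then wq q • X (i, j) (b, a) else 0 := by
  rw [Matrix.mul_apply, Fintype.sum_prod_type]
  simp only [algR, Matrix.map_apply, ← Algebra.commutes, ← Algebra.smul_def]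
  exact sum_normR_right q (fun k l => X (i, j) (k, l)) a b

theorem isQMatrix_iff_matrix (hq : q ≠ 0) {t : Fin n → Fin n → A} : IsQMatrix q t ↔
    algR q n A * (legOne (Matrix.of t) * legTwo (Matrix.of t)) =
      legTwo (Matrix.of t) * legOne (Matrix.of t) * algR q n A := by
  rw [isQMatrix_iff hq]
  constructor
  · intro h
    ext ⟨i, j⟩ ⟨a, b⟩
    rw [algR_mul_apply, mul_algR_apply]
    simpa only [legOne_mul_legTwo_apply, legTwo_mul_legOne_apply, Matrix.of_apply] using h i j a b
  · intro h i j a b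
    have := congrFun (congrFun h (i, j)) (a, b)
    rw [algR_mul_apply, mul_algR_apply] at this
    simpa only [legOne_mul_legTwo_apply, legTwo_mul_legOne_apply, Matrix.of_apply] using this

/-- The product of two quantum matrices with mutually commuting entries. -/
theorem IsQMatrix.mul (hq : q ≠ 0) {t u : Fin n → Fin n → A} (ht : IsQMatrix q t)
    (hu : IsQMatrix q u) (h : ∀ i j k l, Commute (t i j) (u k l)) :
    IsQMatrix q fun i j => ∑ k, t i k * u k j := by
  have hmul : Matrix.of (fun i j => ∑ k, t i k * u k j) = Matrix.of t * Matrix.of u := by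
    ext; simp [Matrix.mul_apply]
  rw [isQMatrix_iff_matrix hq] at *
  rw [hmul, ← legOne_mul, ← legTwo_mul]
  set T := Matrix.of t
  set U := Matrix.of u
  -- Different legs of `t` and `u` may be interchanged, so that the RTT relation of `t` and then
  -- that of `u` can be applied to the product.
  have h1 : legOne U * legTwo T = legTwo T * legOne U :=
    legOne_comm_legTwo fun i j k l => (h k l i j).symm
  have h2 : legOne T * legTwo U = legTwo U * legOne T := legOne_comm_legTwo h
  calc algR q n A * (legOne T * legOne U * (legTwo T * legTwo U))
      = (algR q n A * (legOne T * legTwo T)) * (legOne U * legTwo U) := by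
        simp only [mul_assoc]; rw [← mul_assoc (legOne U), h1]; simp only [mul_assoc]
    _ = legTwo T * legOne T * (algR q n A * (legOne U * legTwo U)) := by
        rw [ht]; simp only [mul_assoc]
    _ = legTwo T * legTwo U * (legOne T * legOne U) * algR q n A := by
        rw [hu]; simp only [mul_assoc]; rw [← mul_assoc (legOne T), h2]; simp only [mul_assoc]

end MatrixForm

/-! ### Relations for the inverse of a quantum matrix. -/

section Inverse

variable {q : ℝ} {n : ℕ} {A : Type*} [Ring A] [Algebra ℂ A] {t s : Fin n → Fin n → A}

/-- `s` is a two-sided inverse of the matrix `t`. -/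
structure IsMatInv (t s : Fin n → Fin n → A) : Prop where
  right : ∀ i j, ∑ k, t i k * s k j = if i = j then 1 else 0
  left : ∀ i j, ∑ k, s i k * t k j = if i = j then 1 else 0

theorem IsMatInv.mul_right (h : IsMatInv t s) : Matrix.of t * Matrix.of s = 1 := by
  ext i j; simp [Matrix.mul_apply, h.right, Matrix.one_apply]

theorem IsMatInv.mul_left (h : IsMatInv t s) : Matrix.of s * Matrix.of t = 1 := by
  ext i j; simp [Matrix.mul_apply, h.left, Matrix.one_apply]

theorem IsMatInv.eq_of_right (h : IsMatInv t s) {u : Fin n → Fin n → A}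
    (hu : ∀ i j, ∑ k, t i k * u k j = if i = j then 1 else 0) : u = s := by
  have h1 : Matrix.of t * Matrix.of u = 1 := by
    ext i j; simp [Matrix.mul_apply, hu, Matrix.one_apply]
  have h2 : Matrix.of u = Matrix.of s := by
    rw [← one_mul (Matrix.of u), ← h.mul_left, mul_assoc, h1, mul_one]
  exact Matrix.of.injective h2

theorem IsMatInv.eq_of_left (h : IsMatInv t s) {u : Fin n → Fin n → A}
    (hu : ∀ i j, ∑ k, u i k * t k j = if i = j then 1 else 0) : u = s := by
  have h1 : Matrix.of u * Matrix.of t = 1 := by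
    ext i j; simp [Matrix.mul_apply, hu, Matrix.one_apply]
  have h2 : Matrix.of u = Matrix.of s := by
    rw [← mul_one (Matrix.of u), ← h.mul_right, ← mul_assoc, h1, one_mul]
  exact Matrix.of.injective h2

theorem IsMatInv.symm (h : IsMatInv t s) : IsMatInv s t := ⟨h.left, h.right⟩

theorem IsMatInv.map {B : Type*} [Ring B] [Algebra ℂ B] (h : IsMatInv t s) (f : A →ₐ[ℂ] B) :
    IsMatInv (fun i j => f (t i j)) fun i j => f (s i j) where
  right i j := by simp only [← map_mul, ← map_sum, h.right]; split_ifs <;> simp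
  left i j := by simp only [← map_mul, ← map_sum, h.left]; split_ifs <;> simp

theorem IsMatInv.legOne (h : IsMatInv t s) :
    legOne (Matrix.of t) * legOne (Matrix.of s) = 1 ∧
      QBundle.legOne (Matrix.of s) * QBundle.legOne (Matrix.of t) = 1 := by
  rw [legOne_mul, legOne_mul, h.mul_left, h.mul_right, legOne_one]
  simp

theorem IsMatInv.legTwo (h : IsMatInv t s) :
    legTwo (Matrix.of t) * legTwo (Matrix.of s) = 1 ∧
      QBundle.legTwo (Matrix.of s) * QBundle.legTwo (Matrix.of t) = 1 := by
  rw [legTwo_mul, legTwo_mul, h.mul_left, h.mul_right, legTwo_one]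
  simp

/-- The inverse of a quantum matrix is a quantum matrix in the opposite algebra. -/
theorem IsQMatrix.inverse (hq : q ≠ 0) (ht : IsQMatrix q t) (h : IsMatInv t s) :
    IsQMatrix q fun i j => MulOpposite.op (s i j) := by
  have h1 := h.legOne
  have h2 := h.legTwo
  rw [isQMatrix_iff_matrix hq] at ht
  -- Multiply the RTT relation by S₁S₂ on the left and by S₂S₁ on the right. The factors appear in
  -- the reverse order, which is the RTT relation in the opposite algebra.
  have key : legOne (Matrix.of s) * legTwo (Matrix.of s) * algR q n A =
      algR q n A * (legTwo (Matrix.of s) * legOne (Matrix.of s)) := by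
    calc _ = legOne (Matrix.of s) * legTwo (Matrix.of s) *
        (algR q n A * (legOne (Matrix.of t) * legTwo (Matrix.of t))) *
          (legTwo (Matrix.of s) * legOne (Matrix.of s)) := by
          simp only [mul_assoc]
          rw [← mul_assoc (legTwo (Matrix.of t)), h2.1, one_mul, h1.1, mul_one]
      _ = _ := by
          rw [ht]
          simp only [mul_assoc]
          rw [← mul_assoc (legTwo (Matrix.of s)) (legTwo (Matrix.of t)), h2.2, one_mul,
            ← mul_assoc (legOne (Matrix.of s)) (legOne (Matrix.of t)), h1.2, one_mul]
  rw [isQMatrix_iff hq]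
  intro i j a b
  have := congrFun (congrFun key (i, j)) (a, b)
  rw [algR_mul_apply, mul_algR_apply] at this
  simp only [legOne_mul_legTwo_apply, legTwo_mul_legOne_apply, Matrix.of_apply] at this
  apply MulOpposite.unop_injective
  simp only [← MulOpposite.op_mul, ← MulOpposite.op_smul, MulOpposite.unop_add,
    MulOpposite.unop_op, apply_ite MulOpposite.unop, MulOpposite.unop_zero]
  exact this.symm

/-- The relations between the entries of a quantum matrix and of its inverse. -/
theorem IsQMatrix.mixed (hq : q ≠ 0) (ht : IsQMatrix q t) (h : IsMatInv t s) (i j a b : Fin n) :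
    dg q i b • (s j b * t i a) + (if i = b then wq q • ∑ m ∈ Finset.univ.filter (i < ·),
        s j m * t m a else 0) =
      dg q a j • (t i a * s j b) + if a = j then wq q • ∑ k ∈ Finset.univ.filter (· < j),
        t i k * s k b else 0 := by
  have h2 := h.legTwo
  rw [isQMatrix_iff_matrix hq] at ht
  -- Here the RTT relation is enclosed between two copies of S₂. The off-diagonal part of R produces
  -- the partial sums of ∑ s t and ∑ t s.
  have key : legTwo (Matrix.of s) * (algR q n A * legOne (Matrix.of t)) =
      legOne (Matrix.of t) * (algR q n A * legTwo (Matrix.of s)) := by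
    calc _ = legTwo (Matrix.of s) * (algR q n A * (legOne (Matrix.of t) * legTwo (Matrix.of t))) *
          legTwo (Matrix.of s) := by
          simp only [mul_assoc]
          rw [h2.1, mul_one]
      _ = _ := by
          rw [ht]
          simp only [mul_assoc]
          rw [← mul_assoc (legTwo (Matrix.of s)) (legTwo (Matrix.of t)), h2.2, one_mul]
  have := congrFun (congrFun key (i, j)) (a, b)
  rw [Matrix.mul_apply, Matrix.mul_apply, Fintype.sum_prod_type, Fintype.sum_prod_type] at this
  simp only [algR_mul_apply, legOne, legTwo, Matrix.of_apply, ite_mul, zero_mul, smul_ite,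
    smul_zero, mul_add, mul_ite, mul_zero, Finset.sum_add_distrib, Finset.sum_ite_eq,
    Finset.sum_ite_eq', Finset.mem_univ, if_true, mul_smul_comm] at this
  have e1 : (∑ x, ∑ y, if x < y then if x = b then if i = x then wq q • (s j y * t y a) else 0
      else 0 else 0) = if i = b then wq q • ∑ m ∈ Finset.univ.filter (i < ·), s j m * t m a
        else 0 := by
    rw [Finset.sum_eq_single b]
    · by_cases hib : i = b <;> simp [hib, Finset.sum_filter, Finset.smul_sum, smul_ite]
    · intro x _ hx
      simp [hx]
    · simp
  have e2 : (∑ x, ∑ y, if x = a then if j = y then dg q x y • (t i x * s y b) else 0 else 0) =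
      dg q a j • (t i a * s j b) := by
    rw [Finset.sum_eq_single a]
    · simp
    · intro x _ hx
      simp [hx]
    · simp
  have e3 : (∑ x, ∑ y, if x < y then if y = a then if j = y then wq q • (t i x * s x b) else 0
      else 0 else 0) = if a = j then wq q • ∑ k ∈ Finset.univ.filter (· < j), t i k * s k b
        else 0 := by
    rw [Finset.sum_comm, Finset.sum_eq_single a]
    · by_cases haj : a = j
      · simp [haj, Finset.sum_filter, Finset.smul_sum, smul_ite]
      · simp [haj, Ne.symm haj]
    · intro x _ hx
      simp [hx]
    · simp
  rw [e1, e2, e3] at this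
  exact this

end Inverse

/-! ### The quantum determinant -/

section Counting

variable {n : ℕ}

/-- The number of pairs `i < j` in `Fin n`. -/
def numPairs (n : ℕ) : ℕ := (Finset.univ.filter (fun p : Fin n × Fin n => p.1 < p.2)).card

/-- Reversal exchanges inversions and non-inversions of an injective tuple. This makes ε with
reversed indices proportional to the inverse weights used in `qSign`. -/
theorem inversions_comp_rev {c : Fin n → Fin n} (hc : Function.Injective c) :
    inversions (c ∘ Fin.rev) + inversions c = numPairs n := by
  unfold numPairs inversions
  rw [← Finset.card_filter_add_card_filter_not (s := Finset.univ.filter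
    (fun p : Fin n × Fin n => p.1 < p.2)) (fun p => c p.1 < c p.2), Finset.filter_filter,
    Finset.filter_filter]
  congr 1
  · refine Finset.card_bij (fun p _ => (Fin.rev p.2, Fin.rev p.1)) ?_ ?_ ?_
    · rintro ⟨i, j⟩ h
      simpa [Fin.rev_lt_rev] using h
    · rintro ⟨i, j⟩ _ ⟨i', j'⟩ _ h
      simpa [and_comm] using h
    · rintro ⟨i, j⟩ h
      exact ⟨(Fin.rev j, Fin.rev i), by simpa [Fin.rev_lt_rev] using h, by simp⟩
  · congr 1
    ext ⟨i, j⟩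
    simp only [Finset.mem_filter, Finset.mem_univ, true_and, not_lt]
    refine and_congr_right fun h => ⟨le_of_lt, fun h' => lt_of_le_of_ne h' fun h'' => ?_⟩
    exact h.ne' (hc h'')

theorem inversions_rev_comp_rev (c : Fin n → Fin n) :
    inversions (Fin.rev ∘ c ∘ Fin.rev) = inversions c := by
  unfold inversions
  refine Finset.card_bij (fun p _ => (Fin.rev p.2, Fin.rev p.1)) ?_ ?_ ?_
  · rintro ⟨i, j⟩ h
    simpa [Fin.rev_lt_rev] using h
  · rintro ⟨i, j⟩ _ ⟨i', j'⟩ _ h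
    simpa [and_comm] using h
  · rintro ⟨i, j⟩ h
    exact ⟨(Fin.rev j, Fin.rev i), by simpa [Fin.rev_lt_rev] using h, by simp⟩

theorem qSign_rev_comp_rev (q : ℝ) (c : Fin n → Fin n) :
    qSign q (Fin.rev ∘ c ∘ Fin.rev) = qSign q c := by
  by_cases h : Function.Injective c
  · rw [qSign_of_injective q h, qSign_of_injective q
      (Fin.rev_injective.comp (h.comp Fin.rev_injective)), inversions_rev_comp_rev]
  · rw [qSign_of_not_injective q h, qSign_of_not_injective]
    intro h'
    apply h
    have := Fin.rev_injective.comp (h'.comp (Fin.rev_injective (n := n)))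
    convert this using 1
    ext i
    simp

theorem sum_qSign_smul {M : Type*} [AddCommGroup M] [Module ℂ M] (q : ℝ)
    (f : (Fin n → Fin n) → M) :
    ∑ c, qSign q c • f c = ∑ σ : Equiv.Perm (Fin n), qSign q σ • f σ := by
  symm
  refine Finset.sum_of_injOn (fun σ : Equiv.Perm (Fin n) => ⇑σ)
    (fun a _ b _ h => DFunLike.coe_injective h) (by simp) ?_ (by simp)
  intro c _ hc
  rw [qSign_of_not_injective, zero_smul]
  intro h
  exact hc ⟨Equiv.ofBijective c (Finite.injective_iff_bijective.1 h), by simp, rfl⟩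

/-- Here q is used to be real: this is a sum of real squares, and the identity contributes 1. -/
theorem sum_qSign_mul_self_ne_zero (q : ℝ) (n : ℕ) :
    ∑ c : Fin n → Fin n, qSign q c * qSign q c ≠ 0 := by
  classical
  have h : ∀ c : Fin n → Fin n, qSign q c =
      ((if Function.Injective c then ((-q)⁻¹) ^ inversions c else 0 : ℝ) : ℂ) := by
    intro c
    unfold qSign
    split_ifs <;> simp
  simp only [h]
  norm_cast
  refine (Finset.sum_pos' (fun c _ => mul_self_nonneg _) ⟨id, Finset.mem_univ _, ?_⟩).ne'
  simp [Function.injective_id, inversions_eq_zero strictMono_id]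

end Counting

section Products

variable {A : Type*} [Ring A] [Algebra ℂ A] {n : ℕ} {ι : Type*} [Fintype ι]

theorem prod_ofFn_sum (f : Fin n → ι → A) :
    (List.ofFn fun k => ∑ m, f k m).prod = ∑ c : Fin n → ι, (List.ofFn fun k => f k (c k)).prod := by
  have := (MultilinearMap.mkPiAlgebraFin ℂ n A).map_sum (ι := Fin n) (α := fun _ => ι) f
  simpa only [MultilinearMap.mkPiAlgebraFin_apply] using this

theorem prod_ofFn_mul {f g : Fin n → A} (h : ∀ i j, Commute (f i) (g j)) :
    (List.ofFn fun k => f k * g k).prod = (List.ofFn f).prod * (List.ofFn g).prod := by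
  induction n with
  | zero => simp
  | succ n ih =>
    simp only [List.ofFn_succ, List.prod_cons]
    rw [ih fun i j => h _ _]
    have : Commute (g 0) (List.ofFn fun i : Fin n => f i.succ).prod :=
      Commute.list_prod_right _ _ fun x hx => by
        obtain ⟨i, rfl⟩ := (List.mem_ofFn' _ _).1 hx
        exact (h _ _).symm
    rw [mul_assoc, ← mul_assoc (g 0), this.eq]
    simp only [mul_assoc]

end Products

/-! ### Transposition, normalisation and multiplicativity of the determinant. -/

section Det

variable {q : ℝ} {n : ℕ} {A : Type*} [Ring A] [Algebra ℂ A] {t : Fin n → Fin n → A}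

/-- The double sum over rows and columns, weighted by both signs, is ∑ ε(c)² times either
determinant, depending on which sum is carried out first; the factor is nonzero. -/
theorem IsQMatrix.rowDet_transpose (h : IsQMatrix q t) (hq : q ≠ 0) :
    rowDet q (fun i j => t j i) = rowDet q t := by
  have h1 : ∑ r : Fin n → Fin n, ∑ c : Fin n → Fin n,
      (qSign q r * qSign q c) • (List.ofFn fun k => t (r k) (c k)).prod =
      (∑ c : Fin n → Fin n, qSign q c * qSign q c) • rowDet q t := by
    rw [Finset.sum_smul]
    refine Finset.sum_congr rfl fun r _ => ?_
    simp only [mul_smul, ← Finset.smul_sum]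
    congr 1
    exact h.rowSum_eq hq r
  have h2 : ∑ r : Fin n → Fin n, ∑ c : Fin n → Fin n,
      (qSign q r * qSign q c) • (List.ofFn fun k => t (r k) (c k)).prod =
      (∑ c : Fin n → Fin n, qSign q c * qSign q c) • rowDet q (fun i j => t j i) := by
    rw [Finset.sum_comm, Finset.sum_smul]
    refine Finset.sum_congr rfl fun c _ => ?_
    simp only [mul_comm (qSign q _) (qSign q c), mul_smul, ← Finset.smul_sum]
    congr 1
    exact h.transpose.rowSum_eq hq c
  exact smul_right_injective _ (sum_qSign_mul_self_ne_zero q n) (h2.symm.trans h1)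

theorem qEps_eq (q : ℝ) (σ : Equiv.Perm (Fin n)) : qEps q σ = (qSign q σ)⁻¹ := by
  rw [qSign_of_injective q σ.injective, inv_pow, inv_inv]
  rfl

theorem qEpsRev_eq (hq : q ≠ 0) (σ : Equiv.Perm (Fin n)) :
    qEpsRev q σ = (-(q : ℂ)) ^ numPairs n * qSign q σ := by
  have hq' : -(q : ℂ) ≠ 0 := by simpa using hq
  rw [qSign_of_injective q σ.injective, ← inversions_comp_rev σ.injective, pow_add, mul_assoc,
    ← mul_pow, mul_inv_cancel₀ hq', one_pow, mul_one]
  rfl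

theorem qSign_perm_ne_zero (hq : q ≠ 0) (σ : Equiv.Perm (Fin n)) : qSign q σ ≠ 0 := by
  rw [qSign_of_injective q σ.injective]
  exact pow_ne_zero _ (neg_inv_ne_zero hq)

/-- The quantum determinant agrees with its row form. -/
theorem IsQMatrix.qDet_eq {A : Type} [Ring A] [Algebra ℂ A] {t : Fin n → Fin n → A}
    (h : IsQMatrix q t) (hq : q ≠ 0) : qDet q t = rowDet q t := by
  have hq' : -(q : ℂ) ≠ 0 := by simpa using hq
  -- The weight `qEps q σ` cancels the sign of the row permutation, so all n! choices of σ
  -- contribute equally. The normalising constant contains the same factor n!.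
  have h1 : ∀ σ : Equiv.Perm (Fin n), ∑ τ : Equiv.Perm (Fin n),
      (qEps q σ * qEpsRev q τ) • (List.ofFn fun k => t (σ k) (τ k)).prod =
        (-(q : ℂ)) ^ numPairs n • rowDet q t := by
    intro σ
    have := h.rowSum_eq hq σ
    rw [rowSum, sum_qSign_smul] at this
    simp only [qEps_eq, qEpsRev_eq hq, mul_smul, ← Finset.smul_sum]
    rw [this, smul_comm, inv_smul_smul₀ (qSign_perm_ne_zero hq σ)]
  have h2 : ∑ σ : Equiv.Perm (Fin n), qEps q σ * qEpsRev q σ =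
      (Fintype.card (Equiv.Perm (Fin n)) : ℂ) * (-(q : ℂ)) ^ numPairs n := by
    rw [← nsmul_eq_mul, ← Finset.card_univ, ← Finset.sum_const]
    refine Finset.sum_congr rfl fun σ _ => ?_
    rw [qEps_eq, qEpsRev_eq hq, mul_left_comm, inv_mul_cancel₀ (qSign_perm_ne_zero hq σ),
      mul_one]
  rw [qDet, Finset.sum_congr rfl fun σ _ => h1 σ, h2, Finset.sum_const, Finset.card_univ,
    ← Nat.cast_smul_eq_nsmul ℂ, smul_smul, smul_smul, mul_assoc, inv_mul_cancel₀, one_smul]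
  exact mul_ne_zero (by exact_mod_cast Fintype.card_ne_zero) (pow_ne_zero _ hq')

/-- Multiplicativity of the quantum determinant. -/
theorem rowDet_mul (hq : q ≠ 0) {u : Fin n → Fin n → A} (hu : IsQMatrix q u)
    (h : ∀ i j k l, Commute (t i j) (u k l)) :
    rowDet q (fun i j => ∑ k, t i k * u k j) = rowDet q t * rowDet q u := by
  have h1 : ∀ c : Fin n → Fin n, (List.ofFn fun k => ∑ m, t k m * u m (c k)).prod =
      ∑ m : Fin n → Fin n, (List.ofFn fun k => t k (m k)).prod *
        (List.ofFn fun k => u (m k) (c k)).prod := by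
    intro c
    rw [prod_ofFn_sum]
    exact Finset.sum_congr rfl fun m _ => prod_ofFn_mul fun i j => h _ _ _ _
  simp only [rowDet, rowSum, id, h1, Finset.smul_sum]
  rw [Finset.sum_comm, Finset.sum_mul]
  refine Finset.sum_congr rfl fun m _ => ?_
  have := hu.rowSum_eq hq m
  simp only [rowDet, rowSum, id] at this
  simp only [← mul_smul_comm, ← Finset.mul_sum]
  rw [this, mul_smul_comm, smul_mul_assoc]

theorem map_rowDet {B : Type*} [Ring B] [Algebra ℂ B] (f : A →ₐ[ℂ] B) :
    f (rowDet q t) = rowDet q fun i j => f (t i j) := by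
  simp only [rowDet, rowSum, map_sum, map_smul, map_list_prod, List.map_ofFn]
  rfl

end Det

/-! ### Inverses of quantum matrices -/

theorem sum_fin_cons {M : Type*} [AddCommMonoid M] {m : ℕ} {ι : Type*} [Fintype ι]
    (f : (Fin (m + 1) → ι) → M) :
    ∑ c, f c = ∑ j, ∑ c' : Fin m → ι, f (Fin.cons j c' : Fin (m + 1) → ι) := by
  rw [← Fintype.sum_prod_type']
  exact (Fintype.sum_equiv (Fin.consEquiv fun _ => ι) _ _ fun _ => rfl).symm

section

variable {q : ℝ} {n : ℕ} {A : Type*} [Ring A] [Algebra ℂ A] {t s : Fin n → Fin n → A}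

/-- Only `i` is missing from the range of `i.succAbove`, so any other first entry is repeated. These
are the vanishing off-diagonal entries in the Laplace expansion. -/
theorem qSign_cons_succAbove {m : ℕ} (k i : Fin (m + 1)) (h : k ≠ i) :
    qSign q (Fin.cons k i.succAbove : Fin (m + 1) → Fin (m + 1)) = 0 := by
  apply qSign_of_not_injective
  rw [Fin.cons_injective_iff]
  rintro ⟨h1, -⟩
  exact h1 (by simpa using h)

theorem qSign_cons_succAbove_self_ne_zero (hq : q ≠ 0) {m : ℕ} (i : Fin (m + 1)) :
    qSign q (Fin.cons i i.succAbove : Fin (m + 1) → Fin (m + 1)) ≠ 0 := by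
  rw [qSign_of_injective]
  · exact pow_ne_zero _ (neg_inv_ne_zero hq)
  · rw [Fin.cons_injective_iff]
    exact ⟨by simp, Fin.succAbove_right_injective⟩

theorem rowSum_cons {m : ℕ} (t : Fin (m + 1) → Fin (m + 1) → A) (k : Fin (m + 1))
    (r : Fin m → Fin (m + 1)) :
    rowSum q t (Fin.cons k r : Fin (m + 1) → Fin (m + 1)) =
      ∑ j, t k j * ∑ c : Fin m → Fin (m + 1),
        qSign q (Fin.cons j c : Fin (m + 1) → Fin (m + 1)) •
          (List.ofFn fun l => t (r l) (c l)).prod := by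
  rw [rowSum, sum_fin_cons]
  simp only [List.ofFn_succ, List.prod_cons, Fin.cons_zero, Fin.cons_succ, Finset.mul_sum,
    mul_smul_comm]

/-- A quantum matrix with invertible determinant has a right inverse (Laplace expansion). -/
theorem IsQMatrix.exists_right_inverse (h : IsQMatrix q t) (hq : q ≠ 0) {D : A}
    (hD : rowDet q t * D = 1) :
    ∃ u : Fin n → Fin n → A, ∀ i j, ∑ k, t i k * u k j = if i = j then 1 else 0 := by
  cases n with
  | zero => exact ⟨fun i => i.elim0, fun i => i.elim0⟩
  | succ m =>
    -- Cofactors for row i moved to the front, with the sign of this rearrangement divided out.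
    -- Pairing them with row j gives `rowSum` for the rows j followed by all rows except i.
    refine ⟨fun k i => (qSign q (Fin.cons i i.succAbove : Fin (m + 1) → Fin (m + 1)))⁻¹ •
      ((∑ c : Fin m → Fin (m + 1), qSign q (Fin.cons k c : Fin (m + 1) → Fin (m + 1)) •
          (List.ofFn fun l => t (i.succAbove l) (c l)).prod) * D), fun j i => ?_⟩
    simp only [mul_smul_comm, ← mul_assoc, ← Finset.smul_sum, ← Finset.sum_mul]
    rw [← rowSum_cons, h.rowSum_eq hq]
    split_ifs with hji
    · subst hji
      rw [smul_mul_assoc, hD, inv_smul_smul₀ (qSign_cons_succAbove_self_ne_zero hq j)]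
    · rw [qSign_cons_succAbove j i hji, zero_smul, zero_mul, smul_zero]

/-- Reflection in the antidiagonal compensates the reversal of products. It turns right inverses
over the opposite algebra into left inverses. -/
theorem IsQMatrix.opRev (h : IsQMatrix q t) :
    IsQMatrix q fun i j => MulOpposite.op (t (Fin.rev j) (Fin.rev i)) where
  row i _ _ hab := by
    simp only [← MulOpposite.op_mul, ← MulOpposite.op_smul,
      h.col (Fin.rev i) (Fin.rev_lt_rev.2 hab)]
  col a hij := by
    simp only [← MulOpposite.op_mul, ← MulOpposite.op_smul,
      h.row (Fin.rev a) (Fin.rev_lt_rev.2 hij)]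
  comm hij hab := by
    simp only [← MulOpposite.op_mul, h.comm (Fin.rev_lt_rev.2 hab) (Fin.rev_lt_rev.2 hij)]
  cross hij hab := by
    simp only [← MulOpposite.op_mul, ← MulOpposite.op_smul, ← MulOpposite.op_add,
      h.cross (Fin.rev_lt_rev.2 hab) (Fin.rev_lt_rev.2 hij),
      h.comm (Fin.rev_lt_rev.2 hab) (Fin.rev_lt_rev.2 hij)]

theorem rowDet_op (q : ℝ) (t : Fin n → Fin n → A) :
    rowDet q (fun i j => MulOpposite.op (t i j)) = MulOpposite.op
      (∑ c : Fin n → Fin n, qSign q c • (List.ofFn fun k => t k (c k)).reverse.prod) := by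
  simp only [rowDet, rowSum, Finset.op_sum, MulOpposite.op_smul, id]
  refine Finset.sum_congr rfl fun c _ => ?_
  rw [MulOpposite.op_list_prod, List.map_reverse, List.reverse_reverse, List.map_ofFn]
  rfl

theorem reverse_ofFn {α : Type*} (f : Fin n → α) :
    (List.ofFn f).reverse = List.ofFn fun k => f (Fin.rev k) := by
  apply List.ext_getElem
  · simp
  · intro i h1 h2
    simp [List.getElem_reverse, Fin.rev]
    congr 1
    ext
    simp at h1 ⊢
    omega

/-- Reversed products are reindexed by c ↦ rev ∘ c ∘ rev, which keeps the number of inversions; the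
remaining transposition does not change the determinant. -/
theorem IsQMatrix.rowDet_opRev (h : IsQMatrix q t) (hq : q ≠ 0) :
    rowDet q (fun i j => MulOpposite.op (t (Fin.rev j) (Fin.rev i))) =
      MulOpposite.op (rowDet q t) := by
  rw [rowDet_op q (fun i j => t (Fin.rev j) (Fin.rev i)), ← h.rowDet_transpose hq]
  congr 1
  rw [rowDet, rowSum]
  refine Finset.sum_bij' (fun c _ => Fin.rev ∘ c ∘ Fin.rev) (fun c _ => Fin.rev ∘ c ∘ Fin.rev)
    (by simp) (by simp) (fun c _ => by ext; simp) (fun c _ => by ext; simp) fun c _ => ?_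
  rw [qSign_rev_comp_rev, reverse_ofFn]
  simp

/-- A quantum matrix with invertible determinant is invertible. -/
theorem IsQMatrix.exists_isMatInv (h : IsQMatrix q t) (hq : q ≠ 0) {D : A}
    (hD : rowDet q t * D = 1) (hD' : D * rowDet q t = 1) : ∃ s, IsMatInv t s := by
  obtain ⟨u, hu⟩ := h.exists_right_inverse hq hD
  obtain ⟨u', hu'⟩ := h.opRev.exists_right_inverse (D := MulOpposite.op D) hq (by
    rw [h.rowDet_opRev hq, ← MulOpposite.op_mul, hD', MulOpposite.op_one])
  have hl : ∀ i j, ∑ k, (u' (Fin.rev k) (Fin.rev i)).unop * t k j = if i = j then 1 else 0 := by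
    intro i j
    have := congrArg MulOpposite.unop (hu' (Fin.rev j) (Fin.rev i))
    rw [Finset.unop_sum, ← Equiv.sum_comp Fin.revPerm] at this
    simp only [MulOpposite.unop_mul, MulOpposite.unop_op, Fin.rev_rev, Fin.revPerm_apply] at this
    rw [this]
    by_cases hij : i = j
    · simp [hij]
    · simp [hij, Ne.symm hij]
  have h1 : Matrix.of t * Matrix.of u = 1 := by
    ext i j; simp [Matrix.mul_apply, hu, Matrix.one_apply]
  have h2 : Matrix.of (fun i k => (u' (Fin.rev k) (Fin.rev i)).unop) * Matrix.of t = 1 := by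
    ext i j; simp [Matrix.mul_apply, hl, Matrix.one_apply]
  refine ⟨u, hu, fun i j => ?_⟩
  rw [left_inv_eq_right_inv h2 h1] at h2
  have := congrFun (congrFun h2 i) j
  simpa [Matrix.mul_apply, Matrix.one_apply] using this

/-- The product collapses from the inside: s(b₀, r₀) and t(r₀, c₀) are adjacent, and the sum over r₀
gives δ. -/
theorem sum_reverse_prod_mul_prod (h : IsMatInv t s) {m : ℕ} (b c : Fin m → Fin n) :
    ∑ r : Fin m → Fin n, (List.ofFn fun k => s (b k) (r k)).reverse.prod *
      (List.ofFn fun k => t (r k) (c k)).prod = if b = c then 1 else 0 := by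
  induction m with
  | zero => simp [Subsingleton.elim b c]
  | succ m ih =>
    rw [sum_fin_cons, Finset.sum_comm]
    have h1 : ∀ r' : Fin m → Fin n, ∑ j, (List.ofFn fun k => s (b k)
        ((Fin.cons j r' : Fin (m + 1) → Fin n) k)).reverse.prod *
      (List.ofFn fun k => t ((Fin.cons j r' : Fin (m + 1) → Fin n) k) (c k)).prod =
      if b 0 = c 0 then (List.ofFn fun k => s (b k.succ) (r' k)).reverse.prod *
        (List.ofFn fun k => t (r' k) (c k.succ)).prod else 0 := by
      intro r'
      simp only [List.ofFn_succ, List.prod_cons, Fin.cons_zero, Fin.cons_succ,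
        List.reverse_cons, List.prod_append, List.prod_nil, mul_one]
      have : ∀ j, (List.ofFn fun k => s (b k.succ) (r' k)).reverse.prod * s (b 0) j *
          (t j (c 0) * (List.ofFn fun k => t (r' k) (c k.succ)).prod) =
          (List.ofFn fun k => s (b k.succ) (r' k)).reverse.prod * (s (b 0) j * t j (c 0)) *
          (List.ofFn fun k => t (r' k) (c k.succ)).prod := fun j => by simp only [mul_assoc]
      simp only [this, ← Finset.sum_mul, ← Finset.mul_sum, h.left]
      split_ifs <;> simp
    simp only [h1]
    rw [Finset.sum_ite_irrel, ih (fun k => b k.succ) (fun k => c k.succ)]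
    by_cases hbc : b = c
    · simp [hbc]
    · have : ¬(b 0 = c 0 ∧ (fun k : Fin m => b k.succ) = fun k => c k.succ) := by
        rintro ⟨h1, h2⟩
        exact hbc (funext fun i => i.cases h1 (fun k => congrFun h2 k))
      by_cases h0 : b 0 = c 0
      · rw [if_pos h0, if_neg hbc, if_neg fun h => this ⟨h0, h⟩]
      · simp [hbc, h0]

/-- The determinant of the inverse matrix, computed in the opposite algebra. -/
theorem IsQMatrix.rowDet_inverse_mul (ht : IsQMatrix q t) (hq : q ≠ 0) (h : IsMatInv t s) :
    (rowDet q fun i j => MulOpposite.op (s i j)).unop * rowDet q t = 1 := by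
  rw [rowDet_op, MulOpposite.unop_op, Finset.sum_mul]
  -- The determinant on the right absorbs the sign of r and becomes the row sum for the rows r.
  -- After that the sum over r is a contraction of inverse matrices.
  have h1 : ∀ r : Fin n → Fin n, qSign q r • (List.ofFn fun k => s k (r k)).reverse.prod *
      rowDet q t = ∑ c : Fin n → Fin n, qSign q c •
        ((List.ofFn fun k => s k (r k)).reverse.prod * (List.ofFn fun k => t (r k) (c k)).prod) := by
    intro r
    rw [smul_mul_assoc, ← mul_smul_comm, ← ht.rowSum_eq hq r, rowSum, Finset.mul_sum]
    simp only [mul_smul_comm]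
  simp only [h1]
  rw [Finset.sum_comm]
  simp only [← Finset.smul_sum]
  have h2 := fun c : Fin n → Fin n => sum_reverse_prod_mul_prod h id c
  simp only [id] at h2
  simp only [h2, smul_ite, smul_zero]
  rw [Finset.sum_eq_single id]
  · simp only [qSign_strictMono q strictMono_id, one_smul]
    simp
  · intro c _ hc
    rw [if_neg]
    intro h'
    exact hc h'.symm
  · simp

theorem IsQMatrix.rowDet_inverse (ht : IsQMatrix q t) (hq : q ≠ 0) (h : IsMatInv t s) {D : A}
    (hD : rowDet q t * D = 1) :
    rowDet q (fun i j => MulOpposite.op (s i j)) = MulOpposite.op D := by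
  have h1 := ht.rowDet_inverse_mul hq h
  rw [← MulOpposite.op_unop (rowDet q fun i j => MulOpposite.op (s i j)),
    left_inv_eq_right_inv h1 hD]

end

/-! ### Block matrices -/

section Block

variable {q : ℝ} {n : ℕ} {A : Type*} [Ring A] [Algebra ℂ A]

/-- The block matrix `1 ⊕ t`. -/
def oneBlock (t : Fin n → Fin n → A) : Fin (n + 1) → Fin (n + 1) → A :=
  Fin.cons (Fin.cons 1 fun _ => 0) fun i => Fin.cons 0 (t i)

theorem oneBlock_zero_zero (t : Fin n → Fin n → A) : oneBlock t 0 0 = 1 := rfl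

theorem oneBlock_zero_succ (t : Fin n → Fin n → A) (j : Fin n) : oneBlock t 0 j.succ = 0 := rfl

theorem oneBlock_succ_zero (t : Fin n → Fin n → A) (i : Fin n) : oneBlock t i.succ 0 = 0 := rfl

theorem oneBlock_succ_succ (t : Fin n → Fin n → A) (i j : Fin n) :
    oneBlock t i.succ j.succ = t i j := rfl

theorem IsQMatrix.oneBlock {t : Fin n → Fin n → A} (h : IsQMatrix q t) :
    IsQMatrix q (oneBlock t) where
  row i a b hab := by
    cases i using Fin.cases <;> cases a using Fin.cases <;> cases b using Fin.cases <;>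
      simp_all [oneBlock_zero_zero, oneBlock_zero_succ, oneBlock_succ_zero, oneBlock_succ_succ,
        h.row]
  col a hij := by
    rename_i i j
    cases i using Fin.cases <;> cases a using Fin.cases <;> cases j using Fin.cases <;>
      simp_all [oneBlock_zero_zero, oneBlock_zero_succ, oneBlock_succ_zero, oneBlock_succ_succ,
        h.col]
  comm hij hab := by
    rename_i i j a b
    cases i using Fin.cases <;> cases a using Fin.cases <;> cases j using Fin.cases <;>
      cases b using Fin.cases <;>
      simp_all [oneBlock_zero_succ, oneBlock_succ_zero, oneBlock_succ_succ]
    exact h.comm hij hab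
  cross hij hab := by
    rename_i i j a b
    cases i using Fin.cases <;> cases a using Fin.cases <;> cases j using Fin.cases <;>
      cases b using Fin.cases <;>
      simp_all [oneBlock_zero_zero, oneBlock_zero_succ, oneBlock_succ_zero, oneBlock_succ_succ,
        h.cross]

theorem qSign_cons_zero_succ {m : ℕ} (c : Fin m → Fin n) :
    qSign q (Fin.cons 0 (Fin.succ ∘ c) : Fin (m + 1) → Fin (n + 1)) = qSign q c := by
  have hinj : Function.Injective (Fin.cons 0 (Fin.succ ∘ c) : Fin (m + 1) → Fin (n + 1)) ↔
      Function.Injective c := by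
    rw [Fin.cons_injective_iff]
    simp [Function.Injective.of_comp_iff (Fin.succ_injective _), Fin.succ_ne_zero]
  by_cases h : Function.Injective c
  · rw [qSign_of_injective q h, qSign_of_injective q (hinj.2 h)]
    congr 1
    unfold inversions
    symm
    refine Finset.card_bij (fun p _ => (p.1.succ, p.2.succ)) ?_ ?_ ?_
    · rintro ⟨i, j⟩ h
      simpa using h
    · rintro ⟨i, j⟩ _ ⟨i', j'⟩ _ h
      simpa using h
    · rintro ⟨i, j⟩ h
      cases i using Fin.cases <;> cases j using Fin.cases <;> simp_all
  · rw [qSign_of_not_injective q h, qSign_of_not_injective q (fun h' => h (hinj.1 h'))]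

/-- Sums against the `ε`-tensor of tuples starting with `0`. -/
theorem sum_qSign_cons_zero {M : Type*} [AddCommGroup M] [Module ℂ M] {m : ℕ}
    (f : (Fin m → Fin (n + 1)) → M) :
    ∑ c : Fin m → Fin (n + 1), qSign q (Fin.cons 0 c : Fin (m + 1) → Fin (n + 1)) • f c =
      ∑ c : Fin m → Fin n, qSign q c • f (Fin.succ ∘ c) := by
  symm
  refine Finset.sum_of_injOn (fun c => Fin.succ ∘ c)
    (fun a _ b _ h => (Fin.succ_injective n).comp_left h) (by simp) ?_ ?_
  · intro c _ hc
    rw [qSign_of_not_injective, zero_smul]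
    rw [Fin.cons_injective_iff]
    rintro ⟨h, -⟩
    apply hc
    have : ∀ i, c i ≠ 0 := fun i hi => h ⟨i, hi⟩
    exact ⟨fun i => (c i).pred (this i), by simp, by ext; simp⟩
  · intro c _
    rw [qSign_cons_zero_succ]

theorem rowDet_oneBlock (q : ℝ) (t : Fin n → Fin n → A) : rowDet q (oneBlock t) = rowDet q t := by
  have : (id : Fin (n + 1) → Fin (n + 1)) = Fin.cons 0 Fin.succ := by
    ext i; cases i using Fin.cases <;> simp
  rw [rowDet, this, rowSum_cons, Fin.sum_univ_succ]
  simp only [oneBlock_zero_zero, oneBlock_zero_succ, zero_mul, Finset.sum_const_zero, add_zero,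
    one_mul]
  rw [sum_qSign_cons_zero]
  simp only [Function.comp_apply, oneBlock_succ_succ]
  rfl

end Block

/-! ### The universal property of `U_q(n)` -/

namespace Uq

variable {q : ℝ} {n : ℕ}

theorem map_mkAlgHom_qDet {A B : Type} [Ring A] [Algebra ℂ A] [Ring B] [Algebra ℂ B]
    (f : A →ₐ[ℂ] B) (t : Fin n → Fin n → A) : f (qDet q t) = qDet q fun i j => f (t i j) := by
  simp only [qDet, map_sum, map_smul, map_list_prod, List.map_ofFn]
  rfl

theorem isQMatrix_t (hq : q ≠ 0) (n : ℕ) : IsQMatrix q (t q : Fin n → Fin n → Uq q n) := by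
  rw [isQMatrix_iff_stdR hq]
  intro i j a b
  have := RingQuot.mkAlgHom_rel ℂ (UqRel.rtt (q := q) i j a b)
  simp only [map_sum, map_smul, map_mul] at this
  exact this

theorem det_eq (hq : q ≠ 0) (n : ℕ) : det q n = rowDet q (t q) := (isQMatrix_t hq n).qDet_eq hq

theorem det_mul_detStar (q : ℝ) (n : ℕ) : det q n * detStar q n = 1 := by
  have := RingQuot.mkAlgHom_rel ℂ (UqRel.det_mul_detStar (q := q) (n := n))
  rwa [map_mul, map_one, map_mkAlgHom_qDet] at this

theorem detStar_mul_det (q : ℝ) (n : ℕ) : detStar q n * det q n = 1 := by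
  have := RingQuot.mkAlgHom_rel ℂ (UqRel.detStar_mul_det (q := q) (n := n))
  rwa [map_mul, map_one, map_mkAlgHom_qDet] at this

section Lift

variable {A : Type} [Ring A] [Algebra ℂ A]

/-- The values of a homomorphism on generators. -/
def genMap (u : Fin n → Fin n → A) (D : A) : UqGen n → A
  | UqGen.t i j => u i j
  | UqGen.detStar => D

/-- The homomorphism from `U_q(n)` given by a quantum matrix with invertible determinant. -/
def lift (hq : q ≠ 0) (u : Fin n → Fin n → A) (hu : IsQMatrix q u) (D : A)
    (h1 : rowDet q u * D = 1) (h2 : D * rowDet q u = 1) : Uq q n →ₐ[ℂ] A :=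
  RingQuot.liftAlgHom ℂ ⟨FreeAlgebra.lift ℂ (genMap u D), by
    intro x y h
    cases h with
    | rtt i j a b =>
      simp only [map_sum, map_smul, map_mul, FreeAlgebra.lift_ι_apply, genMap]
      exact (isQMatrix_iff_stdR hq).1 hu i j a b
    | det_mul_detStar =>
      simp only [map_mul, map_mkAlgHom_qDet, map_one, FreeAlgebra.lift_ι_apply, genMap]
      rw [hu.qDet_eq hq, h1]
    | detStar_mul_det =>
      simp only [map_mul, map_mkAlgHom_qDet, map_one, FreeAlgebra.lift_ι_apply, genMap]
      rw [hu.qDet_eq hq, h2]⟩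

variable {hq : q ≠ 0} {u : Fin n → Fin n → A} {hu : IsQMatrix q u} {D : A}
    {h1 : rowDet q u * D = 1} {h2 : D * rowDet q u = 1}

theorem lift_t (i j : Fin n) : lift hq u hu D h1 h2 (t q i j) = u i j := by
  simp [lift, t, genMap]

theorem lift_detStar : lift hq u hu D h1 h2 (detStar q n) = D := by
  simp [lift, detStar, genMap]

theorem lift_det : lift hq u hu D h1 h2 (det q n) = rowDet q u := by
  rw [det_eq hq, map_rowDet]
  simp only [lift_t]

theorem map_det (hq : q ≠ 0) (f : Uq q n →ₐ[ℂ] A) :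
    f (det q n) = rowDet q fun i j => f (t q i j) := by
  rw [det_eq hq, map_rowDet]

/-- The image of `detStar` is forced, being inverse to the image of a polynomial in the generators
`t`. -/
theorem algHom_ext (hq : q ≠ 0) {f g : Uq q n →ₐ[ℂ] A} (h : ∀ i j, f (t q i j) = g (t q i j)) :
    f = g := by
  apply RingQuot.ringQuot_ext'
  apply FreeAlgebra.hom_ext
  funext x
  cases x with
  | t i j => exact h i j
  | detStar =>
    have h1 : f (detStar q n) * f (det q n) = 1 := by rw [← map_mul, detStar_mul_det, map_one]
    have h2 : g (det q n) * g (detStar q n) = 1 := by rw [← map_mul, det_mul_detStar, map_one]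
    have h3 : f (det q n) = g (det q n) := by
      rw [map_det hq, map_det hq]
      simp only [h]
    rw [h3] at h1
    exact left_inv_eq_right_inv h1 h2

end Lift

theorem adjoin_eq_top (q : ℝ) (n : ℕ) :
    Algebra.adjoin ℂ (Set.range (fun p : Fin n × Fin n => t q p.1 p.2) ∪ {detStar q n}) = ⊤ := by
  have h1 : (RingQuot.mkAlgHom ℂ (UqRel q n)).range = ⊤ :=
    (AlgHom.range_eq_top _).2 (RingQuot.mkAlgHom_surjective ℂ _)
  rw [← h1, ← Algebra.map_top, ← FreeAlgebra.adjoin_range_ι, AlgHom.map_adjoin]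
  congr 1
  ext y
  constructor
  · rintro (⟨⟨i, j⟩, rfl⟩ | rfl)
    · exact ⟨_, ⟨UqGen.t i j, rfl⟩, rfl⟩
    · exact ⟨_, ⟨UqGen.detStar, rfl⟩, rfl⟩
  · rintro ⟨_, ⟨x, rfl⟩, rfl⟩
    cases x with
    | t i j => exact Or.inl ⟨(i, j), rfl⟩
    | detStar => exact Or.inr rfl

/-- Induction over `U_q(n)`. -/
theorem induction {p : Uq q n → Prop} (ht : ∀ i j, p (t q i j)) (hd : p (detStar q n))
    (hc : ∀ c : ℂ, p (algebraMap ℂ _ c)) (hadd : ∀ x y, p x → p y → p (x + y))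
    (hmul : ∀ x y, p x → p y → p (x * y)) (x : Uq q n) : p x := by
  have hx : x ∈ Algebra.adjoin ℂ
      (Set.range (fun p : Fin n × Fin n => t q p.1 p.2) ∪ {detStar q n}) := by
    rw [adjoin_eq_top]; trivial
  induction hx using Algebra.adjoin_induction with
  | mem x hx =>
    rcases hx with ⟨⟨i, j⟩, rfl⟩ | rfl
    · exact ht i j
    · exact hd
  | algebraMap c => exact hc c
  | add x y _ _ hx hy => exact hadd x y hx hy
  | mul x y _ _ hx hy => exact hmul x y hx hy

theorem exists_s (hq : q ≠ 0) (n : ℕ) :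
    ∃ s : Fin n → Fin n → Uq q n, IsMatInv (t q) s :=
  (isQMatrix_t hq n).exists_isMatInv hq
    (by rw [← det_eq hq, det_mul_detStar]) (by rw [← det_eq hq, detStar_mul_det])

/-- The inverse of the matrix of generators. -/
def s (hq : q ≠ 0) {n : ℕ} : Fin n → Fin n → Uq q n := (exists_s hq n).choose

theorem isMatInv (hq : q ≠ 0) (n : ℕ) : IsMatInv (t q : Fin n → Fin n → Uq q n) (s hq) :=
  (exists_s hq n).choose_spec

theorem isQMatrix_s (hq : q ≠ 0) (n : ℕ) :
    IsQMatrix q fun i j : Fin n => MulOpposite.op (s hq i j) :=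
  (isQMatrix_t hq n).inverse hq (isMatInv hq n)

theorem rowDet_s (hq : q ≠ 0) (n : ℕ) :
    rowDet q (fun i j : Fin n => MulOpposite.op (s hq i j)) = MulOpposite.op (detStar q n) :=
  (isQMatrix_t hq n).rowDet_inverse hq (isMatInv hq n) (by rw [← det_eq hq, det_mul_detStar])

/-! ### The Hopf algebra structure -/

/-- The comultiplication of `U_q(n)`. -/
def comul (hq : q ≠ 0) (n : ℕ) : Uq q n →ₐ[ℂ] Uq q n ⊗[ℂ] Uq q n :=
  have hc : ∀ i j k l : Fin n, Commute (t q i j ⊗ₜ[ℂ] (1 : Uq q n))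
      ((1 : Uq q n) ⊗ₜ[ℂ] t q k l) := fun i j k l => by
    simp [Commute, SemiconjBy]
  have h1 : IsQMatrix q fun i j : Fin n => t q i j ⊗ₜ[ℂ] (1 : Uq q n) :=
    (isQMatrix_t hq n).map (B := Uq q n ⊗[ℂ] Uq q n) Algebra.TensorProduct.includeLeft
  have h2 : IsQMatrix q fun i j : Fin n => (1 : Uq q n) ⊗ₜ[ℂ] t q i j :=
    (isQMatrix_t hq n).map (B := Uq q n ⊗[ℂ] Uq q n) Algebra.TensorProduct.includeRight
  have h3 : rowDet q (fun i j : Fin n => ∑ k, t q i k ⊗ₜ[ℂ] (1 : Uq q n) *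
      ((1 : Uq q n) ⊗ₜ[ℂ] t q k j)) = det q n ⊗ₜ[ℂ] det q n := by
    rw [rowDet_mul hq h2 hc]
    have e1 : rowDet q (fun i j : Fin n => t q i j ⊗ₜ[ℂ] (1 : Uq q n)) = det q n ⊗ₜ[ℂ] 1 := by
      rw [det_eq hq]
      exact (map_rowDet (A := Uq q n) (B := Uq q n ⊗[ℂ] Uq q n)
        Algebra.TensorProduct.includeLeft).symm
    have e2 : rowDet q (fun i j : Fin n => (1 : Uq q n) ⊗ₜ[ℂ] t q i j) = 1 ⊗ₜ[ℂ] det q n := by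
      rw [det_eq hq]
      exact (map_rowDet (A := Uq q n) (B := Uq q n ⊗[ℂ] Uq q n)
        Algebra.TensorProduct.includeRight).symm
    rw [e1, e2, Algebra.TensorProduct.tmul_mul_tmul, mul_one, one_mul]
  lift hq _ (h1.mul hq h2 hc) (detStar q n ⊗ₜ[ℂ] detStar q n)
    (by rw [h3, Algebra.TensorProduct.tmul_mul_tmul, det_mul_detStar]; rfl)
    (by rw [h3, Algebra.TensorProduct.tmul_mul_tmul, detStar_mul_det]; rfl)

theorem comul_t (hq : q ≠ 0) (i j : Fin n) :
    comul hq n (t q i j) = ∑ k, t q i k ⊗ₜ[ℂ] t q k j := by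
  simp [comul, lift_t]

theorem comul_detStar (hq : q ≠ 0) :
    comul hq n (detStar q n) = detStar q n ⊗ₜ[ℂ] detStar q n := lift_detStar

theorem isQMatrix_one (q : ℝ) (n : ℕ) :
    IsQMatrix q fun i j : Fin n => if i = j then (1 : ℂ) else 0 where
  row i a b hab := by
    have := hab.ne
    split_ifs <;> simp_all
  col a hij := by
    rename_i i j
    have := hij.ne
    split_ifs <;> simp_all
  comm _ _ := mul_comm _ _
  cross hij hab := by
    rename_i i j a b
    by_cases h : j = a
    · subst h
      simp [(hij.trans hab).ne, mul_comm]
    · simp [h, mul_comm]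

theorem rowDet_one (q : ℝ) (n : ℕ) :
    rowDet q (fun i j : Fin n => if i = j then (1 : ℂ) else 0) = 1 := by
  rw [rowDet, rowSum, Finset.sum_eq_single id]
  · simp [qSign_strictMono q strictMono_id]
  · intro c _ hc
    obtain ⟨i, hi⟩ : ∃ i, c i ≠ i := by
      by_contra! h
      exact hc (funext h)
    rw [List.prod_eq_zero, smul_zero]
    rw [List.mem_ofFn']
    exact ⟨i, by simp [Ne.symm hi]⟩
  · simp

/-- The counit of `U_q(n)`. -/
def counit (hq : q ≠ 0) (n : ℕ) : Uq q n →ₐ[ℂ] ℂ :=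
  lift hq _ (isQMatrix_one q n) 1 (by rw [rowDet_one, one_mul]) (by rw [rowDet_one, one_mul])

theorem counit_t (hq : q ≠ 0) (i j : Fin n) :
    counit hq n (t q i j) = if i = j then 1 else 0 := lift_t i j

theorem counit_detStar (hq : q ≠ 0) : counit hq n (detStar q n) = 1 := lift_detStar

/-- The antipode of `U_q(n)` as a homomorphism to the opposite algebra. -/
def antipodeHom (hq : q ≠ 0) (n : ℕ) : Uq q n →ₐ[ℂ] (Uq q n)ᵐᵒᵖ :=
  lift hq _ (isQMatrix_s hq n) (MulOpposite.op (det q n))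
    (by rw [rowDet_s, ← MulOpposite.op_mul, det_mul_detStar]; rfl)
    (by rw [rowDet_s, ← MulOpposite.op_mul, detStar_mul_det]; rfl)

/-- The antipode of `U_q(n)`. -/
def antipode (hq : q ≠ 0) (n : ℕ) : Uq q n →ₗ[ℂ] Uq q n :=
  (MulOpposite.opLinearEquiv ℂ).symm.toLinearMap ∘ₗ (antipodeHom hq n).toLinearMap

theorem antipode_apply (hq : q ≠ 0) (x : Uq q n) :
    antipode hq n x = (antipodeHom hq n x).unop := rfl

theorem antipode_t (hq : q ≠ 0) (i j : Fin n) : antipode hq n (t q i j) = s hq i j := by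
  rw [antipode_apply, antipodeHom, lift_t, MulOpposite.unop_op]

theorem antipode_detStar (hq : q ≠ 0) : antipode hq n (detStar q n) = det q n := by
  rw [antipode_apply, antipodeHom, lift_detStar, MulOpposite.unop_op]

theorem antipode_mul (hq : q ≠ 0) (x y : Uq q n) :
    antipode hq n (x * y) = antipode hq n y * antipode hq n x := by
  simp [antipode_apply]

theorem antipode_one (hq : q ≠ 0) : antipode hq n 1 = 1 := by
  simp [antipode_apply]

theorem antipode_algebraMap (hq : q ≠ 0) (c : ℂ) :
    antipode hq n (algebraMap ℂ _ c) = algebraMap ℂ _ c := by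
  rw [Algebra.algebraMap_eq_smul_one, map_smul, antipode_one]

end Uq

/-! ### Reduction of the antipode axioms to generators. -/

section Convolution

variable {A : Type*} [Ring A] [Algebra ℂ A] {S : A →ₗ[ℂ] A}

/-- As S reverses products, S((ab)₁)(ab)₂ is S(b₁) S(a₁)a₂ b₂, and the inner factor is already a
scalar. So the antipode axiom passes from factors to products. -/
theorem convolution_left_mul (hS : ∀ x y, S (x * y) = S y * S x) {c : ℂ} {x : A ⊗[ℂ] A}
    (hx : LinearMap.mul' ℂ A (S.rTensor A x) = algebraMap ℂ A c) (y : A ⊗[ℂ] A) :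
    LinearMap.mul' ℂ A (S.rTensor A (x * y)) = c • LinearMap.mul' ℂ A (S.rTensor A y) := by
  induction y using TensorProduct.induction_on with
  | zero => simp
  | add y z hy hz => rw [mul_add, map_add, map_add, hy, hz, map_add, map_add, smul_add]
  | tmul b b' =>
    have key : ∀ x : A ⊗[ℂ] A, LinearMap.mul' ℂ A (S.rTensor A (x * b ⊗ₜ[ℂ] b')) =
        S b * LinearMap.mul' ℂ A (S.rTensor A x) * b' := by
      intro x
      induction x using TensorProduct.induction_on with
      | zero => simp
      | add y z hy hz => rw [add_mul, map_add, map_add, hy, hz, map_add, map_add, mul_add, add_mul]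
      | tmul a a' => simp [hS, mul_assoc]
    rw [key, hx, ← Algebra.commutes, mul_assoc, ← Algebra.smul_def]
    simp

theorem convolution_right_mul (hS : ∀ x y, S (x * y) = S y * S x) {c : ℂ} {y : A ⊗[ℂ] A}
    (hy : LinearMap.mul' ℂ A (S.lTensor A y) = algebraMap ℂ A c) (x : A ⊗[ℂ] A) :
    LinearMap.mul' ℂ A (S.lTensor A (x * y)) = c • LinearMap.mul' ℂ A (S.lTensor A x) := by
  induction x using TensorProduct.induction_on with
  | zero => simp
  | add y z hy hz => rw [add_mul, map_add, map_add, hy, hz, map_add, map_add, smul_add]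
  | tmul a a' =>
    have key : ∀ y : A ⊗[ℂ] A, LinearMap.mul' ℂ A (S.lTensor A (a ⊗ₜ[ℂ] a' * y)) =
        a * LinearMap.mul' ℂ A (S.lTensor A y) * S a' := by
      intro x
      induction x using TensorProduct.induction_on with
      | zero => simp
      | add y z hy hz => rw [mul_add, map_add, map_add, hy, hz, map_add, map_add, mul_add, add_mul]
      | tmul b b' => simp [hS, mul_assoc]
    rw [key, hy, ← Algebra.commutes, mul_assoc, ← Algebra.smul_def]
    simp

end Convolution

namespace Uq

variable {q : ℝ} {n : ℕ}

theorem antipode_left_apply (hq : q ≠ 0) (x : Uq q n) :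
    LinearMap.mul' ℂ (Uq q n) ((antipode hq n).rTensor (Uq q n) (comul hq n x)) =
      algebraMap ℂ _ (counit hq n x) := by
  induction x using induction with
  | ht i j =>
    simp only [comul_t, map_sum, LinearMap.rTensor_tmul, LinearMap.mul'_apply, antipode_t,
      (isMatInv hq n).left, counit_t]
    split_ifs <;> simp
  | hd =>
    simp [comul_detStar, antipode_detStar, counit_detStar, det_mul_detStar]
  | hc c =>
    simp [Algebra.TensorProduct.algebraMap_apply, antipode_algebraMap]
  | hadd x y hx hy => simp only [map_add, hx, hy]
  | hmul x y hx hy =>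
    rw [map_mul, convolution_left_mul (antipode_mul hq) hx, hy, map_mul, map_mul, Algebra.smul_def]

theorem antipode_right_apply (hq : q ≠ 0) (x : Uq q n) :
    LinearMap.mul' ℂ (Uq q n) ((antipode hq n).lTensor (Uq q n) (comul hq n x)) =
      algebraMap ℂ _ (counit hq n x) := by
  induction x using induction with
  | ht i j =>
    simp only [comul_t, map_sum, LinearMap.lTensor_tmul, LinearMap.mul'_apply, antipode_t,
      (isMatInv hq n).right, counit_t]
    split_ifs <;> simp
  | hd =>
    simp [comul_detStar, antipode_detStar, counit_detStar, detStar_mul_det]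
  | hc c =>
    simp [Algebra.TensorProduct.algebraMap_apply, antipode_one]
  | hadd x y hx hy => simp only [map_add, hx, hy]
  | hmul x y hx hy =>
    rw [map_mul, convolution_right_mul (antipode_mul hq) hy, hx, map_mul, Algebra.smul_def, ← map_mul,
      mul_comm]

/-- The Hopf algebra structure of `U_q(n)`. -/
def hopf (hq : q ≠ 0) (n : ℕ) : HopfStructure (Uq q n) where
  comul := comul hq n
  counit := counit hq n
  antipode := antipode hq n
  coassoc := by
    have : ((Algebra.TensorProduct.assoc ℂ ℂ ℂ (Uq q n) (Uq q n) (Uq q n)).toAlgHom.comp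
        (Algebra.TensorProduct.map (comul hq n) (AlgHom.id ℂ _))).comp (comul hq n) =
        (Algebra.TensorProduct.map (AlgHom.id ℂ _) (comul hq n)).comp (comul hq n) := by
      refine algHom_ext (A := Uq q n ⊗[ℂ] (Uq q n ⊗[ℂ] Uq q n)) hq fun i j => ?_
      simp [comul_t, TensorProduct.sum_tmul, TensorProduct.tmul_sum]
      exact Finset.sum_comm
    exact congrArg AlgHom.toLinearMap this
  counit_left := by
    have : (Algebra.TensorProduct.map (counit hq n) (AlgHom.id ℂ _)).comp (comul hq n) =
        Algebra.TensorProduct.includeRight := by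
      refine algHom_ext (A := ℂ ⊗[ℂ] Uq q n) hq fun i j => ?_
      simp [comul_t, counit_t, TensorProduct.ite_tmul]
    exact congrArg AlgHom.toLinearMap this
  counit_right := by
    have : (Algebra.TensorProduct.map (AlgHom.id ℂ _) (counit hq n)).comp (comul hq n) =
        Algebra.TensorProduct.includeLeft := by
      refine algHom_ext (A := Uq q n ⊗[ℂ] ℂ) hq fun i j => ?_
      simp [comul_t, counit_t, TensorProduct.tmul_ite]
    exact congrArg AlgHom.toLinearMap this
  antipode_left := LinearMap.ext (antipode_left_apply hq)
  antipode_right := LinearMap.ext (antipode_right_apply hq)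

end Uq

/-! ### Complex conjugate algebras -/

/-- The complex conjugate of a `ℂ`-algebra. -/
def Bar (A : Type*) : Type _ := A

namespace Bar

variable {A : Type*} [Ring A] [Algebra ℂ A]

instance : Ring (Bar A) := inferInstanceAs (Ring A)

/-- The identity map to the conjugate algebra. -/
def mk : A ≃+* Bar A := RingEquiv.refl A

/-- Scalars act through conjugation, so conjugate linear antihomomorphisms from A to B become
algebra homomorphisms from A to `Bar Bᵐᵒᵖ`, to which universal properties apply. -/
instance : Algebra ℂ (Bar A) :=
  (((mk (A := A) : A →+* Bar A).comp (algebraMap ℂ A)).comp (starRingEnd ℂ)).toAlgebra'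
    fun c x => (Algebra.commutes (A := A) (conj c) x)

theorem algebraMap_def (c : ℂ) : algebraMap ℂ (Bar A) c = mk (algebraMap ℂ A (conj c)) := rfl

theorem smul_mk (c : ℂ) (x : A) : c • mk x = mk (conj c • x) := by
  rw [Algebra.smul_def, Algebra.smul_def, map_mul, algebraMap_def]

end Bar

section BarQ

variable {q : ℝ} {n : ℕ} {A : Type*} [Ring A] [Algebra ℂ A] {t : Fin n → Fin n → A}

theorem conj_wq (q : ℝ) : conj (wq q) = wq q := by simp [wq]

theorem conj_qSign (q : ℝ) {m : ℕ} (c : Fin n → Fin m) : conj (qSign q c) = qSign q c := by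
  unfold qSign
  split_ifs <;> simp

/-- The coefficients q and q − q⁻¹ are real, so conjugating scalars leaves the relations unchanged.
-/
theorem IsQMatrix.bar (h : IsQMatrix q t) : IsQMatrix q fun i j => Bar.mk (t i j) where
  row i _ _ hab := by simp only [← map_mul, Bar.smul_mk, Complex.conj_ofReal, h.row i hab]
  col a hij := by simp only [← map_mul, Bar.smul_mk, Complex.conj_ofReal, h.col a hij]
  comm hij hab := by simp only [← map_mul, h.comm hij hab]
  cross hij hab := by
    simp only [← map_mul, Bar.smul_mk, conj_wq, h.cross hij hab, map_add]

theorem rowDet_bar (q : ℝ) (t : Fin n → Fin n → A) :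
    rowDet q (fun i j => Bar.mk (t i j)) = Bar.mk (rowDet q t) := by
  simp only [rowDet, rowSum, map_sum]
  refine Finset.sum_congr rfl fun c _ => ?_
  rw [← conj_qSign, ← Bar.smul_mk, map_list_prod, List.map_ofFn]
  simp only [conj_qSign]
  rfl

/-- The antimultiplicative conjugate linear map given by a homomorphism to the conjugate of the
opposite algebra. -/
def antiMap {B : Type*} [Ring B] [Algebra ℂ B] (f : A →ₐ[ℂ] Bar Bᵐᵒᵖ) (x : A) : B :=
  (Bar.mk.symm (f x)).unop

section antiMap

variable {B : Type*} [Ring B] [Algebra ℂ B] (f : A →ₐ[ℂ] Bar Bᵐᵒᵖ)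

theorem antiMap_mul (x y : A) : antiMap f (x * y) = antiMap f y * antiMap f x := by
  simp [antiMap]

theorem antiMap_add (x y : A) : antiMap f (x + y) = antiMap f x + antiMap f y := by
  simp [antiMap]

theorem antiMap_one : antiMap f 1 = 1 := by
  simp [antiMap]

theorem antiMap_smul (c : ℂ) (x : A) : antiMap f (c • x) = conj c • antiMap f x := by
  unfold antiMap
  obtain ⟨y, hy⟩ := (Bar.mk (A := Bᵐᵒᵖ)).surjective (f x)
  rw [map_smul, ← hy, Bar.smul_mk]
  simp

theorem antiMap_algebraMap (c : ℂ) : antiMap f (algebraMap ℂ A c) = algebraMap ℂ B (conj c) := by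
  rw [Algebra.algebraMap_eq_smul_one, antiMap_smul, antiMap_one, Algebra.algebraMap_eq_smul_one]

theorem antiMap_zero : antiMap f 0 = 0 := by
  simp [antiMap]

theorem antiMap_sum {ι : Type*} (u : Finset ι) (x : ι → A) :
    antiMap f (∑ i ∈ u, x i) = ∑ i ∈ u, antiMap f (x i) := by
  simp [antiMap, Finset.unop_sum]

/-- The `*`-structure given by an involutive antimultiplicative conjugate linear map. -/
@[reducible]
def starRingOfHom (f : A →ₐ[ℂ] Bar Aᵐᵒᵖ) (hf : ∀ x, antiMap f (antiMap f x) = x) : StarRing A where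
  star := antiMap f
  star_involutive := hf
  star_mul := antiMap_mul f
  star_add := antiMap_add f

theorem starModuleOfHom (f : A →ₐ[ℂ] Bar Aᵐᵒᵖ) (hf : ∀ x, antiMap f (antiMap f x) = x) :
    @StarModule ℂ A _ (starRingOfHom f hf).toStar _ :=
  letI := starRingOfHom f hf
  ⟨antiMap_smul f⟩

end antiMap

end BarQ

/-! ### The `*`-structure of `U_q(n)` -/

namespace Uq

variable {q : ℝ} {n : ℕ}

/-- The `*`-operation of `U_q(n)` as a homomorphism. -/
def starHom (hq : q ≠ 0) (n : ℕ) : Uq q n →ₐ[ℂ] Bar (Uq q n)ᵐᵒᵖ :=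
  -- The generators go to the transposed inverse, and invariance under transposition identifies its
  -- determinant with `detStar`.
  have h : rowDet q (fun i j : Fin n => Bar.mk (MulOpposite.op (s hq j i))) =
      Bar.mk (MulOpposite.op (detStar q n)) := by
    rw [rowDet_bar q fun i j : Fin n => MulOpposite.op (s hq j i),
      (isQMatrix_s hq n).rowDet_transpose hq, rowDet_s]
  lift hq (fun i j : Fin n => Bar.mk (MulOpposite.op (s hq j i))) (isQMatrix_s hq n).transpose.bar
    (Bar.mk (MulOpposite.op (det q n)))
    (by rw [h, ← map_mul, ← MulOpposite.op_mul, det_mul_detStar]; rfl)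
    (by rw [h, ← map_mul, ← MulOpposite.op_mul, detStar_mul_det]; rfl)

/-- The `*`-operation of `U_q(n)`. -/
def conjMap (hq : q ≠ 0) : Uq q n → Uq q n := antiMap (starHom hq n)

theorem conjMap_t (hq : q ≠ 0) (i j : Fin n) : conjMap hq (t q i j) = s hq j i := by
  rw [conjMap, antiMap, starHom, lift_t]; rfl

theorem conjMap_detStar (hq : q ≠ 0) : conjMap hq (detStar q n) = det q n := by
  rw [conjMap, antiMap, starHom, lift_detStar]; rfl

theorem conjMap_mul (hq : q ≠ 0) (x y : Uq q n) :
    conjMap hq (x * y) = conjMap hq y * conjMap hq x := antiMap_mul _ x y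

theorem conjMap_add (hq : q ≠ 0) (x y : Uq q n) :
    conjMap hq (x + y) = conjMap hq x + conjMap hq y := antiMap_add _ x y

theorem conjMap_sum (hq : q ≠ 0) {ι : Type*} (u : Finset ι) (x : ι → Uq q n) :
    conjMap hq (∑ i ∈ u, x i) = ∑ i ∈ u, conjMap hq (x i) := antiMap_sum _ u x

theorem conjMap_smul (hq : q ≠ 0) (c : ℂ) (x : Uq q n) :
    conjMap hq (c • x) = conj c • conjMap hq x := antiMap_smul _ c x

theorem conjMap_one (hq : q ≠ 0) : conjMap hq (1 : Uq q n) = 1 := antiMap_one _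

theorem conjMap_zero (hq : q ≠ 0) : conjMap hq (0 : Uq q n) = 0 := antiMap_zero _

theorem conjMap_algebraMap (hq : q ≠ 0) (c : ℂ) :
    conjMap hq (algebraMap ℂ (Uq q n) c) = algebraMap ℂ _ (conj c) := antiMap_algebraMap _ c

theorem conjMap_det (hq : q ≠ 0) : conjMap hq (det q n) = detStar q n := by
  have h := congrArg (conjMap hq) (detStar_mul_det q n)
  rw [conjMap_mul, conjMap_one, conjMap_detStar] at h
  exact left_inv_eq_right_inv h (det_mul_detStar q n)

/-- Applying the involution to t s = 1 yields a one-sided inverse of the matrix `s`, and inverses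
are unique. -/
theorem conjMap_s (hq : q ≠ 0) (i j : Fin n) : conjMap hq (s hq i j) = t q j i := by
  have := (isMatInv hq n).symm.eq_of_left (u := fun j i => conjMap hq (s hq i j)) fun i j => by
    have h := congrArg (conjMap hq) ((isMatInv hq n).right j i)
    simp only [conjMap_sum, conjMap_mul, conjMap_t] at h
    rw [h, apply_ite (conjMap hq), conjMap_one, conjMap_zero]
    simp only [eq_comm]
  exact congrFun (congrFun this j) i

theorem conjMap_conjMap (hq : q ≠ 0) (x : Uq q n) : conjMap hq (conjMap hq x) = x := by
  induction x using induction with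
  | ht i j => rw [conjMap_t, conjMap_s]
  | hd => rw [conjMap_detStar, conjMap_det]
  | hc c => rw [conjMap_algebraMap, conjMap_algebraMap, Complex.conj_conj]
  | hadd x y hx hy => rw [conjMap_add, conjMap_add, hx, hy]
  | hmul x y hx hy => rw [conjMap_mul, conjMap_mul, hx, hy]

theorem comul_det (hq : q ≠ 0) : comul hq n (det q n) = det q n ⊗ₜ[ℂ] det q n := by
  have h1 : comul hq n (det q n) * comul hq n (detStar q n) = 1 := by
    rw [← map_mul, det_mul_detStar, map_one]
  have h2 : comul hq n (detStar q n) * det q n ⊗ₜ[ℂ] det q n = 1 := by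
    rw [comul_detStar, Algebra.TensorProduct.tmul_mul_tmul, detStar_mul_det]; rfl
  exact left_inv_eq_right_inv h1 h2

theorem counit_det (hq : q ≠ 0) : counit hq n (det q n) = 1 := by
  have h := congrArg (counit hq n) (det_mul_detStar q n)
  simpa [counit_detStar] using h

/-- Uniqueness of the inverse of the matrix Δ(t): the inner contraction gives t s = 1 in the second
factor, then in the first. -/
theorem comul_s (hq : q ≠ 0) (i j : Fin n) :
    comul hq n (s hq i j) = ∑ k, s hq k j ⊗ₜ[ℂ] s hq i k := by
  have h := (isMatInv hq n).map (B := Uq q n ⊗[ℂ] Uq q n) (comul hq n)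
  have := h.eq_of_right (u := fun i j => ∑ k, s hq k j ⊗ₜ[ℂ] s hq i k) fun i j => by
    simp only [comul_t, Finset.sum_mul_sum, Algebra.TensorProduct.tmul_mul_tmul]
    have e : ∀ x y : Fin n, ∑ k, (t q i x * s hq y j) ⊗ₜ[ℂ] (t q x k * s hq k y) =
        if x = y then (t q i x * s hq x j) ⊗ₜ[ℂ] (1 : Uq q n) else 0 := fun x y => by
      rw [← TensorProduct.tmul_sum, (isMatInv hq n).right]
      split_ifs with hxy
      · rw [hxy]
      · simp
    rw [Finset.sum_comm]
    calc _ = ∑ x : Fin n, (t q i x * s hq x j) ⊗ₜ[ℂ] (1 : Uq q n) := by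
          refine Finset.sum_congr rfl fun x _ => ?_
          rw [Finset.sum_comm]
          simp only [e]
          simp
      _ = _ := by
          rw [← TensorProduct.sum_tmul, (isMatInv hq n).right]
          split_ifs <;> simp [Algebra.TensorProduct.one_def]
  exact (congrFun (congrFun this i) j).symm

theorem counit_s (hq : q ≠ 0) (i j : Fin n) :
    counit hq n (s hq i j) = if i = j then 1 else 0 := by
  have h := congrArg (counit hq n) ((isMatInv hq n).right i j)
  simp only [map_sum, map_mul, counit_t, ite_mul, one_mul, zero_mul, Finset.sum_ite_eq,
    Finset.mem_univ, if_true] at h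
  rw [h]
  split_ifs <;> simp

/-- The Hopf `*`-algebra structure of `U_q(n)`. -/
def hopfStar (hq : q ≠ 0) (n : ℕ) : HopfStarStructure (Uq q n) where
  toHopfStructure := hopf hq n
  starRing := starRingOfHom (starHom hq n) (conjMap_conjMap hq)
  starModule := starModuleOfHom (starHom hq n) (conjMap_conjMap hq)
  comul_star a := by
    let _ := starRingOfHom (starHom hq n) (conjMap_conjMap hq)
    have := starModuleOfHom (starHom hq n) (conjMap_conjMap hq)
    change comul hq n (conjMap hq a) = star (comul hq n a)
    have hs : ∀ x y : Uq q n, star (x ⊗ₜ[ℂ] y) = conjMap hq x ⊗ₜ[ℂ] conjMap hq y :=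
      fun x y => TensorProduct.star_tmul x y
    induction a using induction with
    | ht i j =>
      rw [comul_t, conjMap_t, comul_s, star_sum]
      simp only [hs, conjMap_t]
    | hd => rw [conjMap_detStar, comul_detStar, comul_det, hs, conjMap_detStar]
    | hc c =>
      rw [conjMap_algebraMap, AlgHom.commutes, AlgHom.commutes, Algebra.algebraMap_eq_smul_one,
        Algebra.algebraMap_eq_smul_one, star_smul, star_one]
      rfl
    | hadd x y hx hy => rw [conjMap_add, map_add, map_add, star_add, hx, hy]
    | hmul x y hx hy => rw [conjMap_mul, map_mul, map_mul, star_mul, hx, hy]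
  counit_star a := by
    change counit hq n (conjMap hq a) = conj (counit hq n a)
    induction a using induction with
    | ht i j =>
      rw [conjMap_t, counit_t, counit_s]
      split_ifs <;> simp_all
    | hd => rw [conjMap_detStar, counit_detStar, counit_det, map_one]
    | hc c =>
      rw [conjMap_algebraMap, AlgHom.commutes, AlgHom.commutes]
      rfl
    | hadd x y hx hy => rw [conjMap_add, map_add, map_add, map_add, hx, hy]
    | hmul x y hx hy => rw [conjMap_mul, map_mul, map_mul, map_mul, hx, hy, mul_comm]

theorem isStandard_hopfStar (hq : q ≠ 0) (n : ℕ) : IsStandard (hopfStar hq n) where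
  comul_t := comul_t hq
  counit_t := counit_t hq
  star_t i j := (conjMap_t hq i j).trans (antipode_t hq j i).symm
  star_det := conjMap_det hq

/-! ### The restriction homomorphism -/

/-- The homomorphism `U_q(n+1) → U_q(n)`. -/
def restrict (hq : q ≠ 0) (n : ℕ) : Uq q (n + 1) →ₐ[ℂ] Uq q n :=
  lift hq (oneBlock (t q)) (isQMatrix_t hq n).oneBlock (detStar q n)
    (by rw [rowDet_oneBlock, ← det_eq hq, det_mul_detStar])
    (by rw [rowDet_oneBlock, ← det_eq hq, detStar_mul_det])

theorem restrict_t (hq : q ≠ 0) (i j : Fin (n + 1)) :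
    restrict hq n (t q i j) = oneBlock (t q) i j := lift_t i j

theorem restrict_detStar (hq : q ≠ 0) : restrict hq n (detStar q (n + 1)) = detStar q n :=
  lift_detStar

theorem restrict_det (hq : q ≠ 0) : restrict hq n (det q (n + 1)) = det q n := by
  rw [restrict, lift_det, rowDet_oneBlock, ← det_eq hq]

theorem isMatInv_oneBlock {A : Type*} [Ring A] {t u : Fin n → Fin n → A}
    (h : IsMatInv t u) : IsMatInv (oneBlock t) (oneBlock u) where
  right i j := by
    cases i using Fin.cases <;> cases j using Fin.cases <;>
      simp [Fin.sum_univ_succ, oneBlock_zero_zero, oneBlock_zero_succ, oneBlock_succ_zero,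
        oneBlock_succ_succ, h.right, Fin.succ_ne_zero, (Fin.succ_ne_zero _).symm]
  left i j := by
    cases i using Fin.cases <;> cases j using Fin.cases <;>
      simp [Fin.sum_univ_succ, oneBlock_zero_zero, oneBlock_zero_succ, oneBlock_succ_zero,
        oneBlock_succ_succ, h.left, Fin.succ_ne_zero, (Fin.succ_ne_zero _).symm]

theorem restrict_s (hq : q ≠ 0) (i j : Fin (n + 1)) :
    restrict hq n (s hq i j) = oneBlock (s hq) i j := by
  have h1 := (isMatInv hq (n + 1)).map (restrict hq n)
  simp only [restrict_t] at h1
  have h := h1.eq_of_right (u := oneBlock (s hq)) (isMatInv_oneBlock (isMatInv hq n)).right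
  exact (congrFun (congrFun h i) j).symm

theorem isRestriction_restrict (hq : q ≠ 0) (n : ℕ) : IsRestriction (restrict hq n) where
  zero_zero := restrict_t hq 0 0
  zero_succ i := restrict_t hq 0 i.succ
  succ_zero i := restrict_t hq i.succ 0
  succ_succ i j := restrict_t hq i.succ j.succ

theorem restrict_surjective (hq : q ≠ 0) (n : ℕ) : Function.Surjective (restrict hq n) := by
  intro x
  induction x using induction with
  | ht i j => exact ⟨t q i.succ j.succ, restrict_t hq _ _⟩
  | hd => exact ⟨detStar q (n + 1), restrict_detStar hq⟩
  | hc c => exact ⟨algebraMap ℂ _ c, AlgHom.commutes _ c⟩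
  | hadd x y hx hy =>
    obtain ⟨a, rfl⟩ := hx
    obtain ⟨b, rfl⟩ := hy
    exact ⟨a + b, map_add _ a b⟩
  | hmul x y hx hy =>
    obtain ⟨a, rfl⟩ := hx
    obtain ⟨b, rfl⟩ := hy
    exact ⟨a * b, map_mul _ a b⟩

theorem comul_restrict (hq : q ≠ 0) (p : Uq q (n + 1)) :
    comul hq n (restrict hq n p) =
      Algebra.TensorProduct.map (restrict hq n) (restrict hq n) (comul hq (n + 1) p) := by
  have : (comul hq n).comp (restrict hq n) =
      (Algebra.TensorProduct.map (restrict hq n) (restrict hq n)).comp (comul hq (n + 1)) := by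
    refine algHom_ext (A := Uq q n ⊗[ℂ] Uq q n) hq fun i j => ?_
    cases i using Fin.cases <;> cases j using Fin.cases <;>
      simp [comul_t, restrict_t, Fin.sum_univ_succ, oneBlock_zero_zero, oneBlock_zero_succ,
        oneBlock_succ_zero, oneBlock_succ_succ, Algebra.TensorProduct.one_def]
  exact DFunLike.congr_fun this p

theorem counit_restrict (hq : q ≠ 0) (p : Uq q (n + 1)) :
    counit hq n (restrict hq n p) = counit hq (n + 1) p := by
  have : (counit hq n).comp (restrict hq n) = counit hq (n + 1) := by
    refine algHom_ext hq fun i j => ?_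
    cases i using Fin.cases <;> cases j using Fin.cases <;>
      simp [counit_t, restrict_t, oneBlock_zero_zero, oneBlock_zero_succ,
        oneBlock_succ_zero, oneBlock_succ_succ, Fin.succ_ne_zero, (Fin.succ_ne_zero _).symm]
  exact DFunLike.congr_fun this p

theorem antipode_restrict (hq : q ≠ 0) (p : Uq q (n + 1)) :
    antipode hq n (restrict hq n p) = restrict hq n (antipode hq (n + 1) p) := by
  induction p using induction with
  | ht i j =>
    cases i using Fin.cases <;> cases j using Fin.cases <;>
      simp [restrict_t, antipode_t, restrict_s, oneBlock_zero_zero, oneBlock_zero_succ,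
        oneBlock_succ_zero, oneBlock_succ_succ, antipode_one]
  | hd => rw [restrict_detStar, antipode_detStar, antipode_detStar, restrict_det]
  | hc c => rw [AlgHom.commutes, antipode_algebraMap, antipode_algebraMap, AlgHom.commutes]
  | hadd x y hx hy => rw [map_add, map_add, map_add, map_add, hx, hy]
  | hmul x y hx hy => rw [map_mul, antipode_mul, antipode_mul, map_mul, hx, hy]

theorem conjMap_restrict (hq : q ≠ 0) (p : Uq q (n + 1)) :
    conjMap hq (restrict hq n p) = restrict hq n (conjMap hq p) := by
  induction p using induction with
  | ht i j =>
    cases i using Fin.cases <;> cases j using Fin.cases <;>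
      simp [restrict_t, conjMap_t, restrict_s, oneBlock_zero_zero, oneBlock_zero_succ,
        oneBlock_succ_zero, oneBlock_succ_succ, conjMap_one, conjMap_zero]
  | hd => rw [restrict_detStar, conjMap_detStar, conjMap_detStar, restrict_det]
  | hc c => rw [AlgHom.commutes, conjMap_algebraMap, conjMap_algebraMap, AlgHom.commutes]
  | hadd x y hx hy => rw [map_add, conjMap_add, conjMap_add, map_add, hx, hy]
  | hmul x y hx hy => rw [map_mul, conjMap_mul, conjMap_mul, map_mul, hx, hy]

theorem isHopfStarHom_restrict (hq : q ≠ 0) (n : ℕ) :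
    IsHopfStarHom (hopfStar hq (n + 1)) (hopfStar hq n) (restrict hq n) where
  map_comul := comul_restrict hq
  map_counit := counit_restrict hq
  map_antipode := antipode_restrict hq
  map_star := conjMap_restrict hq

end Uq

/-! ### Vectors fixed by the first row of a quantum matrix -/

section FixedVectors

variable {q : ℝ} {n : ℕ} {M : Type*} [AddCommGroup M] [Module ℂ M]

/-- A vector on which `t 0 j` and `s j 0` act as the Kronecker symbol. -/
structure IsFixed (t s : Fin (n + 1) → Fin (n + 1) → Module.End ℂ M) (e : M) : Prop where
  t_zero : ∀ j, t 0 j e = if j = 0 then e else 0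
  s_zero : ∀ j, s j 0 e = if j = 0 then e else 0

variable {t s : Fin (n + 1) → Fin (n + 1) → Module.End ℂ M} {e : M}

/-- Evaluate ∑ t j k s k 0 = δ on `e`; only k = 0 survives. -/
theorem IsFixed.t_apply_zero (he : IsFixed t s e) (h : IsMatInv t s) (j : Fin (n + 1)) :
    t j 0 e = if j = 0 then e else 0 := by
  have := congrArg (fun f : Module.End ℂ M => f e) (h.right j 0)
  simp only [LinearMap.sum_apply, Module.End.mul_apply, he.s_zero, apply_ite (t j _), map_zero,
    Finset.sum_ite_eq', Finset.mem_univ, if_true] at this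
  rw [this]
  split_ifs <;> simp

/-- The partial sums of `∑ t 0 j s j b` in the relations between `t` and `s` on a fixed vector. -/
theorem IsFixed.partial_sum (hq : q ≠ 0) (ht : IsQMatrix q t) (h : IsMatInv t s)
    (he : IsFixed t s e) {b : Fin (n + 1)} (hb : b ≠ 0) (j : Fin (n + 1)) :
    (q : ℂ) • t 0 j (s j b e) + wq q • ∑ k ∈ Finset.univ.filter (· < j), t 0 k (s k b e) =
      if j = 0 then s j b e else 0 := by
  have := congrArg (fun f : Module.End ℂ M => f e) (ht.mixed hq h 0 j j b)
  simp only [dg, hb.symm, if_false, one_smul, add_zero, if_true, LinearMap.add_apply,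
    LinearMap.smul_apply, Module.End.mul_apply, LinearMap.sum_apply, he.t_zero] at this
  rw [← this]
  split_ifs <;> simp

/-- Let Z_m be the sum of the first m terms t 0 k (s k b e). For j ≠ 0, `partial_sum` says Z_{j+1} =
q⁻² Z_j. The full sum is δ = 0 because b ≠ 0, so Z_1 = 0, and then every term vanishes. -/
theorem IsFixed.t_zero_s_apply_of_ne (hq : q ≠ 0) (ht : IsQMatrix q t) (h : IsMatInv t s)
    (he : IsFixed t s e) {b : Fin (n + 1)} (hb : b ≠ 0) (j : Fin (n + 1)) :
    t 0 j (s j b e) = 0 := by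
  have hq' : (q : ℂ) ≠ 0 := by exact_mod_cast hq
  have hZ : ∀ m (hm : m ≤ n), ∑ k ∈ Finset.univ.filter (fun k : Fin (n + 1) => (k : ℕ) < m + 1),
      t 0 k (s k b e) = ((q : ℂ)⁻¹ ^ 2) ^ m • t 0 0 (s 0 b e) := by
    intro m
    induction m with
    | zero =>
      intro _
      rw [Finset.sum_eq_single 0]
      · simp
      · intro k hk hk0
        simp at hk
        exact absurd hk hk0
      · simp
    | succ m ih =>
      intro hm
      set j : Fin (n + 1) := ⟨m + 1, by omega⟩ with hj
      have hs : Finset.univ.filter (fun k : Fin (n + 1) => (k : ℕ) < m + 1 + 1) =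
          insert j (Finset.univ.filter (fun k : Fin (n + 1) => (k : ℕ) < m + 1)) := by
        ext k
        simp [Fin.ext_iff, hj]
        omega
      have hlt : Finset.univ.filter (fun k : Fin (n + 1) => k < j) =
          Finset.univ.filter (fun k : Fin (n + 1) => (k : ℕ) < m + 1) := by
        ext k
        simp [Fin.lt_def, hj]
      have h1 := he.partial_sum hq ht h hb j
      rw [hlt, if_neg (by simp [hj, Fin.ext_iff]), ih (by omega)] at h1
      rw [hs, Finset.sum_insert (by simp [hj]), ih (by omega)]
      have h2 : t 0 j (s j b e) =
          -((q : ℂ)⁻¹ * wq q) • ((q : ℂ)⁻¹ ^ 2) ^ m • t 0 0 (s 0 b e) := by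
        rw [neg_smul, mul_smul, ← smul_right_injective M hq' |>.eq_iff]
        rw [smul_neg, smul_smul (q : ℂ), mul_inv_cancel₀ hq', one_smul]
        exact eq_neg_of_add_eq_zero_left h1
      rw [h2, smul_smul, ← add_smul]
      congr 1
      simp only [wq, pow_succ]
      field_simp
      ring
  have hsum := congrArg (fun f : Module.End ℂ M => f e) (h.right 0 b)
  simp only [hb.symm, if_false, LinearMap.sum_apply, Module.End.mul_apply, LinearMap.zero_apply]
    at hsum
  have h0 : t 0 0 (s 0 b e) = 0 := by
    have h1 := hZ n le_rfl
    rw [Finset.filter_true_of_mem (fun k _ => k.2), hsum] at h1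
    exact (smul_eq_zero.1 h1.symm).resolve_left (by simp [hq'])
  by_cases hj : j = 0
  · rw [hj, h0]
  · have h1 := he.partial_sum hq ht h hb j
    rw [if_neg hj] at h1
    obtain ⟨m, hm⟩ : ∃ m, (j : ℕ) = m + 1 := 
      Nat.exists_eq_succ_of_ne_zero (Fin.val_ne_zero_iff.2 hj)
    have hlt : Finset.univ.filter (fun k : Fin (n + 1) => k < j) =
        Finset.univ.filter (fun k : Fin (n + 1) => (k : ℕ) < m + 1) := by
      ext k
      simp [Fin.lt_def, hm]
    rw [hlt, hZ m (by omega), h0, smul_zero, smul_zero, add_zero] at h1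
    exact (smul_eq_zero.1 h1).resolve_left hq'

theorem IsFixed.s_zero_apply (hq : q ≠ 0) (ht : IsQMatrix q t) (h : IsMatInv t s)
    (he : IsFixed t s e) (b : Fin (n + 1)) : s 0 b e = if b = 0 then e else 0 := by
  by_cases hb : b = 0
  · rw [hb, if_pos rfl, he.s_zero, if_pos rfl]
  · have h1 := he.partial_sum hq ht h hb 0
    rw [he.t_zero_s_apply_of_ne hq ht h hb, if_pos rfl] at h1
    simp only [Fin.not_lt_zero, Finset.filter_false, Finset.sum_empty, smul_zero, add_zero] at h1
    rw [if_neg hb, ← h1]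

/-- The RTT and mixed relations move `t 0 j` and `s j 0` past `t i a` so that they act on `e`. The
corrections vanish because `t 0 a e = 0` for a ≠ 0 and `t i 0 e = 0` for i ≠ 0. -/
theorem IsFixed.t_apply (hq : q ≠ 0) (ht : IsQMatrix q t) (h : IsMatInv t s)
    (he : IsFixed t s e) (i a : Fin (n + 1)) : IsFixed t s (t i a e) := by
  by_cases hi : i = 0
  · rw [hi, he.t_zero]
    split_ifs
    · exact he
    · exact ⟨fun j => by simp, fun j => by simp⟩
  have hi0 := he.t_apply_zero h i
  rw [if_neg hi] at hi0
  refine ⟨fun j => ?_, fun j => ?_⟩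
  · have := congrArg (fun f : Module.End ℂ M => f e) ((isQMatrix_iff hq).1 ht 0 i j a)
    simp only [dg, (Ne.symm hi), if_false, one_smul, Fin.pos_iff_ne_zero.2 hi, if_true,
      LinearMap.add_apply, LinearMap.smul_apply, Module.End.mul_apply, he.t_zero,
      apply_ite (fun f : Module.End ℂ M => f e), LinearMap.zero_apply] at this
    by_cases hj : j = 0
    · subst hj
      by_cases ha : a = 0
      · subst ha
        simp [hi0]
      · simpa [ha, Ne.symm ha] using this
    · by_cases ha : a = 0
      · subst ha
        simp [hj, hi0]
      · simpa [hj, ha] using this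
  · have := congrArg (fun f : Module.End ℂ M => f e) (ht.mixed hq h i j a 0)
    simp only [dg, hi, if_false, one_smul, add_zero,
      LinearMap.add_apply, LinearMap.smul_apply, Module.End.mul_apply, he.s_zero,
      apply_ite (fun f : Module.End ℂ M => f e), LinearMap.zero_apply, LinearMap.sum_apply] at this
    rw [this]
    by_cases hj : j = 0
    · subst hj
      by_cases ha : a = 0
      · subst ha
        simp [hi0]
      · simp [ha]
    · have h0 : ∑ k ∈ Finset.univ.filter (· < j), t i k (if k = 0 then e else 0) = 0 := by
        refine Finset.sum_eq_zero fun k _ => ?_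
        split_ifs with hk
        · rw [hk, hi0]
        · simp
      simp only [h0, hj, if_false, map_zero, smul_zero, ite_self, add_zero]

theorem IsFixed.s_apply (hq : q ≠ 0) (ht : IsQMatrix q t) (h : IsMatInv t s)
    (he : IsFixed t s e) (i a : Fin (n + 1)) : IsFixed t s (s i a e) := by
  by_cases ha : a = 0
  · rw [ha, he.s_zero]
    split_ifs
    · exact he
    · exact ⟨fun j => by simp, fun j => by simp⟩
  have h0 := he.s_zero_apply hq ht h a
  rw [if_neg ha] at h0
  refine ⟨fun j => ?_, fun j => ?_⟩
  -- For j = i the mixed relation contains a partial sum, and the previous vanishing result is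
  -- needed; for j ≠ i the two operators simply change places.
  · by_cases hij : j = i
    · subst hij
      rw [he.t_zero_s_apply_of_ne hq ht h ha]
      split_ifs with hj
      · rw [hj, h0]
      · rfl
    · have := congrArg (fun f : Module.End ℂ M => f e) (ht.mixed hq h 0 i j a)
      simp only [dg, hij, Ne.symm ha, if_false, one_smul, add_zero, Module.End.mul_apply,
        he.t_zero] at this
      rw [← this]
      split_ifs <;> simp
  · have := congrArg (fun f : (Module.End ℂ M)ᵐᵒᵖ => f.unop e)
      ((isQMatrix_iff hq).1 (ht.inverse hq h) j i 0 a)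
    simp only [dg, Ne.symm ha, if_false, one_smul, add_zero, MulOpposite.unop_add,
      MulOpposite.unop_smul, MulOpposite.unop_mul, MulOpposite.unop_op, Fin.not_lt_zero,
      LinearMap.add_apply, LinearMap.smul_apply, Module.End.mul_apply, he.s_zero,
      apply_ite (fun f : (Module.End ℂ M)ᵐᵒᵖ => f.unop e), MulOpposite.unop_zero,
      LinearMap.zero_apply] at this
    rw [← this]
    by_cases hj : j = 0
    · subst hj
      by_cases hi : i = 0
      · subst hi
        simp [h0]
      · simp [hi, Ne.symm hi]
    · by_cases hi : i = 0
      · subst hi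
        simp [hj]
      · simp [hj, hi]

/-- The space of fixed vectors. -/
def fixedSubmodule (t s : Fin (n + 1) → Fin (n + 1) → Module.End ℂ M) : Submodule ℂ M where
  carrier := {v | IsFixed t s v}
  zero_mem' := ⟨fun j => by simp, fun j => by simp⟩
  add_mem' := fun {a b} ha hb => ⟨fun j => by
    rw [map_add, ha.t_zero, hb.t_zero]; split_ifs <;> simp, fun j => by
    rw [map_add, ha.s_zero, hb.s_zero]; split_ifs <;> simp⟩
  smul_mem' := fun c a ha => ⟨fun j => by
    rw [map_smul, ha.t_zero]; split_ifs <;> simp, fun j => by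
    rw [map_smul, ha.s_zero]; split_ifs <;> simp⟩

end FixedVectors

/-! ### Horizontal forms -/

section Horizontal

variable {P : Type} [Ring P] [Algebra ℂ P] {B : Subalgebra ℂ P}

theorem horizontalForms_mono {B C : Subalgebra ℂ P} (h : B ≤ C) :
    horizontalForms B ≤ horizontalForms C := by
  refine Submodule.span_mono ?_
  rintro _ ⟨u, w, η, hη, rfl⟩
  refine ⟨u, w, Algebra.TensorProduct.map (Subalgebra.inclusion h) (Subalgebra.inclusion h) η,
    ?_, ?_⟩
  · rw [universalForms, LinearMap.mem_ker] at hη ⊢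
    have : ∀ η : B ⊗[ℂ] B, LinearMap.mul' ℂ C (Algebra.TensorProduct.map
        (Subalgebra.inclusion h) (Subalgebra.inclusion h) η) =
        Subalgebra.inclusion h (LinearMap.mul' ℂ B η) := by
      intro η
      induction η using TensorProduct.induction_on with
      | zero => simp
      | add x y hx hy => simp only [map_add, hx, hy]
      | tmul x y => simp
    rw [this, hη, map_zero]
  · have : ∀ η : B ⊗[ℂ] B, Algebra.TensorProduct.map B.val B.val η =
        Algebra.TensorProduct.map C.val C.val (Algebra.TensorProduct.map
        (Subalgebra.inclusion h) (Subalgebra.inclusion h) η) := by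
      intro η
      induction η using TensorProduct.induction_on with
      | zero => simp
      | add x y hx hy => simp only [map_add, hx, hy]
      | tmul x y => simp
    rw [this]

theorem mul_mem_horizontalForms (u w : P) {z : P ⊗[ℂ] P} (hz : z ∈ horizontalForms B) :
    (u ⊗ₜ[ℂ] (1 : P)) * z * ((1 : P) ⊗ₜ[ℂ] w) ∈ horizontalForms B := by
  induction hz using Submodule.span_induction with
  | mem x hx =>
    obtain ⟨u', w', η, hη, rfl⟩ := hx
    refine Submodule.subset_span ⟨u * u', w' * w, η, hη, ?_⟩
    have e1 : ((u * u') ⊗ₜ[ℂ] (1 : P)) = (u ⊗ₜ[ℂ] (1 : P)) * (u' ⊗ₜ[ℂ] (1 : P)) := by simp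
    have e2 : ((1 : P) ⊗ₜ[ℂ] (w' * w)) = ((1 : P) ⊗ₜ[ℂ] w') * ((1 : P) ⊗ₜ[ℂ] w) := by simp
    rw [e1, e2]
    simp only [mul_assoc]
  | zero => simp
  | add x y _ _ hx hy => rw [mul_add, add_mul]; exact add_mem hx hy
  | smul c x _ hx => rw [mul_smul_comm, smul_mul_assoc]; exact Submodule.smul_mem _ c hx

theorem tmul_one_sub_mem_horizontalForms {b : P} (hb : b ∈ B) :
    b ⊗ₜ[ℂ] (1 : P) - (1 : P) ⊗ₜ[ℂ] b ∈ horizontalForms B := by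
  refine Submodule.subset_span ⟨1, 1, (⟨b, hb⟩ : B) ⊗ₜ[ℂ] (1 : B) - (1 : B) ⊗ₜ[ℂ] ⟨b, hb⟩, ?_, ?_⟩
  · simp [universalForms]
  · simp [← Algebra.TensorProduct.one_def]

/-- Each difference b ⊗ p − 1 ⊗ bp is (b ⊗ 1 − 1 ⊗ b)(1 ⊗ p). This is the shape taken by x₁ ⊗ S(x₂)
for the generators x of ker α. -/
theorem sum_tmul_sub_mem_horizontalForms {m : ℕ} {b : Fin m → P} (hb : ∀ k, b k ∈ B)
    (p : Fin m → P) :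
    ∑ k, b k ⊗ₜ[ℂ] p k - 1 ⊗ₜ[ℂ] ∑ k, b k * p k ∈ horizontalForms B := by
  have : ∑ k, b k ⊗ₜ[ℂ] p k - 1 ⊗ₜ[ℂ] ∑ k, b k * p k = ∑ k, ((1 : P) ⊗ₜ[ℂ] (1 : P)) *
      (b k ⊗ₜ[ℂ] (1 : P) - (1 : P) ⊗ₜ[ℂ] b k) * ((1 : P) ⊗ₜ[ℂ] p k) := by
    simp [TensorProduct.tmul_sum, sub_mul, mul_sub]
  rw [this]
  exact sum_mem fun k _ => mul_mem_horizontalForms _ _ (tmul_one_sub_mem_horizontalForms (hb k))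

/-- The easy inclusion: on coinvariants the coaction is trivial, so both maps send uηw to an
expression that contains the product of η, which is 0. -/
theorem horizontalForms_le {A : Type} [Ring A] [Algebra ℂ A] (β : P →ₐ[ℂ] A ⊗[ℂ] P) :
    horizontalForms (coinvariants β) ≤ universalForms P ⊓ LinearMap.ker (bundleMap β) := by
  refine Submodule.span_le.2 ?_
  rintro _ ⟨u, w, η, hη, rfl⟩
  rw [universalForms, LinearMap.mem_ker] at hη
  have h1 : ∀ η : coinvariants β ⊗[ℂ] coinvariants β, LinearMap.mul' ℂ P
      ((u ⊗ₜ[ℂ] (1 : P)) * Algebra.TensorProduct.map (coinvariants β).val (coinvariants β).val η *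
      ((1 : P) ⊗ₜ[ℂ] w)) = u * (LinearMap.mul' ℂ (coinvariants β) η : P) * w := by
    intro η
    induction η using TensorProduct.induction_on with
    | zero => simp
    | add x y hx hy => simp only [map_add, mul_add, add_mul, hx, hy, Subalgebra.coe_add]
    | tmul x y => simp [mul_assoc]
  have h2 : ∀ η : coinvariants β ⊗[ℂ] coinvariants β, bundleMap β
      ((u ⊗ₜ[ℂ] (1 : P)) * Algebra.TensorProduct.map (coinvariants β).val (coinvariants β).val η *
      ((1 : P) ⊗ₜ[ℂ] w)) =
      β u * (1 ⊗ₜ[ℂ] (LinearMap.mul' ℂ (coinvariants β) η : P)) * (1 ⊗ₜ[ℂ] w) := by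
    intro η
    induction η using TensorProduct.induction_on with
    | zero => simp
    | add x y hx hy =>
      simp only [map_add, mul_add, add_mul, hx, hy, Subalgebra.coe_add, TensorProduct.tmul_add]
    | tmul x y =>
      have hx : β x = 1 ⊗ₜ[ℂ] (x : P) := x.2
      simp [bundleMap, mul_assoc, hx]
  refine ⟨?_, ?_⟩
  · change LinearMap.mul' ℂ P _ = 0
    rw [h1, hη]
    simp
  · change bundleMap β _ = 0
    rw [h2, hη]
    simp

/-- Right exactness of the tensor product: the kernel of f ⊗ id is the image of ker f ⊗ P. -/
theorem mem_of_rTensor_eq_zero {A : Type} [Ring A] [Algebra ℂ A] {f : P →ₐ[ℂ] A}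
    (hf : Function.Surjective f) {y : P ⊗[ℂ] P} (hy : f.toLinearMap.rTensor P y = 0)
    {V : Submodule ℂ (P ⊗[ℂ] P)} (hV : ∀ x w, f x = 0 → x ⊗ₜ[ℂ] w ∈ V) : y ∈ V := by
  have hex := rTensor_exact P (LinearMap.exact_subtype_ker_map f.toLinearMap) hf
  obtain ⟨y, rfl⟩ := (hex y).1 hy
  clear hy
  induction y using TensorProduct.induction_on with
  | zero => simp
  | add x y hx hy => rw [map_add]; exact add_mem hx hy
  | tmul x p => exact hV _ _ x.2

end Horizontal

/-! ### The quantum principal bundle `U_q(n+1) → U_q(n)` -/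

namespace Uq

variable {q : ℝ} {n : ℕ}

/-- The coaction of `U_q(n)` on `U_q(n+1)`. -/
def coaction (hq : q ≠ 0) (n : ℕ) : Uq q (n + 1) →ₐ[ℂ] Uq q n ⊗[ℂ] Uq q (n + 1) :=
  (Algebra.TensorProduct.map (restrict hq n) (AlgHom.id ℂ (Uq q (n + 1)))).comp (comul hq (n + 1))

theorem coaction_t (hq : q ≠ 0) (i j : Fin (n + 1)) :
    coaction hq n (t q i j) = ∑ k, restrict hq n (t q i k) ⊗ₜ[ℂ] t q k j := by
  simp [coaction, comul_t]

theorem coaction_s (hq : q ≠ 0) (i j : Fin (n + 1)) :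
    coaction hq n (s hq i j) = ∑ k, restrict hq n (s hq k j) ⊗ₜ[ℂ] s hq i k := by
  simp [coaction, comul_s]

theorem coaction_detStar (hq : q ≠ 0) :
    coaction hq n (detStar q (n + 1)) = detStar q n ⊗ₜ[ℂ] detStar q (n + 1) := by
  simp [coaction, comul_detStar, restrict_detStar]

theorem coaction_coassoc (hq : q ≠ 0) : (TensorProduct.assoc ℂ _ _ _).toLinearMap ∘ₗ
    (comul hq n).toLinearMap.rTensor (Uq q (n + 1)) ∘ₗ (coaction hq n).toLinearMap =
      (coaction hq n).toLinearMap.lTensor _ ∘ₗ (coaction hq n).toLinearMap := by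
  have : ((Algebra.TensorProduct.assoc ℂ ℂ ℂ (Uq q n) (Uq q n) (Uq q (n + 1))).toAlgHom.comp
      (Algebra.TensorProduct.map (comul hq n) (AlgHom.id ℂ _))).comp (coaction hq n) =
      (Algebra.TensorProduct.map (AlgHom.id ℂ _) (coaction hq n)).comp (coaction hq n) := by
    refine algHom_ext (A := Uq q n ⊗[ℂ] (Uq q n ⊗[ℂ] Uq q (n + 1))) hq fun i j => ?_
    simp [coaction_t, TensorProduct.sum_tmul, TensorProduct.tmul_sum, comul_restrict, comul_t]
    exact Finset.sum_comm
  exact congrArg AlgHom.toLinearMap this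

theorem coaction_counit (hq : q ≠ 0) :
    (counit hq n).toLinearMap.rTensor (Uq q (n + 1)) ∘ₗ (coaction hq n).toLinearMap =
      TensorProduct.mk ℂ ℂ (Uq q (n + 1)) 1 := by
  have : (Algebra.TensorProduct.map (counit hq n) (AlgHom.id ℂ _)).comp (coaction hq n) =
      Algebra.TensorProduct.includeRight := by
    refine algHom_ext (A := ℂ ⊗[ℂ] Uq q (n + 1)) hq fun i j => ?_
    simp [coaction_t, counit_restrict, counit_t, TensorProduct.ite_tmul]
  exact congrArg AlgHom.toLinearMap this

theorem bundleMap_tmul {A P : Type} [Ring A] [Algebra ℂ A] [Ring P] [Algebra ℂ P]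
    (β : P →ₐ[ℂ] A ⊗[ℂ] P) (u w : P) : bundleMap β (u ⊗ₜ[ℂ] w) = β u * (1 ⊗ₜ[ℂ] w) := by
  simp [bundleMap]

theorem bundleMap_mul {A P : Type} [Ring A] [Algebra ℂ A] [Ring P] [Algebra ℂ P]
    (β : P →ₐ[ℂ] A ⊗[ℂ] P) (u w : P) (z : P ⊗[ℂ] P) :
    bundleMap β ((u ⊗ₜ[ℂ] (1 : P)) * z * ((1 : P) ⊗ₜ[ℂ] w)) =
      β u * bundleMap β z * (1 ⊗ₜ[ℂ] w) := by
  induction z using TensorProduct.induction_on with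
  | zero => simp
  | add x y hx hy => simp only [map_add, mul_add, add_mul, hx, hy]
  | tmul x y => simp [bundleMap_tmul, mul_assoc]

/-- For a generator with lift u the preimage of a ⊗ p is u₁ ⊗ S(u₂)p. For a product xy, expand a
preimage of x ⊗ 1 into terms u ⊗ w and put a preimage of y ⊗ wp between u and 1. -/
theorem bundleMap_surjective (hq : q ≠ 0) (n : ℕ) :
    Function.Surjective (bundleMap (coaction hq n)) := by
  have key : ∀ (a : Uq q n) (p : Uq q (n + 1)),
      a ⊗ₜ[ℂ] p ∈ LinearMap.range (bundleMap (coaction hq n)) := by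
    intro a
    induction a using induction with
    | ht i j =>
      intro p
      refine ⟨∑ k, t q i.succ k ⊗ₜ[ℂ] (s hq k j.succ * p), ?_⟩
      have e : ∀ x : Fin (n + 1), ∑ k, restrict hq n (t q i.succ x) ⊗ₜ[ℂ]
          (t q x k * (s hq k j.succ * p)) =
          if x = j.succ then restrict hq n (t q i.succ x) ⊗ₜ[ℂ] p else 0 := fun x => by
        simp only [← TensorProduct.tmul_sum, ← mul_assoc, ← Finset.sum_mul,
          (isMatInv hq (n + 1)).right]
        split_ifs <;> simp
      simp only [map_sum, bundleMap_tmul, coaction_t, Finset.sum_mul,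
        Algebra.TensorProduct.tmul_mul_tmul, mul_one]
      rw [Finset.sum_comm]
      simp only [e]
      simp [restrict_t, oneBlock_succ_succ]
    | hd =>
      intro p
      refine ⟨detStar q (n + 1) ⊗ₜ[ℂ] (det q (n + 1) * p), ?_⟩
      simp only [bundleMap_tmul, coaction_detStar, Algebra.TensorProduct.tmul_mul_tmul, mul_one,
        ← mul_assoc, detStar_mul_det, one_mul]
    | hc c =>
      intro p
      refine ⟨algebraMap ℂ _ c ⊗ₜ[ℂ] p, ?_⟩
      rw [bundleMap_tmul, AlgHom.commutes, Algebra.TensorProduct.algebraMap_apply]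
      simp
    | hadd x y hx hy =>
      intro p
      rw [TensorProduct.add_tmul]
      exact add_mem (hx p) (hy p)
    | hmul x y hx hy =>
      intro p
      obtain ⟨z, hz⟩ := hx 1
      have : (x * y) ⊗ₜ[ℂ] p = (x ⊗ₜ[ℂ] (1 : Uq q (n + 1))) * (y ⊗ₜ[ℂ] p) := by simp
      rw [this, ← hz]
      clear hz this
      induction z using TensorProduct.induction_on with
      | zero => simp
      | add z z' hz hz' => rw [map_add, add_mul]; exact add_mem hz hz'
      | tmul u w =>
        obtain ⟨z, hz⟩ := hy (w * p)
        refine ⟨(u ⊗ₜ[ℂ] (1 : Uq q (n + 1))) * z * ((1 : Uq q (n + 1)) ⊗ₜ[ℂ] 1), ?_⟩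
        rw [bundleMap_mul, hz, bundleMap_tmul]
        simp [mul_assoc]
  intro z
  induction z using TensorProduct.induction_on with
  | zero => exact ⟨0, map_zero _⟩
  | add x y hx hy =>
    obtain ⟨a, rfl⟩ := hx
    obtain ⟨b, rfl⟩ := hy
    exact ⟨a + b, map_add _ a b⟩
  | tmul a p => exact key a p

/-! ### Exactness of the bundle. -/

/-- The subalgebra of `U_q(n+1)` generated by the first row of `t` and the first column of its
inverse. -/
def sphereSubalgebra (hq : q ≠ 0) (n : ℕ) : Subalgebra ℂ (Uq q (n + 1)) :=
  Algebra.adjoin ℂ (Set.range (fun j => t q 0 j) ∪ Set.range fun j => s hq j 0)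

theorem t_mem_sphereSubalgebra (hq : q ≠ 0) (j : Fin (n + 1)) :
    t q 0 j ∈ sphereSubalgebra hq n := Algebra.subset_adjoin (Or.inl ⟨j, rfl⟩)

theorem s_mem_sphereSubalgebra (hq : q ≠ 0) (j : Fin (n + 1)) :
    s hq j 0 ∈ sphereSubalgebra hq n := Algebra.subset_adjoin (Or.inr ⟨j, rfl⟩)

theorem sphereSubalgebra_le (hq : q ≠ 0) : sphereSubalgebra hq n ≤ coinvariants (coaction hq n) := by
  refine Algebra.adjoin_le ?_
  rintro _ (⟨j, rfl⟩ | ⟨j, rfl⟩)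
  · change coaction hq n _ = 1 ⊗ₜ[ℂ] _
    simp [coaction_t, Fin.sum_univ_succ, restrict_t, oneBlock_zero_zero, oneBlock_zero_succ]
  · change coaction hq n _ = 1 ⊗ₜ[ℂ] _
    simp [coaction_s, Fin.sum_univ_succ, restrict_s, oneBlock_zero_zero, oneBlock_succ_zero]

/-- The map `u ↦ u₁ ⊗ S u₂`. -/
def twist (hq : q ≠ 0) (n : ℕ) : Uq q n →ₗ[ℂ] Uq q n ⊗[ℂ] Uq q n :=
  (antipode hq n).lTensor (Uq q n) ∘ₗ (comul hq n).toLinearMap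

/-- The map `u ⊗ w ↦ u₁ ⊗ S u₂ w`, the inverse of `u ⊗ w ↦ u₁ ⊗ u₂ w`. -/
def untwist (hq : q ≠ 0) (n : ℕ) : Uq q n ⊗[ℂ] Uq q n →ₗ[ℂ] Uq q n ⊗[ℂ] Uq q n :=
  LinearMap.mul' ℂ (Uq q n ⊗[ℂ] Uq q n) ∘ₗ TensorProduct.map (twist hq n)
    (Algebra.TensorProduct.includeRight : Uq q n →ₐ[ℂ] Uq q n ⊗[ℂ] Uq q n).toLinearMap

theorem untwist_tmul (hq : q ≠ 0) (u w : Uq q n) :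
    untwist hq n (u ⊗ₜ[ℂ] w) = twist hq n u * (1 ⊗ₜ[ℂ] w) := by
  simp [untwist]

theorem lTensor_antipode_mul (hq : q ≠ 0) (a b : Uq q n) (z : Uq q n ⊗[ℂ] Uq q n) :
    (antipode hq n).lTensor (Uq q n) ((a ⊗ₜ[ℂ] b) * z) =
      (a ⊗ₜ[ℂ] 1) * (antipode hq n).lTensor (Uq q n) z * (1 ⊗ₜ[ℂ] antipode hq n b) := by
  induction z using TensorProduct.induction_on with
  | zero => simp
  | add x y hx hy => simp only [map_add, mul_add, add_mul, hx, hy]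
  | tmul x y => simp [antipode_mul]

/-- Since S reverses products, the image of ux is u₁ (x₁ ⊗ S(x₂)) S(u₂), with the outer factors on
the outside. Thus the elements x sent into V form a left ideal. -/
theorem twist_mem (hq : q ≠ 0) {V : Submodule ℂ (Uq q n ⊗[ℂ] Uq q n)}
    (hV : ∀ u w z, z ∈ V → (u ⊗ₜ[ℂ] (1 : Uq q n)) * z * ((1 : Uq q n) ⊗ₜ[ℂ] w) ∈ V)
    (u : Uq q n) {x : Uq q n} (hx : twist hq n x ∈ V) : twist hq n (u * x) ∈ V := by
  have : ∀ y : Uq q n ⊗[ℂ] Uq q n,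
      (antipode hq n).lTensor (Uq q n) (y * comul hq n x) ∈ V := by
    intro y
    induction y using TensorProduct.induction_on with
    | zero => simp
    | add y z hy hz => rw [add_mul, map_add]; exact add_mem hy hz
    | tmul a b =>
      rw [lTensor_antipode_mul]
      exact hV _ _ _ hx
  have h2 := this (comul hq n u)
  rwa [← map_mul] at h2

/-- In Sweedler notation u₁a₁ ⊗ S(a₂)S(u₂)u₃b = ua₁ ⊗ S(a₂)b. On the generators `t` the collapse is
s t = 1. -/
theorem untwist_comul_mul (hq : q ≠ 0) (u : Uq q n) :
    ∀ z, untwist hq n (comul hq n u * z) = (u ⊗ₜ[ℂ] 1) * untwist hq n z := by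
  have key : ∀ u v : Uq q n, twist hq n (u * v) =
    (antipode hq n).lTensor (Uq q n) (comul hq n u * comul hq n v) := fun u v => by
      rw [← map_mul]; rfl
  have twist_def : ∀ v : Uq q n, twist hq n v = (antipode hq n).lTensor (Uq q n) (comul hq n v) :=
    fun _ => rfl
  induction u using induction with
  | ht i j =>
    intro z
    induction z using TensorProduct.induction_on with
    | zero => simp
    | add x y hx hy => rw [mul_add, map_add, hx, hy, map_add, mul_add]
    | tmul a b =>
      simp only [comul_t, Finset.sum_mul, Algebra.TensorProduct.tmul_mul_tmul, map_sum,
        untwist_tmul, key, lTensor_antipode_mul, antipode_t, ← twist_def]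
      rw [Finset.sum_comm]
      have e : ∀ l : Fin n, ∑ k, (t q i l ⊗ₜ[ℂ] (1 : Uq q n)) * twist hq n a *
          ((1 : Uq q n) ⊗ₜ[ℂ] s hq l k) * ((1 : Uq q n) ⊗ₜ[ℂ] (t q k j * b)) =
          if l = j then (t q i l ⊗ₜ[ℂ] (1 : Uq q n)) * (twist hq n a * ((1 : Uq q n) ⊗ₜ[ℂ] b))
          else 0 := fun l => by
        simp only [mul_assoc, Algebra.TensorProduct.tmul_mul_tmul, mul_one]
        simp only [← mul_assoc, ← Finset.mul_sum, ← TensorProduct.tmul_sum, ← Finset.sum_mul,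
          (isMatInv hq n).left]
        split_ifs <;> simp
      simp only [e]
      simp
  | hd =>
    intro z
    induction z using TensorProduct.induction_on with
    | zero => simp
    | add x y hx hy => rw [mul_add, map_add, hx, hy, map_add, mul_add]
    | tmul a b =>
      rw [comul_detStar, Algebra.TensorProduct.tmul_mul_tmul, untwist_tmul, key, comul_detStar,
        lTensor_antipode_mul, antipode_detStar, untwist_tmul, ← twist_def]
      simp only [mul_assoc, Algebra.TensorProduct.tmul_mul_tmul, mul_one]
      rw [← mul_assoc (det q n), det_mul_detStar, one_mul]
  | hc c =>
    intro z
    rw [AlgHom.commutes, Algebra.algebraMap_eq_smul_one, Algebra.algebraMap_eq_smul_one,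
      smul_mul_assoc, one_mul, map_smul, ← TensorProduct.smul_tmul',
      ← Algebra.TensorProduct.one_def, smul_mul_assoc, one_mul]
  | hadd x y hx hy =>
    intro z
    rw [map_add, add_mul, map_add, hx, hy, TensorProduct.add_tmul, add_mul]
  | hmul x y hx hy =>
    intro z
    rw [map_mul (comul hq n), mul_assoc, hx, hy, ← mul_assoc, Algebra.TensorProduct.tmul_mul_tmul, mul_one]

theorem untwist_bundleMap (hq : q ≠ 0) (z : Uq q n ⊗[ℂ] Uq q n) :
    untwist hq n (bundleMap (comul hq n) z) = z := by
  induction z using TensorProduct.induction_on with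
  | zero => simp
  | add x y hx hy => rw [map_add, map_add, hx, hy]
  | tmul u w =>
    rw [bundleMap_tmul, untwist_comul_mul, untwist_tmul]
    simp [twist, Algebra.TensorProduct.one_def, antipode_one]

/-- Together with `untwist_bundleMap` this identifies the kernel of χ with a subspace of the image
of ker α ⊗ P under `untwist`. -/
theorem rTensor_bundleMap (hq : q ≠ 0) (z : Uq q (n + 1) ⊗[ℂ] Uq q (n + 1)) :
    (restrict hq n).toLinearMap.rTensor (Uq q (n + 1)) (bundleMap (comul hq (n + 1)) z) =
      bundleMap (coaction hq n) z := by
  induction z using TensorProduct.induction_on with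
  | zero => simp
  | add x y hx hy => simp only [map_add, hx, hy]
  | tmul u w =>
    rw [bundleMap_tmul, bundleMap_tmul]
    change Algebra.TensorProduct.map (restrict hq n) (AlgHom.id ℂ (Uq q (n + 1))) _ = _
    rw [map_mul]
    simp [coaction]

section Fixed

variable {M : Type} [AddCommGroup M] [Module ℂ M] (ρ : Uq q (n + 1) →ₐ[ℂ] Module.End ℂ M)

/-- A vector which is fixed by the generators of the kernel of the restriction homomorphism. -/
abbrev Fixed (hq : q ≠ 0) (v : M) : Prop :=
  IsFixed (fun i j => ρ (t q i j)) (fun i j => ρ (s hq i j)) v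

variable {ρ}

theorem Fixed.apply (hq : q ≠ 0) (x : Uq q (n + 1)) : ∀ v, Fixed ρ hq v → Fixed ρ hq (ρ x v) := by
  have hT : IsQMatrix q fun i j => ρ (t q i j) := (isQMatrix_t hq _).map ρ
  have hTS : IsMatInv (fun i j => ρ (t q i j)) fun i j => ρ (s hq i j) := (isMatInv hq _).map ρ
  set F := fixedSubmodule (fun i j => ρ (t q i j)) (fun i j => ρ (s hq i j))
  change ∀ v ∈ F, ρ x v ∈ F
  have hst : ∀ i j, ∀ v ∈ F, ρ (s hq i j) v ∈ F := fun i j v hv => IsFixed.s_apply hq hT hTS hv i j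
  induction x using induction with
  | ht i j => exact fun v hv => IsFixed.t_apply hq hT hTS hv i j
  | hd =>
    -- The inverse determinant is a polynomial in the entries of `s`, so stability under `s`
    -- suffices.
    have hd : detStar q (n + 1) = MulOpposite.unop (rowDet q
      (fun i j : Fin (n + 1) => MulOpposite.op (s hq i j))) := by rw [rowDet_s]; rfl
    rw [hd, rowDet_op, MulOpposite.unop_op]
    intro v hv
    rw [map_sum, LinearMap.sum_apply]
    refine sum_mem fun c _ => ?_
    rw [map_smul, LinearMap.smul_apply]
    refine F.smul_mem _ ?_
    have hl : ∀ x ∈ (List.ofFn fun k => s hq k (c k)).reverse, ∀ v ∈ F, ρ x v ∈ F := by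
      intro x hx
      rw [List.mem_reverse, List.mem_ofFn'] at hx
      obtain ⟨k, rfl⟩ := hx
      exact hst _ _
    generalize (List.ofFn fun k => s hq k (c k)).reverse = l at hl
    induction l with
    | nil => simpa using hv
    | cons x l ih =>
      rw [List.prod_cons, map_mul]
      exact hl x List.mem_cons_self _ (ih fun y hy => hl y (List.mem_cons_of_mem _ hy))
  | hc c =>
    intro v hv
    rw [AlgHom.commutes]
    exact F.smul_mem c hv
  | hadd x y hx hy =>
    intro v hv
    rw [map_add]
    exact F.add_mem (hx v hv) (hy v hv)
  | hmul x y hx hy =>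
    intro v hv
    rw [map_mul]
    exact hx _ (hy v hv)

/-- When every vector is fixed, the generators act through a block matrix 1 ⊕ T'. Its determinant is
that of T', so T' defines an action of U_q(n) through which `ρ` factors. -/
theorem apply_eq_zero_of_restrict_eq_zero (hq : q ≠ 0) (hfix : ∀ v, Fixed ρ hq v)
    {u : Uq q (n + 1)} (hu : restrict hq n u = 0) : ρ u = 0 := by
  have hT : IsQMatrix q fun i j => ρ (t q i j) := (isQMatrix_t hq _).map ρ
  have hTS : IsMatInv (fun i j => ρ (t q i j)) fun i j => ρ (s hq i j) := (isMatInv hq _).map ρ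
  have hblock : ∀ i j, ρ (t q i j) = oneBlock (fun i j => ρ (t q (Fin.succ i) (Fin.succ j))) i j := by
    intro i j
    ext v
    cases i using Fin.cases with
    | zero =>
      rw [(hfix v).t_zero]
      cases j using Fin.cases <;> simp [oneBlock_zero_zero, oneBlock_zero_succ, Fin.succ_ne_zero]
    | succ i =>
      cases j using Fin.cases with
      | zero => rw [(hfix v).t_apply_zero hTS]; simp [oneBlock_succ_zero, Fin.succ_ne_zero]
      | succ j => rfl
  have hdet : rowDet q (fun i j => ρ (t q (Fin.succ i) (Fin.succ j))) = ρ (det q (n + 1)) := by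
    rw [← rowDet_oneBlock, map_det hq]
    exact congrArg _ (funext fun i => funext fun j => (hblock i j).symm)
  let γ : Uq q n →ₐ[ℂ] Module.End ℂ M :=
    lift hq (fun i j => ρ (t q (Fin.succ i) (Fin.succ j)))
      (hT.submatrix (f := Fin.succ) (Fin.strictMono_succ)) (ρ (detStar q (n + 1)))
      (by rw [hdet, ← map_mul, det_mul_detStar, map_one])
      (by rw [hdet, ← map_mul, detStar_mul_det, map_one])
  have hγ : γ.comp (restrict hq n) = ρ := by
    refine algHom_ext hq fun i j => ?_
    rw [AlgHom.comp_apply, hblock, restrict_t]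
    cases i using Fin.cases with
    | zero =>
      cases j using Fin.cases with
      | zero => exact map_one γ
      | succ j => exact map_zero γ
    | succ i =>
      cases j using Fin.cases with
      | zero => exact map_zero γ
      | succ j => exact lift_t i j
  rw [← hγ, AlgHom.comp_apply, hu, map_zero]

end Fixed

/-- A left ideal which contains the generators of the kernel of the restriction homomorphism
contains the kernel. -/
theorem mem_of_restrict_eq_zero (hq : q ≠ 0) (I : Submodule (Uq q (n + 1)) (Uq q (n + 1)))
    (ht : ∀ j, t q 0 j - (if j = 0 then 1 else 0) ∈ I)
    (hs : ∀ j, s hq j 0 - (if j = 0 then 1 else 0) ∈ I)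
    {u : Uq q (n + 1)} (hu : restrict hq n u = 0) : u ∈ I := by
  -- Act on the quotient by the left ideal. The class of 1 is fixed by assumption and generates the
  -- module, so all vectors are fixed; hence u acts as zero and u · 1 lies in I.
  let ρ : Uq q (n + 1) →ₐ[ℂ] Module.End ℂ (Uq q (n + 1) ⧸ I) := Algebra.lsmul ℂ ℂ _
  have hρ : ∀ x, ρ x (Submodule.Quotient.mk 1) = Submodule.Quotient.mk x := fun x => by
    change x • (Submodule.Quotient.mk 1 : Uq q (n + 1) ⧸ I) = _
    rw [← Submodule.Quotient.mk_smul, smul_eq_mul, mul_one]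
  have he : Fixed ρ hq (Submodule.Quotient.mk 1) := by
    refine ⟨fun j => ?_, fun j => ?_⟩
    · rw [hρ, (Submodule.Quotient.eq I).2 (ht j)]
      split_ifs <;> rfl
    · rw [hρ, (Submodule.Quotient.eq I).2 (hs j)]
      split_ifs <;> rfl
  have hfix : ∀ v, Fixed ρ hq v := by
    intro v
    obtain ⟨x, rfl⟩ := Submodule.Quotient.mk_surjective I v
    rw [← hρ]
    exact he.apply hq x
  have := hρ u
  rw [apply_eq_zero_of_restrict_eq_zero hq hfix hu, LinearMap.zero_apply] at this
  exact (Submodule.Quotient.mk_eq_zero I).1 this.symm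

/-- This is stronger than exactness in that it uses the algebra of first-row and first-column
entries instead of all coinvariants. The later comparison of the two algebras depends on it. -/
theorem ker_bundleMap_le (hq : q ≠ 0) :
    LinearMap.ker (bundleMap (coaction hq n)) ≤ horizontalForms (sphereSubalgebra hq n) := by
  intro z hz
  rw [LinearMap.mem_ker, ← rTensor_bundleMap] at hz
  rw [← untwist_bundleMap hq z]
  generalize bundleMap (comul hq (n + 1)) z = y at hz
  have hmul := fun u w z => mul_mem_horizontalForms (B := sphereSubalgebra hq n) (z := z) u w
  -- The left ideal of those x for which x₁ ⊗ S(x₂) is horizontal; only the generators of ker α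
  -- remain to be checked.
  let I : Submodule (Uq q (n + 1)) (Uq q (n + 1)) :=
    { carrier := {x | twist hq (n + 1) x ∈ horizontalForms (sphereSubalgebra hq n)}
      zero_mem' := by simp
      add_mem' := fun {a b} ha hb => by
        simp only [Set.mem_ofPred_eq, map_add]
        exact add_mem ha hb
      smul_mem' := fun c x hx => twist_mem hq hmul c hx }
  have hI : ∀ u, restrict hq n u = 0 → u ∈ I := by
    intro u hu
    refine mem_of_restrict_eq_zero hq I (fun j => ?_) (fun j => ?_) hu
    · change twist hq (n + 1) _ ∈ horizontalForms (sphereSubalgebra hq n)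
      have h1 : twist hq (n + 1) (t q 0 j) = ∑ k, t q 0 k ⊗ₜ[ℂ] s hq k j := by
        simp [twist, comul_t, antipode_t]
      have h2 : twist hq (n + 1) (if j = 0 then 1 else 0) = 1 ⊗ₜ[ℂ] ∑ k, t q 0 k * s hq k j := by
        rw [(isMatInv hq _).right]
        by_cases hj : j = 0
        · simp [hj, twist, Algebra.TensorProduct.one_def, antipode_one]
        · simp [hj, Ne.symm hj]
      rw [map_sub, h1, h2]
      exact sum_tmul_sub_mem_horizontalForms (t_mem_sphereSubalgebra hq) _
    · change twist hq (n + 1) _ ∈ horizontalForms (sphereSubalgebra hq n)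
      have h1 : twist hq (n + 1) (s hq j 0) =
          ∑ k, s hq k 0 ⊗ₜ[ℂ] antipode hq (n + 1) (s hq j k) := by
        simp [twist, comul_s]
      have h2 : twist hq (n + 1) (if j = 0 then 1 else 0) =
          1 ⊗ₜ[ℂ] ∑ k, s hq k 0 * antipode hq (n + 1) (s hq j k) := by
        have : ∑ k, s hq k 0 * antipode hq (n + 1) (s hq j k) =
            antipode hq (n + 1) (∑ k, s hq j k * t q k 0) := by
          simp [antipode_mul, antipode_t]
        rw [this, (isMatInv hq _).left]
        by_cases hj : j = 0
        · simp [hj, twist, Algebra.TensorProduct.one_def, antipode_one]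
        · simp [hj]
      rw [map_sub, h1, h2]
      exact sum_tmul_sub_mem_horizontalForms (s_mem_sphereSubalgebra hq) _
  rw [← Submodule.mem_comap]
  refine mem_of_rTensor_eq_zero (restrict_surjective hq n) hz fun x p hx => ?_
  rw [Submodule.mem_comap, untwist_tmul]
  have := hmul 1 p _ (hI x hx)
  rwa [← Algebra.TensorProduct.one_def, one_mul] at this

theorem isQuantumPrincipalBundle (hq : q ≠ 0) (n : ℕ) : IsQuantumPrincipalBundle
    (hopf hq n) (coaction hq n) (coinvariants (coaction hq n)) where
  coassoc := coaction_coassoc hq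
  counit := coaction_counit hq
  base := rfl
  free := bundleMap_surjective hq n
  exact := le_antisymm
    (inf_le_right.trans ((ker_bundleMap_le hq).trans (horizontalForms_mono (sphereSubalgebra_le hq))))
    (horizontalForms_le _)

end Uq

/-! ### Tail sums -/

section TailSum

variable {M : Type*} [AddCommGroup M] [Module ℂ M] {N : ℕ}

/-- The sum of the terms with index at least `m`. -/
def tailSum (f : Fin N → M) (m : ℕ) : M := ∑ l ∈ Finset.univ.filter (fun l : Fin N => m ≤ (l : ℕ)), f l

theorem tailSum_zero (f : Fin N → M) : tailSum f 0 = ∑ l, f l := by simp [tailSum]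

theorem tailSum_self (f : Fin N → M) : tailSum f N = 0 :=
  Finset.sum_eq_zero fun l hl => by simp at hl; omega

theorem tailSum_eq (f : Fin N → M) (k : Fin N) :
    tailSum f k = f k + tailSum f (k + 1) := by
  have : Finset.univ.filter (fun l : Fin N => (k : ℕ) ≤ (l : ℕ)) =
      insert k (Finset.univ.filter fun l : Fin N => (k : ℕ) + 1 ≤ (l : ℕ)) := by
    ext l
    simp [Fin.ext_iff]
    omega
  rw [tailSum, this, Finset.sum_insert (by simp), tailSum]

theorem tailSum_filter_lt (f : Fin N → M) (k : Fin N) :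
    ∑ l ∈ Finset.univ.filter (k < ·), f l = tailSum f (k + 1) := rfl

/-- Downward induction: T_m = z_m + q² T_{m+1} unrolls to powers of q². The recursion may use the
formula for the next tail, since in one application it is only known in terms of the weighted tail
of z. -/
theorem tailSum_eq_of_forall (q : ℝ) (hq : q ≠ 0) {y z : Fin N → M}
    (h : ∀ k : Fin N, tailSum y (k + 1) =
        ((q : ℂ)⁻¹ ^ 2) ^ ((k : ℕ) + 1) • tailSum (fun l => ((q : ℂ) ^ 2) ^ (l : ℕ) • z l) (k + 1) →
      y k + tailSum y (k + 1) = z k + (q : ℂ) ^ 2 • tailSum y (k + 1)) (m : ℕ) (hm : m ≤ N) :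
    tailSum y m = ((q : ℂ)⁻¹ ^ 2) ^ m • tailSum (fun l => ((q : ℂ) ^ 2) ^ (l : ℕ) • z l) m := by
  have hq' : (q : ℂ) ≠ 0 := by exact_mod_cast hq
  induction hm using Nat.decreasingInduction with
  | self => rw [tailSum_self, tailSum_self, smul_zero]
  | of_succ m hm ih =>
    rw [tailSum_eq y ⟨m, hm⟩, tailSum_eq _ ⟨m, hm⟩, h ⟨m, hm⟩ ih, ih, smul_add, smul_smul,
      smul_smul]
    congr 1
    · rw [← mul_pow, ← mul_pow, inv_mul_cancel₀ hq', one_pow, one_pow, one_smul]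
    · congr 1
      rw [pow_succ ((q : ℂ)⁻¹ ^ 2), mul_left_comm, ← mul_pow, mul_inv_cancel₀ hq', one_pow, mul_one]

end TailSum

/-! ### Relations of quantum spheres -/

section SphereRelations

variable {q : ℝ} {N : ℕ} {A : Type*} [Ring A] [Algebra ℂ A]

/-- The explicit form of the relations of `S_q^{2n-1}`. -/
structure IsSphereFamily (q : ℝ) (V X : Fin N → A) : Prop where
  vv : ∀ {i j}, i < j → V i * V j = (q : ℂ) • (V j * V i)
  xx : ∀ {i j}, i < j → X j * X i = (q : ℂ) • (X i * X j)
  xv : ∀ k l, (q : ℂ) • (V k * X l) = dg q l k • (X l * V k) +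
    if k = l then wq q • ∑ i ∈ Finset.univ.filter (· < k), X i * V i else 0
  norm : ∑ i, X i * V i = 1

/-- The relations of `S_q^{2n-1}` in terms of rescaled generators in the reversed order. -/
structure IsSpherePair (q : ℝ) (x v : Fin N → A) : Prop where
  xx : ∀ {k l}, k < l → x l * x k = (q : ℂ) • (x k * x l)
  vv : ∀ {k l}, k < l → v k * v l = (q : ℂ) • (v l * v k)
  xv : ∀ {k l}, k ≠ l → v l * x k = (q : ℂ) • (x k * v l)
  vx : ∀ k, v k * x k = x k * v k - ((q : ℂ) ^ 2 - 1) • tailSum (fun l => x l * v l) (k + 1)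
  norm : ∑ k, x k * v k = 1

theorem sum_filter_lt_rev {M : Type*} [AddCommGroup M] (f : Fin N → M) (k : Fin N) :
    ∑ i ∈ Finset.univ.filter (· < k), f i = tailSum (fun l => f l.rev) (k.rev + 1) := by
  rw [tailSum]
  refine Finset.sum_bij (fun i _ => i.rev) ?_ ?_ ?_ ?_
  · intro i hi
    simp only [Finset.mem_filter, Finset.mem_univ, true_and, Fin.lt_def, Fin.val_rev] at hi ⊢
    omega
  · intro i _ j _ h
    exact Fin.rev_injective h
  · intro i hi
    refine ⟨i.rev, ?_, Fin.rev_rev i⟩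
    simp only [Finset.mem_filter, Finset.mem_univ, true_and, Fin.lt_def, Fin.val_rev] at hi ⊢
    omega
  · simp

/-- The factors q^k absorb the weights q^{2k} with which the tails of ∑ x v are expressed by the
products v x. The reversal turns the tails into the sums over i < k of the defining relations. -/
theorem IsSpherePair.isSphereFamily (hq : q ≠ 0) {x v : Fin N → A} (h : IsSpherePair q x v) :
    IsSphereFamily q (fun i => (q : ℂ) ^ (i.rev : ℕ) • x i.rev)
      (fun i => (q : ℂ) ^ (i.rev : ℕ) • v i.rev) := by
  have hq' : (q : ℂ) ≠ 0 := by exact_mod_cast hq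
  have hT := tailSum_eq_of_forall q hq (y := fun l => x l * v l) (z := fun l => v l * x l) (N := N)
    fun k _ => by
      rw [h.vx, sub_smul, one_smul]
      abel
  have hz : ∀ l : Fin N, ((q : ℂ) ^ (l : ℕ) • v l) * ((q : ℂ) ^ (l : ℕ) • x l) =
      ((q : ℂ) ^ 2) ^ (l : ℕ) • (v l * x l) := fun l => by
    rw [smul_mul_smul_comm, ← pow_mul, ← pow_add]
    congr 2
    omega
  refine ⟨fun {i j} hij => ?_, fun {i j} hij => ?_, fun k l => ?_, ?_⟩
  · rw [smul_mul_smul_comm, smul_mul_smul_comm, h.xx (Fin.rev_lt_rev.2 hij), smul_smul, smul_smul]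
    congr 1
    ring
  · rw [smul_mul_smul_comm, smul_mul_smul_comm, h.vv (Fin.rev_lt_rev.2 hij), smul_smul, smul_smul]
    congr 1
    ring
  · by_cases hkl : k = l
    · subst hkl
      rw [if_pos rfl, sum_filter_lt_rev]
      simp only [Fin.rev_rev, hz]
      have h1 := h.vx k.rev
      rw [hT _ (by omega), smul_smul] at h1
      rw [smul_mul_smul_comm, dg, if_pos rfl, h1]
      simp only [smul_sub, smul_smul]
      rw [sub_add, ← sub_smul]
      rw [eq_comm, sub_eq_iff_eq_add, eq_comm]
      convert add_zero _ using 2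
      · convert zero_smul ℂ _ using 2
        simp only [wq, inv_pow, pow_succ ((q : ℂ) ^ 2)]
        field_simp
        ring
      · congr 1
        ring
    · rw [if_neg hkl, dg, if_neg (Ne.symm hkl), one_smul, add_zero, smul_mul_smul_comm,
        smul_mul_smul_comm, h.xv (fun hh => hkl (Fin.rev_injective hh)), smul_smul, smul_smul]
      congr 1
      ring
  · have h0 := hT 0 (Nat.zero_le N)
    rw [tailSum_zero, h.norm, pow_zero, one_smul, tailSum_zero] at h0
    simp only [hz]
    rw [h0]
    exact Equiv.sum_comp Fin.revPerm fun l : Fin N => ((q : ℂ) ^ 2) ^ (l : ℕ) • (v l * x l)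

theorem IsSphereFamily.isSpherePair (hq : q ≠ 0) {V X : Fin N → A} (h : IsSphereFamily q V X) :
    IsSpherePair q (fun k => (q : ℂ)⁻¹ ^ (k : ℕ) • V k.rev)
      (fun k => (q : ℂ)⁻¹ ^ (k : ℕ) • X k.rev) := by
  have hq' : (q : ℂ) ≠ 0 := by exact_mod_cast hq
  have hz : ∀ l : Fin N, ((q : ℂ) ^ 2) ^ (l : ℕ) • (((q : ℂ)⁻¹ ^ (l : ℕ) • X l.rev) *
      ((q : ℂ)⁻¹ ^ (l : ℕ) • V l.rev)) = X l.rev * V l.rev := fun l => by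
    rw [smul_mul_smul_comm, smul_smul, ← mul_pow, ← mul_pow]
    convert one_smul ℂ _ using 2
    field_simp
    simp
  have key : ∀ k : Fin N, V k.rev * X k.rev = X k.rev * V k.rev +
      ((q : ℂ)⁻¹ * wq q) • tailSum (fun l => X l.rev * V l.rev) (k + 1) := fun k => by
    have := h.xv k.rev k.rev
    rw [if_pos rfl, sum_filter_lt_rev, dg, if_pos rfl, Fin.rev_rev] at this
    have := congrArg (fun z => (q : ℂ)⁻¹ • z) this
    simpa only [smul_add, smul_smul, inv_mul_cancel₀ hq', one_smul] using this
  have hT := tailSum_eq_of_forall q hq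
    (y := fun k : Fin N => ((q : ℂ)⁻¹ ^ (k : ℕ) • V k.rev) * ((q : ℂ)⁻¹ ^ (k : ℕ) • X k.rev))
    (z := fun k : Fin N => ((q : ℂ)⁻¹ ^ (k : ℕ) • X k.rev) * ((q : ℂ)⁻¹ ^ (k : ℕ) • V k.rev))
    (N := N) fun k hk => by
      rw [hk]
      simp only [hz]
      rw [smul_mul_smul_comm, smul_mul_smul_comm, key, smul_add, add_assoc, smul_smul, smul_smul,
        ← add_smul]
      congr 2
      simp only [wq, inv_pow, pow_succ ((q : ℂ) ^ 2)]
      field_simp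
      ring
  refine ⟨fun {i j} hij => ?_, fun {i j} hij => ?_, fun {k l} hkl => ?_, fun k => ?_, ?_⟩
  · rw [smul_mul_smul_comm, smul_mul_smul_comm, h.vv (Fin.rev_lt_rev.2 hij), smul_smul, smul_smul]
    congr 1
    ring
  · rw [smul_mul_smul_comm, smul_mul_smul_comm, h.xx (Fin.rev_lt_rev.2 hij), smul_smul, smul_smul]
    congr 1
    ring
  · have := h.xv k.rev l.rev
    have hne : k.rev ≠ l.rev := fun hh => hkl (Fin.rev_injective hh)
    rw [if_neg hne, dg, if_neg hne.symm, one_smul, add_zero] at this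
    rw [smul_mul_smul_comm, smul_mul_smul_comm, ← this, smul_smul, smul_smul]
    congr 1
    ring
  · rw [hT _ (by omega)]
    simp only [hz]
    rw [smul_mul_smul_comm, smul_mul_smul_comm, key, smul_add, smul_smul, smul_smul, add_sub_assoc,
      ← sub_smul, eq_comm]
    convert add_zero _ using 2
    convert zero_smul ℂ _ using 2
    simp only [wq, inv_pow, pow_succ ((q : ℂ) ^ 2)]
    field_simp
    ring
  · have h0 := hT 0 (Nat.zero_le N)
    simp only [hz] at h0
    rw [tailSum_zero, pow_zero, one_smul, tailSum_zero] at h0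
    rw [h0, ← h.norm]
    exact Equiv.sum_comp Fin.revPerm fun l : Fin N => X l * V l

/-- The inverse relations of sphere pairs in a quantum matrix and its inverse. -/
theorem IsQMatrix.isSpherePair {n : ℕ} (hq : q ≠ 0) {t s : Fin (n + 1) → Fin (n + 1) → A}
    (ht : IsQMatrix q t) (h : IsMatInv t s) :
    IsSpherePair q (fun k => t 0 k) fun k => s k 0 := by
  have hq' : (q : ℂ) ≠ 0 := by exact_mod_cast hq
  -- Completing the partial sum by s t = 1 leaves only the term m = 0, which combines with the main
  -- term as q − (q − q⁻¹) = q⁻¹.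
  have hs : ∀ k l, ∑ m ∈ Finset.univ.filter ((0 : Fin (n + 1)) < ·), s l m * t m k =
      (if l = k then 1 else 0) - s l 0 * t 0 k := fun k l => by
    have h1 := h.left l k
    rw [Fin.sum_univ_succ] at h1
    rw [← h1, Finset.sum_filter, Fin.sum_univ_succ]
    simp
  refine ⟨fun {k l} hkl => ht.row 0 hkl, fun {k l} hkl => ?_, fun {k l} hkl => ?_, fun k => ?_, ?_⟩
  · exact MulOpposite.op_injective ((ht.inverse hq h).col 0 hkl)
  · have := ht.mixed hq h 0 l k 0
    rw [if_pos rfl, if_neg hkl, hs, if_neg hkl.symm, dg, dg, if_pos rfl, if_neg hkl, zero_sub,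
      one_smul, smul_neg, ← sub_eq_add_neg, ← sub_smul, add_zero] at this
    rw [← this, smul_smul]
    convert (one_smul ℂ _).symm using 2
    simp only [wq]
    field_simp
    ring
  · have := ht.mixed hq h 0 k k 0
    rw [if_pos rfl, if_pos rfl, hs, if_pos rfl, dg, dg, if_pos rfl, if_pos rfl] at this
    have h1 : ∑ l ∈ Finset.univ.filter (· < k), t 0 l * s l 0 =
        1 - t 0 k * s k 0 - tailSum (fun l => t 0 l * s l 0) (k + 1) := by
      have h2 := h.right 0 0
      rw [if_pos rfl] at h2
      rw [← h2, ← Finset.sum_filter_add_sum_filter_not Finset.univ (· < k)]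
      have h3 : Finset.univ.filter (fun l => ¬l < k) =
          Finset.univ.filter (fun l : Fin (n + 1) => (k : ℕ) ≤ (l : ℕ)) := by
        ext l
        simp only [Finset.mem_filter, Finset.mem_univ, true_and, not_lt, Fin.le_def]
      rw [h3]
      change _ = _ + tailSum _ _ - _ - _
      rw [tailSum_eq]
      abel
    rw [h1] at this
    have h4 : (q : ℂ)⁻¹ • (s k 0 * t 0 k) = (q : ℂ)⁻¹ • (t 0 k * s k 0) -
        wq q • tailSum (fun l => t 0 l * s l 0) (k + 1) := by
      simp only [wq, smul_sub, sub_smul] at this ⊢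
      rw [← sub_eq_zero] at this ⊢
      rw [← this]
      module
    have h5 := congrArg (fun z => (q : ℂ) • z) h4
    simp only [smul_sub, smul_smul, mul_inv_cancel₀ hq', one_smul] at h5
    rw [h5]
    congr 2
    simp only [wq]
    field_simp
  · simpa using h.right 0 0

theorem lam_eq (hq : q ≠ 0) (n : ℕ) : lam q n = q * rootFactor q n := by
  rw [lam, rootFactor, sub_eq_add_neg, Complex.cpow_add _ _ (by exact_mod_cast hq),
    Complex.cpow_one, neg_div]

theorem sum_normR_outer {M : Type*} [AddCommGroup M] [Module ℂ M] (f : Fin N → Fin N → M)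
    (k l : Fin N) : ∑ i, ∑ j, normR q N (i, k) (l, j) • f i j = dg q l k • f l k +
      if k = l then wq q • ∑ i ∈ Finset.univ.filter (· < k), f i i else 0 := by
  simp only [normR_apply, add_smul, Finset.sum_add_distrib]
  congr 1
  · rw [Finset.sum_eq_single l, Finset.sum_eq_single k] <;> simp +contextual [eq_comm]
  · split_ifs with h
    · subst h
      rw [Finset.smul_sum, Finset.sum_filter]
      refine Finset.sum_congr rfl fun i _ => ?_
      rw [Finset.sum_eq_single i] <;> simp +contextual [eq_comm, ite_smul]
    · simp [h]

theorem sum_normR_inner {M : Type*} [AddCommGroup M] [Module ℂ M] (f : Fin N → Fin N → M)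
    (i j : Fin N) : ∑ l, ∑ k, normR q N (i, k) (l, j) • f l k = dg q i j • f i j +
      if i = j then wq q • ∑ k ∈ Finset.univ.filter (i < ·), f k k else 0 := by
  simp only [normR_apply, add_smul, Finset.sum_add_distrib]
  congr 1
  · rw [Finset.sum_eq_single i, Finset.sum_eq_single j] <;> simp +contextual [eq_comm]
  · split_ifs with h
    · subst h
      rw [Finset.smul_sum, Finset.sum_filter]
      refine Finset.sum_congr rfl fun i _ => ?_
      rw [Finset.sum_eq_single i] <;> simp +contextual [eq_comm, ite_smul]
    · simp [h]

/-- Apart from the diagonal, R^{t₂} only has a strictly triangular block on the pairs (i, i). The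
tail sums of a kernel vector vanish one after the other, beginning at the last index, and then so do
its entries. -/
theorem isUnit_transpose₂_stdR (hq : q ≠ 0) (n : ℕ) : IsUnit (transpose₂ (stdR q n)) := by
  have hq' : (q : ℂ) ≠ 0 := by exact_mod_cast hq
  rw [← Matrix.mulVec_injective_iff_isUnit]
  refine (injective_iff_map_eq_zero (transpose₂ (stdR q n)).mulVecLin).2 fun g hg => ?_
  have key : ∀ i j, dg q i j • g (i, j) +
      (if i = j then wq q • ∑ k ∈ Finset.univ.filter (i < ·), g (k, k) else 0) = 0 := by
    intro i j
    have h1 : ∑ l, ∑ k, stdR q n (i, k) (l, j) • g (l, k) = 0 := by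
      have h0 := congrFun hg (i, j)
      rw [Matrix.mulVecLin_apply, Matrix.mulVec, dotProduct, Fintype.sum_prod_type] at h0
      exact h0
    simp only [stdR_eq, Matrix.smul_apply, smul_assoc, ← Finset.smul_sum] at h1
    rw [sum_normR_inner fun l k => g (l, k)] at h1
    exact (smul_eq_zero.1 h1).resolve_left (rootFactor_ne_zero hq n)
  have htail : ∀ m ≤ n, tailSum (fun k => g (k, k)) m = 0 := by
    intro m hm
    induction hm using Nat.decreasingInduction with
    | self => exact tailSum_self _
    | of_succ m hm ih =>
      have h1 := key ⟨m, hm⟩ ⟨m, hm⟩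
      rw [if_pos rfl, dg, if_pos rfl, tailSum_filter_lt fun k => g (k, k), ih, smul_zero,
        add_zero] at h1
      rw [tailSum_eq _ ⟨m, hm⟩, ih, add_zero]
      exact (smul_eq_zero.1 h1).resolve_left hq'
  ext ⟨i, j⟩
  have h1 := key i j
  rw [tailSum_filter_lt fun k => g (k, k), htail _ (by omega), smul_zero, ite_self, add_zero] at h1
  refine (smul_eq_zero.1 h1).resolve_left ?_
  unfold dg
  split_ifs
  · exact hq'
  · exact one_ne_zero

/-- It removes the inverse matrix from the cross relations, which then only involve R itself. -/
theorem sum_nonsing_inv_smul_iff {ι : Type*} [Fintype ι] [DecidableEq ι] {M : Matrix ι ι ℂ}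
    (hM : IsUnit M) (F G : ι → A) :
    (∀ p, G p = ∑ r, M⁻¹ r p • F r) ↔ ∀ r, F r = ∑ p, M p r • G p := by
  have h1 : M * M⁻¹ = 1 := Matrix.mul_nonsing_inv _ ((Matrix.isUnit_iff_isUnit_det _).1 hM)
  have h2 : M⁻¹ * M = 1 := Matrix.nonsing_inv_mul _ ((Matrix.isUnit_iff_isUnit_det _).1 hM)
  have aux : ∀ {M M' : Matrix ι ι ℂ} {F G : ι → A}, M' * M = 1 →
      (∀ p, G p = ∑ r, M' r p • F r) → ∀ r, F r = ∑ p, M p r • G p := by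
    intro M M' F G h hG r
    simp only [hG, Finset.smul_sum, smul_smul]
    rw [Finset.sum_comm]
    simp only [← Finset.sum_smul]
    have : ∀ y, ∑ x, M x r * M' y x = (1 : Matrix ι ι ℂ) y r := fun y => by
      rw [← h, Matrix.mul_apply]
      simp only [mul_comm]
    simp [this, Matrix.one_apply]
  exact ⟨aux h2, aux h1⟩

/-- The defining relations of the quantum sphere. -/
theorem isSphereFamily_iff (hq : q ≠ 0) (V X : Fin N → A) : IsSphereFamily q V X ↔
    (∀ i j, V i * V j = ∑ k, ∑ l, ((lam q N)⁻¹ * stdR q N (i, j) (k, l)) • (V l * V k)) ∧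
    (∀ i j, X i * X j = ∑ k, ∑ l, ((lam q N)⁻¹ * stdR q N (k, l) (i, j)) • (X l * X k)) ∧
    (∀ i j, X i * V j = ∑ k, ∑ l, (lam q N * tildeR q N (l, j) (i, k)) • (V k * X l)) ∧
    ∑ a, ∑ b, metric q N b a • (V a * X b) = 1 := by
  have hq' : (q : ℂ) ≠ 0 := by exact_mod_cast hq
  have hr := rootFactor_ne_zero hq N
  have hlam : (lam q N)⁻¹ * rootFactor q N = (q : ℂ)⁻¹ := by
    rw [lam_eq hq]
    field_simp
  have vv : (∀ i j, V i * V j = ∑ k, ∑ l, ((lam q N)⁻¹ * stdR q N (i, j) (k, l)) • (V l * V k)) ↔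
      ∀ {i j}, i < j → V i * V j = (q : ℂ) • (V j * V i) := by
    simp only [stdR_eq, Matrix.smul_apply, smul_eq_mul, ← mul_assoc, hlam, mul_smul,
      ← Finset.smul_sum]
    simp only [sum_normR_left q (fun k l => V l * V k)]
    constructor
    · intro h i j hij
      have h1 := h j i
      rw [dg, if_neg hij.ne', if_neg hij.not_gt, one_smul, add_zero] at h1
      rw [h1, smul_smul, mul_inv_cancel₀ hq', one_smul]
    · intro h i j
      rcases lt_trichotomy i j with hij | rfl | hij
      · rw [dg, if_neg hij.ne, if_pos hij, one_smul, h hij, smul_smul, smul_add, smul_smul,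
          ← add_smul]
        congr 1
        simp only [wq]
        field_simp
        ring
      · rw [dg, if_pos rfl, if_neg (lt_irrefl _), add_zero, smul_smul, inv_mul_cancel₀ hq',
          one_smul]
      · rw [dg, if_neg hij.ne', if_neg hij.not_gt, one_smul, add_zero, h hij, smul_smul,
          inv_mul_cancel₀ hq', one_smul]
  have xx : (∀ i j, X i * X j = ∑ k, ∑ l, ((lam q N)⁻¹ * stdR q N (k, l) (i, j)) • (X l * X k)) ↔
      ∀ {i j}, i < j → X j * X i = (q : ℂ) • (X i * X j) := by
    simp only [stdR_eq, Matrix.smul_apply, smul_eq_mul, ← mul_assoc, hlam, mul_smul,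
      ← Finset.smul_sum]
    simp only [sum_normR_right q (fun k l => X l * X k)]
    constructor
    · intro h i j hij
      have h1 := h i j
      rw [dg, if_neg hij.ne, if_neg hij.not_gt, one_smul, add_zero] at h1
      rw [h1, smul_smul, mul_inv_cancel₀ hq', one_smul]
    · intro h i j
      rcases lt_trichotomy i j with hij | rfl | hij
      · rw [dg, if_neg hij.ne, if_neg hij.not_gt, one_smul, add_zero, h hij, smul_smul,
          inv_mul_cancel₀ hq', one_smul]
      · rw [dg, if_pos rfl, if_neg (lt_irrefl _), add_zero, smul_smul, inv_mul_cancel₀ hq',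
          one_smul]
      · rw [dg, if_neg hij.ne', if_pos hij, one_smul, h hij, smul_smul, smul_add, smul_smul,
          ← add_smul]
        congr 1
        simp only [wq]
        field_simp
        ring
  have xv : (∀ i j, X i * V j =
      ∑ k, ∑ l, (lam q N * tildeR q N (l, j) (i, k)) • (V k * X l)) ↔
      ∀ k l, (q : ℂ) • (V k * X l) = dg q l k • (X l * V k) +
        if k = l then wq q • ∑ i ∈ Finset.univ.filter (· < k), X i * V i else 0 := by
    have h1 := sum_nonsing_inv_smul_iff (isUnit_transpose₂_stdR hq N)
      (fun r : Fin N × Fin N => lam q N • (V r.2 * X r.1)) (fun p => X p.1 * V p.2)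
    refine Iff.trans ?_ (h1.trans ?_)
    · rw [Prod.forall]
      refine forall_congr' fun i => forall_congr' fun j => ?_
      rw [Fintype.sum_prod_type, Finset.sum_comm]
      simp only [mul_comm (lam q N), mul_smul]
      rfl
    · rw [Prod.forall, forall_comm]
      refine forall_congr' fun k => forall_congr' fun l => ?_
      rw [Fintype.sum_prod_type]
      change _ = ∑ i, ∑ j, stdR q N (i, k) (l, j) • (X i * V j) ↔ _
      simp only [stdR_eq, Matrix.smul_apply, smul_assoc, ← Finset.smul_sum]
      rw [sum_normR_outer fun i j => X i * V j, lam_eq hq, mul_comm, mul_smul]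
      exact (smul_right_injective A hr).eq_iff
  -- The metric is the contraction of the coefficients of the cross relation, so summing that
  -- relation over i = j turns v g x into ∑ X_i V_i. The metric never has to be computed.
  have norm : (∀ i j, X i * V j =
      ∑ k, ∑ l, (lam q N * tildeR q N (l, j) (i, k)) • (V k * X l)) →
      ∑ a, ∑ b, metric q N b a • (V a * X b) = ∑ i, X i * V i := by
    intro h
    simp only [h, metric, Matrix.of_apply, Finset.mul_sum, Finset.sum_smul]
    refine Eq.trans ?_ Finset.sum_comm
    refine Finset.sum_congr rfl fun k _ => ?_
    exact Finset.sum_comm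
  constructor
  · intro h
    have hxv := xv.2 h.xv
    exact ⟨vv.2 h.vv, xx.2 h.xx, hxv, (norm hxv).trans h.norm⟩
  · rintro ⟨h1, h2, h3, h4⟩
    exact ⟨vv.1 h1, xx.1 h2, xv.1 h3, (norm h3).symm.trans h4⟩

/-- The relations are invariant under exchange of V and X combined with reversal of products, again
because q is real; hence the involution of the sphere. -/
theorem IsSphereFamily.bar_op {V X : Fin N → A} (h : IsSphereFamily q V X) :
    IsSphereFamily q (fun i => Bar.mk (MulOpposite.op (X i)))
      fun i => Bar.mk (MulOpposite.op (V i)) where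
  vv hij := by
    simp only [← map_mul, ← MulOpposite.op_mul, Bar.smul_mk, Complex.conj_ofReal, h.xx hij,
      MulOpposite.op_smul]
  xx hij := by
    simp only [← map_mul, ← MulOpposite.op_mul, Bar.smul_mk, Complex.conj_ofReal, h.vv hij,
      MulOpposite.op_smul]
  xv k l := by
    have hdg : ∀ k l : Fin N, conj (dg q k l) = dg q l k := fun k l => by
      unfold dg
      by_cases h : k = l
      · simp [h]
      · simp [h, Ne.symm h]
    simp only [← map_mul, ← MulOpposite.op_mul, Bar.smul_mk, Complex.conj_ofReal, hdg, ← map_sum,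
      conj_wq, ← MulOpposite.op_smul, h.xv l k, MulOpposite.op_add, map_add, ← Finset.op_sum]
    by_cases hkl : k = l
    · subst hkl
      simp
    · simp [hkl, Ne.symm hkl]
  norm := by
    simp only [← map_mul, ← MulOpposite.op_mul, ← map_sum, ← Finset.op_sum, h.norm]
    rfl

end SphereRelations

/-! ### The quantum sphere -/

namespace Sphere

variable {q : ℝ} {n : ℕ}

theorem isSphereFamily (hq : q ≠ 0) (n : ℕ) :
    IsSphereFamily q (v q : Fin n → Sphere q n) (x q) := by
  refine (isSphereFamily_iff hq _ _).2 ⟨fun i j => ?_, fun i j => ?_, fun i j => ?_, ?_⟩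
  · have := RingQuot.mkAlgHom_rel ℂ (SphereRel.vv (q := q) i j)
    simp only [map_sum, map_smul, map_mul] at this
    exact this
  · have := RingQuot.mkAlgHom_rel ℂ (SphereRel.xx (q := q) i j)
    simp only [map_sum, map_smul, map_mul] at this
    exact this
  · have := RingQuot.mkAlgHom_rel ℂ (SphereRel.xv (q := q) i j)
    simp only [map_sum, map_smul, map_mul] at this
    exact this
  · have := RingQuot.mkAlgHom_rel ℂ (SphereRel.norm (q := q) (n := n))
    simp only [map_sum, map_smul, map_mul, map_one] at this
    exact this

section Lift

variable {A : Type} [Ring A] [Algebra ℂ A]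

/-- The values of a homomorphism on generators. -/
def genMap (V X : Fin n → A) : SphereGen n → A
  | SphereGen.v i => V i
  | SphereGen.x i => X i

/-- The homomorphism from `S_q^{2n-1}` given by a family which satisfies the relations. -/
def lift (hq : q ≠ 0) (V X : Fin n → A) (h : IsSphereFamily q V X) : Sphere q n →ₐ[ℂ] A :=
  RingQuot.liftAlgHom ℂ ⟨FreeAlgebra.lift ℂ (genMap V X), by
    obtain ⟨h1, h2, h3, h4⟩ := (isSphereFamily_iff hq V X).1 h
    intro x y h
    cases h with
    | vv i j =>
      simp only [map_sum, map_smul, map_mul, FreeAlgebra.lift_ι_apply, genMap]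
      exact h1 i j
    | xx i j =>
      simp only [map_sum, map_smul, map_mul, FreeAlgebra.lift_ι_apply, genMap]
      exact h2 i j
    | xv i j =>
      simp only [map_sum, map_smul, map_mul, FreeAlgebra.lift_ι_apply, genMap]
      exact h3 i j
    | norm =>
      simp only [map_sum, map_smul, map_mul, map_one, FreeAlgebra.lift_ι_apply, genMap]
      exact h4⟩

variable {hq : q ≠ 0} {V X : Fin n → A} {h : IsSphereFamily q V X}

theorem lift_v (i : Fin n) : lift hq V X h (v q i) = V i := by
  simp [lift, v, genMap]

theorem lift_x (i : Fin n) : lift hq V X h (x q i) = X i := by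
  simp [lift, x, genMap]

end Lift

theorem adjoin_eq_top (q : ℝ) (n : ℕ) :
    Algebra.adjoin ℂ (Set.range (v q : Fin n → Sphere q n) ∪ Set.range (x q)) = ⊤ := by
  have h1 : (RingQuot.mkAlgHom ℂ (SphereRel q n)).range = ⊤ :=
    (AlgHom.range_eq_top _).2 (RingQuot.mkAlgHom_surjective ℂ _)
  rw [← h1, ← Algebra.map_top, ← FreeAlgebra.adjoin_range_ι, AlgHom.map_adjoin]
  congr 1
  ext y
  constructor
  · rintro (⟨i, rfl⟩ | ⟨i, rfl⟩)
    · exact ⟨_, ⟨SphereGen.v i, rfl⟩, rfl⟩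
    · exact ⟨_, ⟨SphereGen.x i, rfl⟩, rfl⟩
  · rintro ⟨_, ⟨x, rfl⟩, rfl⟩
    cases x with
    | v i => exact Or.inl ⟨i, rfl⟩
    | x i => exact Or.inr ⟨i, rfl⟩

/-- Induction over the quantum sphere. -/
theorem induction {p : Sphere q n → Prop} (hv : ∀ i, p (v q i)) (hx : ∀ i, p (x q i))
    (hc : ∀ c : ℂ, p (algebraMap ℂ _ c)) (hadd : ∀ x y, p x → p y → p (x + y))
    (hmul : ∀ x y, p x → p y → p (x * y)) (y : Sphere q n) : p y := by
  have hy : y ∈ Algebra.adjoin ℂ (Set.range (v q : Fin n → Sphere q n) ∪ Set.range (x q)) := by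
    rw [adjoin_eq_top]; trivial
  induction hy using Algebra.adjoin_induction with
  | mem y hy =>
    rcases hy with ⟨i, rfl⟩ | ⟨i, rfl⟩
    · exact hv i
    · exact hx i
  | algebraMap c => exact hc c
  | add x y _ _ hx hy => exact hadd x y hx hy
  | mul x y _ _ hx hy => exact hmul x y hx hy

/-- The `*`-operation of the quantum sphere as a homomorphism. -/
def starHom (hq : q ≠ 0) (n : ℕ) : Sphere q n →ₐ[ℂ] Bar (Sphere q n)ᵐᵒᵖ :=
  lift hq _ _ (isSphereFamily hq n).bar_op

/-- The `*`-operation of the quantum sphere. -/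
def conjMap (hq : q ≠ 0) : Sphere q n → Sphere q n := antiMap (starHom hq n)

theorem conjMap_v (hq : q ≠ 0) (i : Fin n) : conjMap hq (v q i) = x q i := by
  rw [conjMap, antiMap, starHom, lift_v]; rfl

theorem conjMap_x (hq : q ≠ 0) (i : Fin n) : conjMap hq (x q i) = v q i := by
  rw [conjMap, antiMap, starHom, lift_x]; rfl

theorem conjMap_conjMap (hq : q ≠ 0) (y : Sphere q n) : conjMap hq (conjMap hq y) = y := by
  induction y using induction with
  | hv i => rw [conjMap_v, conjMap_x]
  | hx i => rw [conjMap_x, conjMap_v]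
  | hc c => unfold conjMap; rw [antiMap_algebraMap, antiMap_algebraMap, Complex.conj_conj]
  | hadd x y hx hy =>
    unfold conjMap at *
    rw [antiMap_add, antiMap_add, hx, hy]
  | hmul x y hx hy =>
    unfold conjMap at *
    rw [antiMap_mul, antiMap_mul, hx, hy]

/-- The embedding of the quantum sphere. -/
def toUq (hq : q ≠ 0) (n : ℕ) : Sphere q (n + 1) →ₐ[ℂ] Uq q (n + 1) :=
  lift hq _ _ (IsSpherePair.isSphereFamily hq
    ((Uq.isQMatrix_t hq (n + 1)).isSpherePair hq (Uq.isMatInv hq _)))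

theorem toUq_v (hq : q ≠ 0) (i : Fin (n + 1)) :
    toUq hq n (v q i) = (q : ℂ) ^ (i.rev : ℕ) • Uq.t q 0 i.rev := lift_v i

theorem toUq_x (hq : q ≠ 0) (i : Fin (n + 1)) :
    toUq hq n (x q i) = (q : ℂ) ^ (i.rev : ℕ) • Uq.s hq i.rev 0 := lift_x i

theorem toUq_conjMap (hq : q ≠ 0) (y : Sphere q (n + 1)) :
    toUq hq n (conjMap hq y) = Uq.conjMap hq (toUq hq n y) := by
  induction y using induction with
  | hv i => rw [conjMap_v, toUq_x, toUq_v, Uq.conjMap_smul, Uq.conjMap_t]; simp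
  | hx i => rw [conjMap_x, toUq_x, toUq_v, Uq.conjMap_smul, Uq.conjMap_s]; simp
  | hc c =>
    unfold conjMap
    rw [antiMap_algebraMap, AlgHom.commutes, AlgHom.commutes, Uq.conjMap_algebraMap]
  | hadd x y hx hy =>
    unfold conjMap at *
    rw [antiMap_add, map_add, map_add, hx, hy, Uq.conjMap_add]
  | hmul x y hx hy =>
    unfold conjMap at *
    rw [antiMap_mul, map_mul, map_mul, hx, hy, Uq.conjMap_mul]

theorem range_toUq (hq : q ≠ 0) (n : ℕ) : (toUq hq n).range = Uq.sphereSubalgebra hq n := by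
  have hq' : (q : ℂ) ≠ 0 := by exact_mod_cast hq
  refine le_antisymm ?_ (Algebra.adjoin_le ?_)
  · rintro _ ⟨y, rfl⟩
    change toUq hq n y ∈ _
    induction y using induction with
    | hv i =>
      rw [toUq_v]
      exact Subalgebra.smul_mem _ (Uq.t_mem_sphereSubalgebra hq _) _
    | hx i =>
      rw [toUq_x]
      exact Subalgebra.smul_mem _ (Uq.s_mem_sphereSubalgebra hq _) _
    | hc c => rw [AlgHom.commutes]; exact Subalgebra.algebraMap_mem _ c
    | hadd x y hx hy => rw [map_add]; exact add_mem hx hy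
    | hmul x y hx hy => rw [map_mul]; exact mul_mem hx hy
  · rintro _ (⟨j, rfl⟩ | ⟨j, rfl⟩)
    · refine ⟨((q : ℂ) ^ (j : ℕ))⁻¹ • v q j.rev, ?_⟩
      change toUq hq n _ = _
      rw [map_smul, toUq_v, Fin.rev_rev, smul_smul, inv_mul_cancel₀ (pow_ne_zero _ hq'), one_smul]
    · refine ⟨((q : ℂ) ^ (j : ℕ))⁻¹ • x q j.rev, ?_⟩
      change toUq hq n _ = _
      rw [map_smul, toUq_x, Fin.rev_rev, smul_smul, inv_mul_cancel₀ (pow_ne_zero _ hq'), one_smul]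

end Sphere

/-! ### Homomorphisms given by invertible quantum matrices -/

section

variable {q : ℝ} {n : ℕ} {A : Type*} [Ring A] [Algebra ℂ A] {t s : Fin n → Fin n → A}

/-- The determinant of the inverse is a left inverse of the determinant; the same for the reflected
matrix over the opposite algebra gives a right inverse. Representations can thus be built from
invertible quantum matrices alone. -/
theorem IsQMatrix.exists_det_inverse (ht : IsQMatrix q t) (hq : q ≠ 0) (h : IsMatInv t s) :
    ∃ D, rowDet q t * D = 1 ∧ D * rowDet q t = 1 := by
  have h1 := ht.rowDet_inverse_mul hq h
  have h' : IsMatInv (fun i j => MulOpposite.op (t (Fin.rev j) (Fin.rev i)))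
      fun i j => MulOpposite.op (s (Fin.rev j) (Fin.rev i)) := by
    refine ⟨fun i j => ?_, fun i j => ?_⟩
    · have := h.left j.rev i.rev
      rw [← Equiv.sum_comp Fin.revPerm] at this
      simp only [← MulOpposite.op_mul, ← Finset.op_sum]
      simp only [Fin.revPerm_apply] at this
      rw [this]
      simp only [Fin.rev_inj, eq_comm (a := j)]
      split_ifs <;> rfl
    · have := h.right j.rev i.rev
      rw [← Equiv.sum_comp Fin.revPerm] at this
      simp only [← MulOpposite.op_mul, ← Finset.op_sum]
      simp only [Fin.revPerm_apply] at this
      rw [this]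
      simp only [Fin.rev_inj, eq_comm (a := j)]
      split_ifs <;> rfl
  have h2 := congrArg MulOpposite.unop (ht.opRev.rowDet_inverse_mul hq h')
  rw [ht.rowDet_opRev hq, MulOpposite.unop_mul, MulOpposite.unop_op] at h2
  refine ⟨_, ?_, h1⟩
  rwa [left_inv_eq_right_inv h1 h2]

theorem IsMatInv.mul {u v : Fin n → Fin n → A} (h : IsMatInv t s) (h' : IsMatInv u v) :
    IsMatInv (fun i j => ∑ k, t i k * u k j) fun i j => ∑ k, v i k * s k j := by
  have key : ∀ {t s u v : Fin n → Fin n → A}, (∀ i j, ∑ k, t i k * s k j = if i = j then 1 else 0) →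
      (∀ i j, ∑ k, u i k * v k j = if i = j then 1 else 0) → ∀ i j,
      ∑ k, (∑ l, t i l * u l k) * (∑ l, v k l * s l j) = if i = j then 1 else 0 := by
    intro t s u v h h' i j
    have h1 : Matrix.of t * Matrix.of s = 1 := by
      ext i j; simp [Matrix.mul_apply, h, Matrix.one_apply]
    have h2 : Matrix.of u * Matrix.of v = 1 := by
      ext i j; simp [Matrix.mul_apply, h', Matrix.one_apply]
    have h3 : (Matrix.of t * Matrix.of u) * (Matrix.of v * Matrix.of s) = 1 := by
      rw [Matrix.mul_assoc, ← Matrix.mul_assoc (Matrix.of u), h2, Matrix.one_mul, h1]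
    have := congrFun (congrFun h3 i) j
    simpa [Matrix.mul_apply, Matrix.one_apply] using this
  exact ⟨key h.right h'.right, key h'.left h.left⟩

/-- The block matrix with the blocks `t` and `1`. -/
def endBlock (t : Fin n → Fin n → A) : Fin (n + 1) → Fin (n + 1) → A :=
  Fin.snoc (fun i => Fin.snoc (t i) 0) (Fin.snoc (fun _ => 0) 1)

theorem endBlock_castSucc_castSucc (t : Fin n → Fin n → A) (i j : Fin n) :
    endBlock t i.castSucc j.castSucc = t i j := by
  simp [endBlock]

theorem endBlock_castSucc_last (t : Fin n → Fin n → A) (i : Fin n) :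
    endBlock t i.castSucc (Fin.last n) = 0 := by
  simp [endBlock]

theorem endBlock_last_castSucc (t : Fin n → Fin n → A) (i : Fin n) :
    endBlock t (Fin.last n) i.castSucc = 0 := by
  simp [endBlock]

theorem endBlock_last_last (t : Fin n → Fin n → A) :
    endBlock t (Fin.last n) (Fin.last n) = 1 := by
  simp [endBlock]

theorem IsQMatrix.endBlock (h : IsQMatrix q t) : IsQMatrix q (endBlock t) where
  row i a b hab := by
    cases i using Fin.lastCases <;> cases a using Fin.lastCases <;> cases b using Fin.lastCases <;>
      simp_all [endBlock_castSucc_castSucc, endBlock_castSucc_last, endBlock_last_castSucc,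
        endBlock_last_last, h.row, Fin.castSucc_lt_castSucc_iff]
  col a hij := by
    rename_i i j
    cases i using Fin.lastCases <;> cases a using Fin.lastCases <;> cases j using Fin.lastCases <;>
      simp_all [endBlock_castSucc_castSucc, endBlock_castSucc_last, endBlock_last_castSucc,
        endBlock_last_last, h.col, Fin.castSucc_lt_castSucc_iff]
  comm hij hab := by
    rename_i i j a b
    cases i using Fin.lastCases with
    | last => exact absurd hij (not_lt.2 (Fin.le_last _))
    | cast i =>
      cases a using Fin.lastCases with
      | last => exact absurd hab (not_lt.2 (Fin.le_last _))
      | cast a =>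
        cases j using Fin.lastCases <;> cases b using Fin.lastCases <;>
          simp_all [endBlock_castSucc_castSucc, endBlock_castSucc_last, endBlock_last_castSucc,
            Fin.castSucc_lt_castSucc_iff]
        exact h.comm hij hab
  cross hij hab := by
    rename_i i j a b
    cases i using Fin.lastCases with
    | last => exact absurd hij (not_lt.2 (Fin.le_last _))
    | cast i =>
      cases a using Fin.lastCases with
      | last => exact absurd hab (not_lt.2 (Fin.le_last _))
      | cast a =>
        cases j using Fin.lastCases <;> cases b using Fin.lastCases <;>
          simp_all [endBlock_castSucc_castSucc, endBlock_castSucc_last, endBlock_last_castSucc,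
            endBlock_last_last, h.cross, Fin.castSucc_lt_castSucc_iff]

theorem IsMatInv.endBlock (h : IsMatInv t s) : IsMatInv (endBlock t) (endBlock s) where
  right i j := by
    cases i using Fin.lastCases <;> cases j using Fin.lastCases <;>
      simp [Fin.sum_univ_castSucc, endBlock_castSucc_castSucc, endBlock_castSucc_last,
        endBlock_last_castSucc, endBlock_last_last, h.right, Fin.castSucc_ne_last,
        (Fin.castSucc_ne_last _).symm]
  left i j := by
    cases i using Fin.lastCases <;> cases j using Fin.lastCases <;>
      simp [Fin.sum_univ_castSucc, endBlock_castSucc_castSucc, endBlock_castSucc_last,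
        endBlock_last_castSucc, endBlock_last_last, h.left, Fin.castSucc_ne_last,
        (Fin.castSucc_ne_last _).symm]

/-- The quantum matrices given by an invertible element `a` and an element `b` with
`b a = q a b`. -/
structure IsSkewPair (q : ℝ) (a a' b : A) : Prop where
  mul_inv : a * a' = 1
  inv_mul : a' * a = 1
  comm : b * a = (q : ℂ) • (a * b)

/-- The block matrix with determinant `1` and the first row `(a, b, 0, …)`. -/
def skewBlock (q : ℝ) (a a' b : A) : (m : ℕ) → Fin (m + 2) → Fin (m + 2) → A
  -- The last entry d is forced by the determinant ad − q⁻¹b(−qb) = ad + b² = 1.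
  | 0 => ![![a, b], ![-(q : ℂ) • b, a' * (1 - b * b)]]
  | m + 1 => endBlock (skewBlock q a a' b m)

/-- The inverse of `skewBlock`. -/
def skewBlockInv (q : ℝ) (a a' b : A) : (m : ℕ) → Fin (m + 2) → Fin (m + 2) → A
  | 0 => ![![a' * (1 - b * b), -(q : ℂ) • b], ![b, a]]
  | m + 1 => endBlock (skewBlockInv q a a' b m)

variable {a a' b : A}

theorem IsSkewPair.inv_comm (h : IsSkewPair q a a' b) : a' * b = (q : ℂ) • (b * a') := by
  have := congrArg (fun z => a' * z * a') h.comm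
  simp only [mul_smul_comm, smul_mul_assoc] at this
  rwa [mul_assoc, mul_assoc, h.mul_inv, mul_one, ← mul_assoc a', h.inv_mul, one_mul] at this

theorem IsSkewPair.mul_b (h : IsSkewPair q a a' b) :
    a' * (1 - b * b) * b = (q : ℂ) • (b * (a' * (1 - b * b))) := by
  have : a' * (1 - b * b) * b = a' * b * (1 - b * b) := by noncomm_ring
  rw [this, h.inv_comm, smul_mul_assoc, mul_assoc]

theorem IsSkewPair.mul_a (h : IsSkewPair q a a' b) :
    a' * (1 - b * b) * a = 1 - (q : ℂ) • (q : ℂ) • (b * b) := by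
  have : a' * (1 - b * b) * a = a' * a - a' * b * (b * a) := by noncomm_ring
  rw [this, h.comm, h.inv_comm, h.inv_mul, smul_mul_smul_comm, mul_assoc, ← mul_assoc a', h.inv_mul,
    one_mul, smul_smul]

theorem IsSkewPair.a_mul (h : IsSkewPair q a a' b) : a * (a' * (1 - b * b)) = 1 - b * b := by
  rw [← mul_assoc, h.mul_inv, one_mul]

theorem IsSkewPair.isQMatrix (h : IsSkewPair q a a' b) (hq : q ≠ 0) (m : ℕ) :
    IsQMatrix q (skewBlock q a a' b m) := by
  have hq' : (q : ℂ) ≠ 0 := by exact_mod_cast hq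
  induction m with
  | zero =>
    have h01 : ∀ {i j : Fin 2}, i < j → i = 0 ∧ j = 1 := by decide
    refine ⟨fun i a b hab => ?_, fun {i j} a hij => ?_, fun {i j a b} hij hab => ?_,
      fun {i j a b} hij hab => ?_⟩
    · obtain ⟨rfl, rfl⟩ := h01 hab
      fin_cases i
      · exact h.comm
      · simp [skewBlock, h.mul_b]
    · obtain ⟨rfl, rfl⟩ := h01 hij
      fin_cases a
      · simp [skewBlock, h.comm]
      · simp [skewBlock, h.mul_b]
    · obtain ⟨rfl, rfl⟩ := h01 hij
      obtain ⟨rfl, rfl⟩ := h01 hab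
      simp [skewBlock]
    · obtain ⟨rfl, rfl⟩ := h01 hij
      obtain ⟨rfl, rfl⟩ := h01 hab
      simp only [skewBlock, Matrix.cons_val_zero, Matrix.cons_val_one, Matrix.cons_val_fin_one,
        h.mul_a, h.a_mul, smul_mul_assoc, smul_smul]
      have : wq q * -(q : ℂ) = 1 - q * q := by
        simp only [wq]
        field_simp
        ring
      rw [this]
      module
  | succ m ih => exact ih.endBlock

theorem IsSkewPair.isMatInv (h : IsSkewPair q a a' b) (m : ℕ) :
    IsMatInv (skewBlock q a a' b m) (skewBlockInv q a a' b m) := by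
  induction m with
  | zero =>
    refine ⟨fun i j => ?_, fun i j => ?_⟩
    · fin_cases i <;> fin_cases j <;> simp [skewBlock, skewBlockInv, h.mul_a, h.mul_b, h.a_mul,
        h.comm, smul_smul]
    · fin_cases i <;> fin_cases j <;> simp [skewBlock, skewBlockInv, h.mul_a, h.mul_b, h.a_mul,
        h.comm, smul_smul]
  | succ m ih => exact ih.endBlock

theorem skewBlock_zero (q : ℝ) (a a' b : A) (m : ℕ) :
    skewBlock q a a' b m 0 = Fin.cons a (Fin.cons b 0) := by
  induction m with
  | zero =>
    ext i
    fin_cases i <;> rfl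
  | succ m ih =>
    have h0 : (0 : Fin (m + 1 + 2)) = Fin.castSucc 0 := rfl
    ext i
    cases i using Fin.lastCases with
    | last =>
      rw [skewBlock, h0, endBlock_castSucc_last]
      rfl
    | cast i =>
      rw [skewBlock, h0, endBlock_castSucc_castSucc, ih]
      cases i using Fin.cases with
      | zero => rfl
      | succ i => cases i using Fin.cases <;> rfl

theorem skewBlockInv_zero (q : ℝ) (a a' b : A) (m : ℕ) (i : Fin (m + 2)) :
    skewBlockInv q a a' b m i 0 =
      (Fin.cons (a' * (1 - b * b)) (Fin.cons b 0) : Fin (m + 2) → A) i := by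
  induction m with
  | zero => fin_cases i <;> rfl
  | succ m ih =>
    have h0 : (0 : Fin (m + 1 + 2)) = Fin.castSucc 0 := rfl
    cases i using Fin.lastCases with
    | last =>
      rw [skewBlockInv, h0, endBlock_last_castSucc]
      rfl
    | cast i =>
      rw [skewBlockInv, h0, endBlock_castSucc_castSucc, ih]
      cases i using Fin.cases with
      | zero => rfl
      | succ i => cases i using Fin.cases <;> rfl

end

namespace Uq

variable {q : ℝ} {n : ℕ}

section

variable {A : Type} [Ring A] [Algebra ℂ A]

theorem exists_lift (hq : q ≠ 0) {u v : Fin n → Fin n → A} (hu : IsQMatrix q u)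
    (h : IsMatInv u v) :
    ∃ f : Uq q n →ₐ[ℂ] A, (∀ i j, f (t q i j) = u i j) ∧ ∀ i j, f (s hq i j) = v i j := by
  obtain ⟨D, h1, h2⟩ := hu.exists_det_inverse hq h
  have ht : ∀ i j, lift hq u hu D h1 h2 (t q i j) = u i j := lift_t
  refine ⟨lift hq u hu D h1 h2, ht, fun i j => ?_⟩
  have h3 := (isMatInv hq n).map (lift hq u hu D h1 h2)
  simp only [ht] at h3
  exact (congrFun (congrFun (h3.eq_of_right h.right) i) j).symm

end

/-- Induction over `U_q(n)` with the entries of `t` and of its inverse. -/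
theorem induction_t_s (hq : q ≠ 0) {p : Uq q n → Prop} (ht : ∀ i j, p (t q i j))
    (hs : ∀ i j, p (s hq i j))
    (hc : ∀ c : ℂ, p (algebraMap ℂ _ c)) (hadd : ∀ x y, p x → p y → p (x + y))
    (hmul : ∀ x y, p x → p y → p (x * y)) (x : Uq q n) : p x := by
  refine induction ht ?_ hc hadd hmul x
  have hd : detStar q n = MulOpposite.unop (rowDet q
    (fun i j : Fin n => MulOpposite.op (s hq i j))) := by rw [rowDet_s]; rfl
  rw [hd, rowDet_op, MulOpposite.unop_op]
  refine Finset.sum_induction _ p hadd (by simpa using hc 0) fun c _ => ?_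
  rw [Algebra.smul_def]
  refine hmul _ _ (hc _) ?_
  have hl : ∀ x ∈ (List.ofFn fun k => s hq k (c k)).reverse, p x := by
    intro x hx
    rw [List.mem_reverse, List.mem_ofFn'] at hx
    obtain ⟨k, rfl⟩ := hx
    exact hs _ _
  generalize (List.ofFn fun k => s hq k (c k)).reverse = l at hl
  induction l with
  | nil => simpa using hc 1
  | cons x l ih =>
    rw [List.prod_cons]
    exact hmul _ _ (hl x List.mem_cons_self) (ih fun y hy => hl y (List.mem_cons_of_mem _ hy))

end Uq

/-! ### Weighted shifts -/

section Shift

variable {L M : Type*} [AddCommGroup L] [AddCommGroup M] [Module ℂ M] (e : Module.Basis L ℂ M)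

/-- An operator which maps basis vectors to nonzero multiples of translated basis vectors. -/
def IsShift (f : Module.End ℂ M) (d : L) : Prop :=
  ∀ l, ∃ c : ℂ, c ≠ 0 ∧ f (e l) = c • e (l + d)

/-- An operator which moves basis vectors by translations in a finite set. -/
def IsLocal (f : Module.End ℂ M) : Prop :=
  ∃ D : Finset L, ∀ l, f (e l) ∈ Submodule.span ℂ (e '' {l' | ∃ d ∈ D, l' = l + d})

/-- The weighted shift. -/
def wshift (c : L → ℂ) (d : L) : Module.End ℂ M := e.constr ℂ fun l => c l • e (l + d)

variable {e}

theorem wshift_apply (c : L → ℂ) (d l : L) : wshift e c d (e l) = c l • e (l + d) :=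
  e.constr_basis ℂ _ l

theorem isShift_wshift {c : L → ℂ} (hc : ∀ l, c l ≠ 0) (d : L) : IsShift e (wshift e c d) d :=
  fun l => ⟨c l, hc l, wshift_apply c d l⟩

theorem IsShift.one : IsShift e (1 : Module.End ℂ M) 0 :=
  fun l => ⟨1, one_ne_zero, by simp⟩

theorem IsShift.mul {f g : Module.End ℂ M} {d d' : L} (hf : IsShift e f d) (hg : IsShift e g d') :
    IsShift e (f * g) (d' + d) := by
  intro l
  obtain ⟨c, hc, h⟩ := hg l
  obtain ⟨c', hc', h'⟩ := hf (l + d')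
  exact ⟨c * c', mul_ne_zero hc hc', by
    rw [Module.End.mul_apply, h, map_smul, h', smul_smul, add_assoc]⟩

/-- The coefficients are translated and multiplied by nonzero scalars. This permits cancelling shift
operators although they are not inverted. -/
theorem IsShift.injective {f : Module.End ℂ M} {d : L} (hf : IsShift e f d) :
    Function.Injective f := by
  refine (injective_iff_map_eq_zero f).2 fun m hm => ?_
  choose c hc h using hf
  have key : ∀ m l, e.repr (f m) (l + d) = c l * e.repr m l := by
    intro m l
    have hlin : e.coord (l + d) ∘ₗ f = c l • e.coord l := e.ext fun l' => by
      rw [LinearMap.comp_apply, h, map_smul, LinearMap.smul_apply, e.coord_apply, e.coord_apply,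
        e.repr_self, e.repr_self]
      by_cases hl : l' = l
      · subst hl
        simp
      · rw [Finsupp.single_eq_of_ne (fun hh => hl (add_right_cancel hh).symm),
          Finsupp.single_eq_of_ne (Ne.symm hl), smul_zero, smul_zero]
    exact LinearMap.congr_fun hlin m
  refine e.ext_elem fun l => ?_
  have := key m l
  rw [hm] at this
  simpa [hc l] using this.symm

theorem IsShift.isLocal {f : Module.End ℂ M} {d : L} (hf : IsShift e f d) : IsLocal e f := by
  refine ⟨{d}, fun l => ?_⟩
  obtain ⟨c, -, h⟩ := hf l
  rw [h]
  exact Submodule.smul_mem _ _ (Submodule.subset_span ⟨_, ⟨d, by simp, rfl⟩, rfl⟩)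

theorem IsLocal.smul {f : Module.End ℂ M} (hf : IsLocal e f) (c : ℂ) : IsLocal e (c • f) := by
  obtain ⟨D, hD⟩ := hf
  exact ⟨D, fun l => Submodule.smul_mem _ c (hD l)⟩

theorem IsLocal.one : IsLocal e (1 : Module.End ℂ M) := IsShift.one.isLocal

theorem IsLocal.add {f g : Module.End ℂ M} (hf : IsLocal e f) (hg : IsLocal e g) :
    IsLocal e (f + g) := by
  classical
  obtain ⟨D, hD⟩ := hf
  obtain ⟨D', hD'⟩ := hg
  refine ⟨D ∪ D', fun l => add_mem (Submodule.span_mono ?_ (hD l)) (Submodule.span_mono ?_ (hD' l))⟩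
  · rintro _ ⟨_, ⟨d, hd, rfl⟩, rfl⟩
    exact ⟨_, ⟨d, Finset.mem_union_left _ hd, rfl⟩, rfl⟩
  · rintro _ ⟨_, ⟨d, hd, rfl⟩, rfl⟩
    exact ⟨_, ⟨d, Finset.mem_union_right _ hd, rfl⟩, rfl⟩

theorem IsLocal.zero : IsLocal e (0 : Module.End ℂ M) := ⟨∅, fun l => by simp⟩

theorem map_mem_of_mem_span {N N' : Type*} [AddCommGroup N] [Module ℂ N] [AddCommGroup N']
    [Module ℂ N'] {S : Set N} {T : Submodule ℂ N'} (g : N →ₗ[ℂ] N') (h : ∀ y ∈ S, g y ∈ T) {x : N}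
    (hx : x ∈ Submodule.span ℂ S) : g x ∈ T :=
  (Submodule.span_le.2 h : Submodule.span ℂ S ≤ T.comap g) hx

theorem IsLocal.mul {f g : Module.End ℂ M} (hf : IsLocal e f) (hg : IsLocal e g) :
    IsLocal e (f * g) := by
  classical
  obtain ⟨D, hD⟩ := hf
  obtain ⟨D', hD'⟩ := hg
  refine ⟨Finset.image₂ (· + ·) D' D, fun l => map_mem_of_mem_span f ?_ (hD' l)⟩
  rintro _ ⟨_, ⟨d', hd', rfl⟩, rfl⟩
  refine Submodule.span_mono ?_ (hD (l + d'))
  rintro _ ⟨_, ⟨d, hd, rfl⟩, rfl⟩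
  exact ⟨_, ⟨d' + d, Finset.mem_image₂_of_mem hd' hd, add_assoc _ _ _⟩, rfl⟩

theorem IsLocal.sum {ι : Type*} {u : Finset ι} {f : ι → Module.End ℂ M}
    (hf : ∀ i ∈ u, IsLocal e (f i)) : IsLocal e (∑ i ∈ u, f i) :=
  Finset.sum_induction _ _ (fun _ _ => IsLocal.add) IsLocal.zero hf

variable {L' M' : Type*} [AddCommGroup L'] [AddCommGroup M'] [Module ℂ M']
  {e' : Module.Basis L' ℂ M'}

theorem IsShift.rTensor {f : Module.End ℂ M} {d : L} (hf : IsShift e f d) :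
    IsShift (e.tensorProduct e') (Module.End.rTensorAlgHom ℂ M M' f) (d, 0) := by
  rintro ⟨l, l'⟩
  obtain ⟨c, hc, h⟩ := hf l
  refine ⟨c, hc, ?_⟩
  rw [Module.Basis.tensorProduct_apply, Prod.mk_add_mk, Module.Basis.tensorProduct_apply]
  change LinearMap.rTensor M' f _ = _
  rw [LinearMap.rTensor_tmul, h, add_zero, TensorProduct.smul_tmul']

theorem IsShift.lTensor {f : Module.End ℂ M'} {d : L'} (hf : IsShift e' f d) :
    IsShift (e.tensorProduct e') (Module.End.lTensorAlgHom ℂ M' M f) (0, d) := by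
  rintro ⟨l, l'⟩
  obtain ⟨c, hc, h⟩ := hf l'
  refine ⟨c, hc, ?_⟩
  rw [Module.Basis.tensorProduct_apply, Prod.mk_add_mk, Module.Basis.tensorProduct_apply]
  change LinearMap.lTensor M f _ = _
  rw [LinearMap.lTensor_tmul, h, add_zero, TensorProduct.tmul_smul]

theorem IsLocal.rTensor {f : Module.End ℂ M} (hf : IsLocal e f) :
    IsLocal (e.tensorProduct e') (Module.End.rTensorAlgHom ℂ M M' f) := by
  obtain ⟨D, hD⟩ := hf
  refine ⟨D ×ˢ {0}, ?_⟩
  rintro ⟨l, l'⟩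
  rw [Module.Basis.tensorProduct_apply]
  refine map_mem_of_mem_span ((TensorProduct.mk ℂ M M').flip (e' l')) ?_ (hD l)
  rintro _ ⟨_, ⟨d, hd, rfl⟩, rfl⟩
  exact Submodule.subset_span ⟨(l + d, l'), ⟨(d, 0), by simpa using hd, by simp⟩, by
    rw [Module.Basis.tensorProduct_apply]; rfl⟩

theorem IsLocal.lTensor {f : Module.End ℂ M'} (hf : IsLocal e' f) :
    IsLocal (e.tensorProduct e') (Module.End.lTensorAlgHom ℂ M' M f) := by
  obtain ⟨D, hD⟩ := hf
  refine ⟨{0} ×ˢ D, ?_⟩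
  rintro ⟨l, l'⟩
  rw [Module.Basis.tensorProduct_apply]
  refine map_mem_of_mem_span (TensorProduct.mk ℂ M M' (e l)) ?_ (hD l')
  rintro _ ⟨_, ⟨d, hd, rfl⟩, rfl⟩
  exact Submodule.subset_span ⟨(l, l' + d), ⟨(0, d), by simpa using hd, by simp⟩, by
    rw [Module.Basis.tensorProduct_apply]; rfl⟩

theorem commute_rTensor_lTensor (f : Module.End ℂ M) (g : Module.End ℂ M') :
    Commute (Module.End.rTensorAlgHom ℂ M M' f) (Module.End.lTensorAlgHom ℂ M' M g) := by
  change LinearMap.rTensor M' f ∘ₗ LinearMap.lTensor M g =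
    LinearMap.lTensor M g ∘ₗ LinearMap.rTensor M' f
  rw [LinearMap.rTensor_comp_lTensor, LinearMap.lTensor_comp_rTensor]

end Shift

/-! ### Representations of `U_q(n+1)` by weighted shifts -/

namespace Uq

variable {q : ℝ}

/-- The element `∑_{l ≥ k} t 0 l * s l 0`. -/
def tail (hq : q ≠ 0) (n : ℕ) (k : ℕ) : Uq q (n + 1) := tailSum (fun l => t q 0 l * s hq l 0) k

/-- A representation of `U_q(n+1)` on which the first row of `t` and the tails of
`∑ t 0 l * s l 0` act by weighted shifts, and all elements by local operators. -/
structure ShiftRep (hq : q ≠ 0) (n : ℕ) where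
  L : Type
  [addL : AddCommGroup L]
  M : Type
  [addM : AddCommGroup M]
  [modM : Module ℂ M]
  e : Module.Basis L ℂ M
  ρ : Uq q (n + 1) →ₐ[ℂ] Module.End ℂ M
  X : Fin (n + 1) → L
  B : Fin (n + 1) → L
  ht : L →+ ℤ
  B_zero : B 0 = 0
  -- The next tail moves the basis further up, so in x_i v_i = T_i − T_{i+1} the term T_i leads.
  ht_B : StrictMono fun k => ht (B k)
  -- Independence of the 2n + 1 degrees, `B 0` = 0 being left out, is what separates the monomials.
  indep : ∀ (γ : Fin (n + 1) → ℤ) (μ : Fin n → ℤ),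
    ∑ i, γ i • X i + ∑ k, μ k • B k.succ = 0 → γ = 0 ∧ μ = 0
  isShift_t : ∀ i, IsShift e (ρ (t q 0 i)) (X i)
  isShift_tail : ∀ k : Fin (n + 1), IsShift e (ρ (tail hq n k)) (B k)
  isLocal : ∀ p, IsLocal e (ρ p)

attribute [instance] ShiftRep.addL ShiftRep.addM ShiftRep.modM

theorem tail_zero (hq : q ≠ 0) (n : ℕ) : tail hq n 0 = 1 := by
  rw [tail, tailSum_zero, (isMatInv hq _).right, if_pos rfl]

theorem tailSum_succ {M : Type*} [AddCommGroup M] {N : ℕ} (f : Fin (N + 1) → M) (m : ℕ) :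
    tailSum f (m + 1) = tailSum (fun l => f l.succ) m := by
  rw [tailSum, tailSum, Finset.sum_filter, Finset.sum_filter, Fin.sum_univ_succ]
  simp

/-- The representation of the functions on the circle by shifts. -/
theorem nonempty_shiftRep_zero (hq : q ≠ 0) : Nonempty (ShiftRep hq 0) := by
  let e : Module.Basis ℤ ℂ (ℤ →₀ ℂ) := Finsupp.basisSingleOne
  let a := wshift e (fun _ => 1) 1
  let a' := wshift e (fun _ => 1) (-1)
  have h1 : a * a' = 1 := e.ext fun l => by
    rw [Module.End.mul_apply, wshift_apply, one_smul, wshift_apply]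
    simp
  have h2 : a' * a = 1 := e.ext fun l => by
    rw [Module.End.mul_apply, wshift_apply, one_smul, wshift_apply]
    simp
  have hlt : ∀ {i j : Fin 1}, ¬i < j := by decide
  have hij : ∀ i j : Fin 1, i = j := fun i j => Subsingleton.elim i j
  obtain ⟨ρ, hρ, hρ'⟩ := exists_lift hq (n := 1) (u := fun _ _ => a) (v := fun _ _ => a')
    ⟨fun _ _ _ h => absurd h hlt, fun _ h => absurd h hlt, fun h => absurd h hlt,
      fun h => absurd h hlt⟩
    ⟨fun i j => by simp [h1, hij i j], fun i j => by simp [h2, hij i j]⟩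
  have ha : IsShift e a 1 := isShift_wshift (fun _ => one_ne_zero) 1
  have ha' : IsShift e a' (-1) := isShift_wshift (fun _ => one_ne_zero) (-1)
  exact ⟨{
    L := ℤ
    M := ℤ →₀ ℂ
    e := e
    ρ := ρ
    X := fun _ => 1
    B := fun _ => 0
    ht := 0
    B_zero := rfl
    ht_B := fun _ _ h => absurd h hlt
    indep := fun γ μ h => by
      refine ⟨?_, Subsingleton.elim _ _⟩
      ext i
      rw [hij i 0]
      simpa using h
    isShift_t := fun i => by rw [hρ]; exact ha
    isShift_tail := fun k => by
      rw [hij k 0]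
      change IsShift e (ρ (tail hq 0 0)) 0
      rw [tail_zero, map_one]
      exact IsShift.one
    isLocal := fun p => by
      induction p using induction_t_s hq with
      | ht i j => rw [hρ]; exact ha.isLocal
      | hs i j => rw [hρ']; exact ha'.isLocal
      | hc c => rw [AlgHom.commutes, Algebra.algebraMap_eq_smul_one]; exact IsLocal.one.smul c
      | hadd x y hx hy => rw [map_add]; exact hx.add hy
      | hmul x y hx hy => rw [map_mul]; exact hx.mul hy }⟩

theorem isLocal_skewBlock {L M : Type*} [AddCommGroup L] [AddCommGroup M] [Module ℂ M]
    {e : Module.Basis L ℂ M} {a a' b : Module.End ℂ M} (ha : IsLocal e a) (ha' : IsLocal e a')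
    (hb : IsLocal e b) (m : ℕ) (i j : Fin (m + 2)) : IsLocal e (skewBlock q a a' b m i j) ∧
      IsLocal e (skewBlockInv q a a' b m i j) := by
  have hd : IsLocal e (a' * (1 - b * b)) := by
    rw [sub_eq_add_neg, ← neg_one_smul ℂ]
    exact ha'.mul (IsLocal.one.add ((hb.mul hb).smul _))
  induction m with
  | zero =>
    fin_cases i <;> fin_cases j
    · exact ⟨ha, hd⟩
    · exact ⟨hb, hb.smul _⟩
    · exact ⟨hb.smul _, hb⟩
    · exact ⟨hd, ha⟩
  | succ m ih =>
    cases i using Fin.lastCases <;> cases j using Fin.lastCases <;>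
      simp only [skewBlock, skewBlockInv, endBlock_castSucc_castSucc, endBlock_castSucc_last,
        endBlock_last_castSucc, endBlock_last_last, ih, IsLocal.one, IsLocal.zero, and_self]

/-- Skew pairs exist as weighted shifts. -/
theorem exists_isSkewPair (hq : q ≠ 0) : ∃ (W : Type) (_ : AddCommGroup W) (_ : Module ℂ W)
    (e : Module.Basis (ℤ × ℤ) ℂ W) (a a' b : Module.End ℂ W), IsSkewPair q a a' b ∧
      IsShift e a (1, 0) ∧ IsShift e a' (-1, 0) ∧ IsShift e b (0, 1) := by
  have hq' : (q : ℂ) ≠ 0 := by exact_mod_cast hq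
  let e : Module.Basis (ℤ × ℤ) ℂ ((ℤ × ℤ) →₀ ℂ) := Finsupp.basisSingleOne
  let a := wshift e (fun _ => 1) (1, 0)
  let a' := wshift e (fun _ => 1) (-1, 0)
  -- The weight records the first coordinate, which `a` raises by one; this is the source of ba = q
  -- ab.
  let b := wshift e (fun p => (q : ℂ) ^ p.1) (0, 1)
  have hadd : ∀ l : ℤ × ℤ, l + (0, 0) = l := add_zero
  refine ⟨_, _, _, e, a, a', b, ⟨e.ext fun l => ?_, e.ext fun l => ?_, e.ext fun l => ?_⟩,
    isShift_wshift (fun _ => one_ne_zero) _, isShift_wshift (fun _ => one_ne_zero) _,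
    isShift_wshift (fun l => zpow_ne_zero _ hq') _⟩
  · simp only [a, a', Module.End.mul_apply, wshift_apply, one_smul, Module.End.one_apply,
      add_assoc]
    simp [hadd]
  · simp only [a, a', Module.End.mul_apply, wshift_apply, one_smul, Module.End.one_apply,
      add_assoc]
    simp [hadd]
  · simp only [a, b, Module.End.mul_apply, LinearMap.smul_apply, map_smul, wshift_apply, one_smul,
      Prod.fst_add, zpow_add₀ hq', zpow_one, smul_smul, mul_comm ((q : ℂ) ^ l.1)]
    rw [add_assoc, add_assoc, add_comm ((1, 0) : ℤ × ℤ)]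

/-- Multiply a 2 × 2 block, extended by 1 and acting on W, with 1 ⊕ T acting on the given
representation. The first row becomes a, followed by the entries b ⊗ t 0 i, so it still acts by
shifts. -/
theorem nonempty_shiftRep_succ (hq : q ≠ 0) {n : ℕ} (R : ShiftRep hq n) :
    Nonempty (ShiftRep hq (n + 1)) := by
  obtain ⟨W, _, _, e, a, a', b, hab, ha, ha', hb⟩ := exists_isSkewPair hq
  let rT := Module.End.rTensorAlgHom ℂ W R.M
  let lT := Module.End.lTensorAlgHom ℂ R.M W
  have hcomm : ∀ f g, Commute (rT f) (lT g) := fun f g => commute_rTensor_lTensor f g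
  have hU := (hab.isQMatrix hq n).map (B := Module.End ℂ (W ⊗[ℂ] R.M)) rT
  have hU' := (hab.isMatInv n).map (B := Module.End ℂ (W ⊗[ℂ] R.M)) rT
  have hT := ((isQMatrix_t hq (n + 1)).map
    (B := Module.End ℂ (W ⊗[ℂ] R.M)) (lT.comp R.ρ)).oneBlock
  have hT' := isMatInv_oneBlock ((isMatInv hq (n + 1)).map
    (B := Module.End ℂ (W ⊗[ℂ] R.M)) (lT.comp R.ρ))
  obtain ⟨ρ, hρ, hρ'⟩ := exists_lift hq (hU.mul hq hT fun i j k l => by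
    cases k using Fin.cases <;> cases l using Fin.cases
    · rw [oneBlock_zero_zero]; exact Commute.one_right _
    · rw [oneBlock_zero_succ]; exact Commute.zero_right _
    · rw [oneBlock_succ_zero]; exact Commute.zero_right _
    · rw [oneBlock_succ_succ]; exact hcomm _ _) (hU'.mul hT')
  have hρt0 : ρ (t q 0 0) = rT a := by
    rw [hρ, Fin.sum_univ_succ, Fin.sum_univ_succ]
    simp only [oneBlock_zero_zero, oneBlock_succ_zero, skewBlock_zero]
    simp
  have hρt : ∀ i : Fin (n + 1), ρ (t q 0 i.succ) = rT b * lT (R.ρ (t q 0 i)) := by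
    intro i
    rw [hρ, Fin.sum_univ_succ, Fin.sum_univ_succ]
    simp only [oneBlock_zero_succ, oneBlock_succ_succ, skewBlock_zero]
    simp
  have hρs : ∀ i : Fin (n + 1), ρ (s hq i.succ 0) = lT (R.ρ (s hq i 0)) * rT b := by
    intro i
    rw [hρ', Fin.sum_univ_succ, Fin.sum_univ_succ]
    simp only [oneBlock_succ_zero, oneBlock_succ_succ, skewBlockInv_zero]
    simp
  -- One factor b comes from the row and one from the column of the inverse, and both commute with
  -- the old representation.
  have htail : ∀ k : ℕ, ρ (tail hq (n + 1) (k + 1)) = rT b * rT b * lT (R.ρ (tail hq n k)) := by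
    intro k
    rw [tail, tailSum_succ, tail, tailSum, tailSum, map_sum, map_sum, map_sum, Finset.mul_sum]
    refine Finset.sum_congr rfl fun l _ => ?_
    rw [map_mul, hρt, hρs, map_mul, map_mul, mul_assoc, mul_assoc]
    congr 1
    rw [← mul_assoc, ← mul_assoc, (hcomm b _).eq, mul_assoc, mul_assoc, (hcomm b _).eq]
  refine ⟨{
    L := (ℤ × ℤ) × R.L
    M := W ⊗[ℂ] R.M
    e := e.tensorProduct R.e
    ρ := ρ
    X := Fin.cons ((1, 0), 0) fun i => ((0, 1), R.X i)
    B := Fin.cons 0 fun k => ((0, 2), R.B k)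
    ht := AddMonoidHom.coprod (AddMonoidHom.snd ℤ ℤ) R.ht
    B_zero := rfl
    ht_B := ?_
    indep := ?_
    isShift_t := ?_
    isShift_tail := ?_
    isLocal := ?_ }⟩
  · have h0 : ∀ k, 0 ≤ R.ht (R.B k) := fun k => by
      have := R.ht_B.monotone (Fin.zero_le k)
      simpa [R.B_zero] using this
    refine Fin.strictMono_iff_lt_succ.2 fun k => ?_
    cases k using Fin.cases with
    | zero =>
      have := h0 0
      simp only [Fin.castSucc_zero, Fin.cons_zero, Fin.cons_succ, map_zero]
      simp only [AddMonoidHom.coprod_apply, AddMonoidHom.coe_snd]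
      omega
    | succ k =>
      have : R.ht (R.B k.castSucc) < R.ht (R.B k.succ) := R.ht_B (Fin.castSucc_lt_succ (i := k))
      simp only [Fin.castSucc_succ, Fin.cons_succ, AddMonoidHom.coprod_apply, AddMonoidHom.coe_snd]
      omega
  · intro γ μ h
    rw [Fin.sum_univ_succ, Fin.sum_univ_succ (f := fun k => μ k • _)] at h
    simp only [Fin.cons_zero, Fin.cons_succ] at h
    have h1 := congrArg (fun z => z.1.1) h
    have h2 := congrArg (fun z => z.1.2) h
    have h3 := congrArg (fun z => z.2) h
    simp only [Prod.fst_add, Prod.snd_add, Prod.fst_sum, Prod.snd_sum, Prod.smul_fst, Prod.smul_snd,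
      Prod.fst_zero, Prod.snd_zero, smul_zero, R.B_zero, zero_add] at h1 h2 h3
    have h4 := R.indep _ _ h3
    simp only [funext_iff, Pi.zero_apply] at h4
    -- The old lattice determines all coefficients except those of X 0 and B 1, and these appear
    -- alone in the two new coordinates, as γ 0 and 2 μ 0.
    simp [h4.1, h4.2] at h1 h2
    refine ⟨funext fun i => ?_, funext fun i => ?_⟩
    · cases i using Fin.cases with
      | zero => exact h1
      | succ i => exact h4.1 i
    · cases i using Fin.cases with
      | zero => exact h2
      | succ i => exact h4.2 i
  · intro i
    cases i using Fin.cases with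
    | zero =>
      rw [hρt0]
      exact ha.rTensor
    | succ i =>
      rw [hρt]
      simpa using hb.rTensor.mul (R.isShift_t i).lTensor
  · intro k
    cases k using Fin.cases with
    | zero =>
      change IsShift _ (ρ (tail hq (n + 1) 0)) 0
      rw [tail_zero, map_one]
      exact IsShift.one
    | succ k =>
      rw [Fin.val_succ, htail]
      have := (hb.rTensor (e' := R.e)).mul hb.rTensor |>.mul (R.isShift_tail k).lTensor
      simpa using this
  · intro p
    have hloc : ∀ p, IsLocal (e.tensorProduct R.e) (lT (R.ρ p)) := fun p => (R.isLocal p).lTensor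
    have hsk := fun i j => isLocal_skewBlock (q := q) ha.isLocal ha'.isLocal hb.isLocal n i j
    have hone : ∀ (u : Fin (n + 1) → Fin (n + 1) → Uq q (n + 1)) i j, IsLocal (e.tensorProduct R.e)
        (oneBlock (fun i j => (lT.comp R.ρ) (u i j)) i j) := by
      intro u i j
      cases i using Fin.cases <;> cases j using Fin.cases
      · exact IsLocal.one
      · exact IsLocal.zero
      · exact IsLocal.zero
      · exact hloc _
    induction p using induction_t_s hq with
    | ht i j =>
      rw [hρ]
      exact IsLocal.sum fun k _ => (hsk i k).1.rTensor.mul (hone _ _ _)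
    | hs i j =>
      rw [hρ']
      exact IsLocal.sum fun k _ => (hone _ _ _).mul (hsk k j).2.rTensor
    | hc c => rw [AlgHom.commutes, Algebra.algebraMap_eq_smul_one]; exact IsLocal.one.smul c
    | hadd x y hx hy => rw [map_add]; exact hx.add hy
    | hmul x y hx hy => rw [map_mul]; exact hx.mul hy

/-- Representations of `U_q(n+1)` by weighted shifts exist. -/
theorem nonempty_shiftRep (hq : q ≠ 0) (n : ℕ) : Nonempty (ShiftRep hq n) := by
  induction n with
  | zero => exact nonempty_shiftRep_zero hq
  | succ n ih => exact ih.elim fun R => nonempty_shiftRep_succ hq R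

end Uq

/-! ### Commutation up to scalars -/

section SkewCommute

variable {A : Type*} [Ring A] [Algebra ℂ A] {a b z : A} {m : ℕ}

/-- Commutation up to a nonzero scalar. -/
def SkewCommute (a b : A) : Prop := ∃ c : ℂ, c ≠ 0 ∧ a * b = c • (b * a)

theorem SkewCommute.symm (h : SkewCommute a b) : SkewCommute b a := by
  obtain ⟨c, hc, h⟩ := h
  exact ⟨c⁻¹, inv_ne_zero hc, by rw [h, inv_smul_smul₀ hc]⟩

theorem _root_.Commute.skewCommute (h : Commute a b) : SkewCommute a b :=
  ⟨1, one_ne_zero, by rw [one_smul, h.eq]⟩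

theorem SkewCommute.mul_right (h : SkewCommute z a) (h' : SkewCommute z b) :
    SkewCommute z (a * b) := by
  obtain ⟨c, hc, h⟩ := h
  obtain ⟨c', hc', h'⟩ := h'
  exact ⟨c * c', mul_ne_zero hc hc', by
    rw [← mul_assoc, h, smul_mul_assoc, mul_assoc, h', mul_smul_comm, smul_smul, mul_assoc]⟩

theorem SkewCommute.one_right : SkewCommute z (1 : A) := (Commute.one_right z).skewCommute

theorem SkewCommute.pow_right (h : SkewCommute z a) (k : ℕ) : SkewCommute z (a ^ k) := by
  induction k with
  | zero => rw [pow_zero]; exact SkewCommute.one_right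
  | succ k ih => rw [pow_succ]; exact ih.mul_right h

/-- The ordered product of a family. -/
def fprod (g : Fin m → A) : A := (List.ofFn g).prod

theorem fprod_succ (g : Fin (m + 1) → A) : fprod g = g 0 * fprod fun i => g i.succ := by
  rw [fprod, List.ofFn_succ, List.prod_cons, fprod]

theorem fprod_update_sub (g : Fin m → A) (i : Fin m) (a b : A) :
    fprod (Function.update g i (a - b)) =
      fprod (Function.update g i a) - fprod (Function.update g i b) := by
  simpa only [MultilinearMap.mkPiAlgebraFin_apply, fprod] using (MultilinearMap.mkPiAlgebraFin ℂ m A).map_update_sub g i a b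

theorem fprod_update_smul (g : Fin m → A) (i : Fin m) (c : ℂ) (a : A) :
    fprod (Function.update g i (c • a)) = c • fprod (Function.update g i a) := by
  simpa only [MultilinearMap.mkPiAlgebraFin_apply, fprod] using (MultilinearMap.mkPiAlgebraFin ℂ m A).map_update_smul g i c a

theorem SkewCommute.fprod_right {g : Fin m → A} (h : ∀ i, SkewCommute z (g i)) :
    SkewCommute z (fprod g) := by
  induction m with
  | zero => simpa [fprod] using SkewCommute.one_right
  | succ m ih =>
    rw [fprod_succ]
    exact (h 0).mul_right (ih fun i => h i.succ)

theorem exists_mul_fprod (g : Fin m → A) (i : Fin m) (h : ∀ j, j ≠ i → SkewCommute z (g j)) :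
    ∃ c : ℂ, c ≠ 0 ∧ z * fprod g = c • fprod (Function.update g i (z * g i)) := by
  induction m with
  | zero => exact i.elim0
  | succ m ih =>
    cases i using Fin.cases with
    | zero =>
      refine ⟨1, one_ne_zero, ?_⟩
      rw [fprod_succ, fprod_succ, Function.update_self, one_smul, mul_assoc]
      congr 2
    | succ i =>
      obtain ⟨c, hc, h0⟩ := h 0 (Fin.succ_ne_zero i).symm
      obtain ⟨c', hc', h'⟩ := ih (fun j => g j.succ) i fun j hj => h _ fun hh =>
        hj (Fin.succ_injective _ hh)
      refine ⟨c * c', mul_ne_zero hc hc', ?_⟩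
      rw [fprod_succ, ← mul_assoc, h0, smul_mul_assoc, mul_assoc, h', mul_smul_comm, smul_smul,
        fprod_succ, Function.update_of_ne (Fin.succ_ne_zero i).symm]
      congr 3
      exact (Fin.tail_update_succ g i _).symm

/-- Powers of `a` and, for negative exponents, of `b`. -/
def wpow (a b : A) : ℤ → A
  | .ofNat k => a ^ k
  | .negSucc k => b ^ (k + 1)

theorem SkewCommute.wpow_right (h : SkewCommute z a) (h' : SkewCommute z b) (k : ℤ) :
    SkewCommute z (wpow a b k) := by
  cases k with
  | ofNat k => exact h.pow_right k
  | negSucc k => exact h'.pow_right _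

/-- At a negative exponent a factor ab is left over. In the sphere it is a difference of two tails,
which can be moved to the front. -/
theorem mul_wpow (k : ℤ) :
    a * wpow a b k = wpow a b (k + 1) ∨ a * wpow a b k = a * b * wpow a b (k + 1) := by
  cases k with
  | ofNat k => exact Or.inl (pow_succ' a k).symm
  | negSucc k =>
    refine Or.inr ?_
    cases k with
    | zero => change a * b ^ 1 = a * b * a ^ 0; simp
    | succ k =>
      change a * b ^ (k + 1 + 1) = a * b * b ^ (k + 1)
      rw [pow_succ', mul_assoc]

theorem mul_wpow' (k : ℤ) :
    b * wpow a b k = wpow a b (k - 1) ∨ b * wpow a b k = b * a * wpow a b (k - 1) := by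
  cases k with
  | ofNat k =>
    cases k with
    | zero => exact Or.inl (by change b * a ^ 0 = b ^ (0 + 1); simp)
    | succ k =>
      refine Or.inr ?_
      have : (Int.ofNat (k + 1)) - 1 = Int.ofNat k := by simp
      rw [this]
      change b * a ^ (k + 1) = b * a * a ^ k
      rw [pow_succ', mul_assoc]
  | negSucc k => exact Or.inl (pow_succ' b _).symm

end SkewCommute

/-! ### Monomials in the sphere algebra -/

namespace IsSpherePair

variable {q : ℝ} {n : ℕ} {A : Type*} [Ring A] [Algebra ℂ A] {x v : Fin (n + 1) → A}

theorem tail_zero (h : IsSpherePair q x v) : tailSum (fun l => x l * v l) 0 = 1 := by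
  rw [tailSum_zero, h.norm]

theorem x_mul_v (i : Fin (n + 1)) : x i * v i =
    tailSum (fun l => x l * v l) i - tailSum (fun l => x l * v l) (i + 1) := by
  rw [tailSum_eq, add_sub_cancel_right]

theorem v_mul_x (h : IsSpherePair q x v) (i : Fin (n + 1)) : v i * x i =
    tailSum (fun l => x l * v l) i - (q : ℂ) ^ 2 • tailSum (fun l => x l * v l) (i + 1) := by
  rw [h.vx, x_mul_v]
  module

theorem tail_mul_x (h : IsSpherePair q x v) {k : ℕ} {i : Fin (n + 1)} (hk : i < k) :
    tailSum (fun l => x l * v l) k * x i = (q : ℂ) ^ 2 • (x i * tailSum (fun l => x l * v l) k) := by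
  rw [tailSum, Finset.sum_mul, Finset.mul_sum, Finset.smul_sum]
  refine Finset.sum_congr rfl fun l hl => ?_
  have hl' : i < l := by
    simp only [Finset.mem_filter] at hl
    exact Fin.lt_def.2 (by omega)
  rw [mul_assoc, h.xv hl'.ne, mul_smul_comm, ← mul_assoc, h.xx hl', smul_mul_assoc, smul_smul,
    mul_assoc, sq]

theorem v_mul_tail (h : IsSpherePair q x v) {k : ℕ} {i : Fin (n + 1)} (hk : i < k) :
    v i * tailSum (fun l => x l * v l) k = (q : ℂ) ^ 2 • (tailSum (fun l => x l * v l) k * v i) := by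
  rw [tailSum, Finset.sum_mul, Finset.mul_sum, Finset.smul_sum]
  refine Finset.sum_congr rfl fun l hl => ?_
  have hl' : i < l := by
    simp only [Finset.mem_filter] at hl
    exact Fin.lt_def.2 (by omega)
  rw [← mul_assoc, h.xv hl'.ne', smul_mul_assoc, mul_assoc, h.vv hl', mul_smul_comm, smul_smul,
    mul_assoc, sq]

/-- For i ≥ k, moving x_i or v_i through the tail itself would meet the products with index i. The
complementary sum has only indices below k. -/
theorem tail_eq_one_sub (h : IsSpherePair q x v) (k : ℕ) : tailSum (fun l => x l * v l) k =
    1 - ∑ l ∈ Finset.univ.filter (fun l : Fin (n + 1) => ¬ k ≤ (l : ℕ)), x l * v l := by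
  rw [← h.norm, ← Finset.sum_filter_add_sum_filter_not Finset.univ
    (fun l : Fin (n + 1) => k ≤ (l : ℕ)), add_sub_cancel_right]
  rfl

theorem commute_tail_x (h : IsSpherePair q x v) {k : ℕ} {i : Fin (n + 1)} (hk : k ≤ i) :
    Commute (tailSum (fun l => x l * v l) k) (x i) := by
  rw [h.tail_eq_one_sub]
  refine (Commute.one_left _).sub_left (Commute.sum_left _ _ _ fun l hl => ?_)
  have hl' : l < i := by
    simp only [Finset.mem_filter] at hl
    exact Fin.lt_def.2 (by omega)
  rw [Commute, SemiconjBy, mul_assoc, h.xv hl'.ne', mul_smul_comm, ← mul_assoc (x i), h.xx hl',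
    smul_mul_assoc, mul_assoc]

theorem commute_tail_v (h : IsSpherePair q x v) {k : ℕ} {i : Fin (n + 1)} (hk : k ≤ i) :
    Commute (tailSum (fun l => x l * v l) k) (v i) := by
  rw [h.tail_eq_one_sub]
  refine (Commute.one_left _).sub_left (Commute.sum_left _ _ _ fun l hl => ?_)
  have hl' : l < i := by
    simp only [Finset.mem_filter] at hl
    exact Fin.lt_def.2 (by omega)
  rw [Commute, SemiconjBy, mul_assoc, h.vv hl', mul_smul_comm, ← mul_assoc (v i), h.xv hl'.ne,
    smul_mul_assoc, mul_assoc]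

theorem commute_tail_tail (h : IsSpherePair q x v) (k m : ℕ) :
    Commute (tailSum (fun l => x l * v l) k) (tailSum (fun l => x l * v l) m) := by
  refine Commute.sum_right _ _ _ fun l _ => ?_
  rcases le_or_gt k l with hl | hl
  · exact (h.commute_tail_x hl).mul_right (h.commute_tail_v hl)
  · rw [Commute, SemiconjBy, ← mul_assoc, h.tail_mul_x hl, mul_assoc, h.v_mul_tail hl,
      smul_mul_assoc, mul_smul_comm, mul_assoc]

theorem skewCommute_tail_x (h : IsSpherePair q x v) (hq : q ≠ 0) (k : ℕ) (i : Fin (n + 1)) :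
    SkewCommute (tailSum (fun l => x l * v l) k) (x i) := by
  rcases le_or_gt k i with hi | hi
  · exact (h.commute_tail_x hi).skewCommute
  · exact ⟨_, pow_ne_zero 2 (by exact_mod_cast hq), h.tail_mul_x hi⟩

theorem skewCommute_tail_v (h : IsSpherePair q x v) (hq : q ≠ 0) (k : ℕ) (i : Fin (n + 1)) :
    SkewCommute (tailSum (fun l => x l * v l) k) (v i) := by
  rcases le_or_gt k i with hi | hi
  · exact (h.commute_tail_v hi).skewCommute
  · exact SkewCommute.symm ⟨_, pow_ne_zero 2 (by exact_mod_cast hq), h.v_mul_tail hi⟩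

theorem skewCommute_x_x (h : IsSpherePair q x v) (hq : q ≠ 0) {i j : Fin (n + 1)} (hij : j ≠ i) :
    SkewCommute (x i) (x j) := by
  have hq' : (q : ℂ) ≠ 0 := by exact_mod_cast hq
  rcases lt_or_gt_of_ne hij with hij | hij
  · exact ⟨q, hq', h.xx hij⟩
  · exact SkewCommute.symm ⟨q, hq', h.xx hij⟩

theorem skewCommute_v_v (h : IsSpherePair q x v) (hq : q ≠ 0) {i j : Fin (n + 1)} (hij : j ≠ i) :
    SkewCommute (v i) (v j) := by
  have hq' : (q : ℂ) ≠ 0 := by exact_mod_cast hq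
  rcases lt_or_gt_of_ne hij with hij | hij
  · exact SkewCommute.symm ⟨q, hq', h.vv hij⟩
  · exact ⟨q, hq', h.vv hij⟩

theorem skewCommute_v_x (h : IsSpherePair q x v) (hq : q ≠ 0) {i j : Fin (n + 1)} (hij : j ≠ i) :
    SkewCommute (v i) (x j) :=
  ⟨q, by exact_mod_cast hq, h.xv hij⟩

variable (x v) in
/-- The monomials in the tails and in the generators. -/
def mon (l : Fin n → ℕ) (γ : Fin (n + 1) → ℤ) : A :=
  fprod (fun k : Fin n => tailSum (fun l => x l * v l) (k + 1) ^ l k) *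
    fprod fun i => wpow (x i) (v i) (γ i)

variable (x v) in
/-- The span of the monomials. -/
def monSpan : Submodule ℂ A :=
  Submodule.span ℂ (Set.range fun p : (Fin n → ℕ) × (Fin (n + 1) → ℤ) => mon x v p.1 p.2)

theorem mon_mem (l : Fin n → ℕ) (γ : Fin (n + 1) → ℤ) : mon x v l γ ∈ monSpan x v :=
  Submodule.subset_span ⟨(l, γ), rfl⟩

theorem tail_mul_mon_mem (h : IsSpherePair q x v) {k : ℕ} (hk : k ≤ n + 1) (l : Fin n → ℕ)
    (γ : Fin (n + 1) → ℤ) : tailSum (fun l => x l * v l) k * mon x v l γ ∈ monSpan x v := by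
  rcases Nat.eq_zero_or_pos k with rfl | hk0
  · rw [h.tail_zero, one_mul]
    exact mon_mem _ _
  obtain ⟨k, rfl⟩ := Nat.exists_eq_succ_of_ne_zero hk0.ne'
  rcases Nat.lt_or_ge k n with hkn | hkn
  · obtain ⟨c, -, hc⟩ := exists_mul_fprod (z := tailSum (fun l => x l * v l) (k + 1))
      (fun k : Fin n => tailSum (fun l => x l * v l) (k + 1) ^ l k) ⟨k, hkn⟩ fun j _ =>
        ((h.commute_tail_tail _ _).pow_right _).skewCommute
    rw [mon, ← mul_assoc, Nat.succ_eq_add_one, hc, smul_mul_assoc]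
    refine Submodule.smul_mem _ _ ?_
    convert mon_mem (Function.update l ⟨k, hkn⟩ (l ⟨k, hkn⟩ + 1)) γ using 1
    rw [mon]
    congr 2
    ext j
    by_cases hj : j = ⟨k, hkn⟩
    · subst hj
      simp [pow_succ']
    · rw [Function.update_of_ne hj, Function.update_of_ne hj]
  · have : k = n := by omega
    subst this
    rw [Nat.succ_eq_add_one, tailSum_self, zero_mul]
    exact zero_mem _

/-- Up to scalars, `z` passes everything except the i-th power. There it shifts the exponent and may
leave a combination of two tails, which return to the tail part of the monomial at the cost of
another scalar. -/
theorem mul_mon_mem (h : IsSpherePair q x v) (hq : q ≠ 0) (i : Fin (n + 1)) {z : A} {γ' : ℤ} {c : ℂ}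
    (l : Fin n → ℕ) (γ : Fin (n + 1) → ℤ)
    (hz : ∀ k, SkewCommute z (tailSum (fun l => x l * v l) k))
    (hzj : ∀ j, j ≠ i → SkewCommute z (wpow (x j) (v j) (γ j)))
    (hzi : z * wpow (x i) (v i) (γ i) = wpow (x i) (v i) γ' ∨ z * wpow (x i) (v i) (γ i) =
      (tailSum (fun l => x l * v l) i - c • tailSum (fun l => x l * v l) (i + 1)) *
        wpow (x i) (v i) γ') : z * mon x v l γ ∈ monSpan x v := by
  obtain ⟨c₁, -, hc₁⟩ := SkewCommute.fprod_right (z := z)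
    (g := fun k : Fin n => tailSum (fun l => x l * v l) (k + 1) ^ l k) fun k => (hz _).pow_right _
  obtain ⟨c₂, -, hc₂⟩ := exists_mul_fprod (z := z) (fun i => wpow (x i) (v i) (γ i)) i hzj
  rw [mon, ← mul_assoc, hc₁, smul_mul_assoc, mul_assoc, hc₂, mul_smul_comm]
  refine Submodule.smul_mem _ _ (Submodule.smul_mem _ _ ?_)
  have hup : Function.update (fun i => wpow (x i) (v i) (γ i)) i (wpow (x i) (v i) γ') =
      fun j => wpow (x j) (v j) (Function.update γ i γ' j) := by
    ext j
    by_cases hj : j = i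
    · subst hj
      simp
    · rw [Function.update_of_ne hj, Function.update_of_ne hj]
  rcases hzi with hzi | hzi
  · rw [hzi, hup]
    exact mon_mem _ _
  · have key : ∀ k ≤ n + 1, fprod (fun k : Fin n => tailSum (fun l => x l * v l) (k + 1) ^ l k) *
        fprod (Function.update (fun i => wpow (x i) (v i) (γ i)) i
          (tailSum (fun l => x l * v l) k * wpow (x i) (v i) γ')) ∈ monSpan x v := by
      intro k hk
      obtain ⟨c₃, h₃, hc₃⟩ := exists_mul_fprod (z := tailSum (fun l => x l * v l) k)
        (fun j => wpow (x j) (v j) (Function.update γ i γ' j)) i fun j _ =>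
          (h.skewCommute_tail_x hq _ _).wpow_right (h.skewCommute_tail_v hq _ _) _
      obtain ⟨c₄, -, hc₄⟩ := SkewCommute.symm (SkewCommute.fprod_right
        (z := tailSum (fun l => x l * v l) k)
        (g := fun k : Fin n => tailSum (fun l => x l * v l) (k + 1) ^ l k) fun k' =>
          ((h.commute_tail_tail _ _).pow_right _).skewCommute)
      rw [← hup, Function.update_idem, Function.update_self] at hc₃
      rw [← inv_smul_eq_iff₀ h₃] at hc₃
      rw [← hc₃, mul_smul_comm, ← mul_assoc, hc₄, smul_mul_assoc, mul_assoc, hup]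
      exact Submodule.smul_mem _ _ (Submodule.smul_mem _ _ (h.tail_mul_mon_mem hk _ _))
    rw [hzi, sub_mul, smul_mul_assoc, fprod_update_sub, fprod_update_smul, mul_sub, mul_smul_comm]
    exact sub_mem (key _ (by omega)) (Submodule.smul_mem _ _ (key _ (by omega)))

/-- The span contains 1 and is stable under left multiplication by the generators. -/
theorem monSpan_eq_top (h : IsSpherePair q x v) (hq : q ≠ 0)
    (hgen : Algebra.adjoin ℂ (Set.range x ∪ Set.range v) = ⊤) : monSpan x v = ⊤ := by
  have key : ∀ a : A, ∀ m ∈ monSpan x v, a * m ∈ monSpan x v := by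
    intro a
    have ha : a ∈ Algebra.adjoin ℂ (Set.range x ∪ Set.range v) := hgen ▸ Algebra.mem_top
    induction ha using Algebra.adjoin_induction with
    | mem a ha =>
      intro m hm
      refine map_mem_of_mem_span (LinearMap.mulLeft ℂ a) ?_ hm
      rintro _ ⟨⟨l, γ⟩, rfl⟩
      rw [LinearMap.mulLeft_apply]
      obtain ⟨i, rfl⟩ | ⟨i, rfl⟩ := ha
      · refine h.mul_mon_mem hq i (γ' := γ i + 1) (c := 1) l γ
          (fun k => (h.skewCommute_tail_x hq k i).symm)
          (fun j hj => (h.skewCommute_x_x hq hj).wpow_right (h.skewCommute_v_x hq hj.symm).symm _) ?_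
        rw [one_smul, ← x_mul_v]
        exact mul_wpow _
      · refine h.mul_mon_mem hq i (γ' := γ i - 1) (c := (q : ℂ) ^ 2) l γ
          (fun k => (h.skewCommute_tail_v hq k i).symm)
          (fun j hj => (h.skewCommute_v_x hq hj).wpow_right (h.skewCommute_v_v hq hj) _) ?_
        rw [← h.v_mul_x]
        exact mul_wpow' _
    | algebraMap c =>
      intro m hm
      rw [← Algebra.smul_def]
      exact Submodule.smul_mem _ _ hm
    | add a b _ _ ha hb =>
      intro m hm
      rw [add_mul]
      exact add_mem (ha m hm) (hb m hm)
    | mul a b _ _ ha hb =>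
      intro m hm
      rw [mul_assoc]
      exact ha _ (hb m hm)
  refine eq_top_iff.2 fun a _ => ?_
  have h1 : mon x v 0 0 = 1 := by
    simp only [mon, Pi.zero_apply, pow_zero]
    have : wpow (x 0) (v 0) 0 = 1 := pow_zero _
    have h' : ∀ i, wpow (x i) (v i) 0 = 1 := fun i => pow_zero _
    simp [fprod, h']
  have := key a 1 (h1 ▸ mon_mem 0 0)
  rwa [mul_one] at this

end IsSpherePair

/-! ### Operators with leading terms -/

section Leading

variable {L M : Type*} [AddCommGroup L] [AddCommGroup M] [Module ℂ M] (e : Module.Basis L ℂ M)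
  (ht : L →+ ℤ)

/-- The span of the basis vectors of height more than `h`. -/
def above (h : ℤ) : Submodule ℂ M := Submodule.span ℂ (e '' {l | h < ht l})

/-- An operator which translates the basis vectors by `d`, up to nonzero factors and terms of
larger height. -/
def IsLeading (f : Module.End ℂ M) (d : L) : Prop :=
  ∀ l, ∃ c : ℂ, c ≠ 0 ∧ f (e l) - c • e (l + d) ∈ above e ht (ht (l + d))

variable {e ht}

theorem mem_above {h : ℤ} {l : L} (hl : h < ht l) : e l ∈ above e ht h :=
  Submodule.subset_span ⟨l, hl, rfl⟩

theorem above_mono {h h' : ℤ} (hh : h ≤ h') : above e ht h' ≤ above e ht h :=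
  Submodule.span_mono (Set.image_mono fun _ hl => lt_of_le_of_lt hh hl)

theorem IsShift.isLeading {f : Module.End ℂ M} {d : L} (hf : IsShift e f d) :
    IsLeading e ht f d := by
  intro l
  obtain ⟨c, hc, h⟩ := hf l
  exact ⟨c, hc, by rw [h, sub_self]; exact zero_mem _⟩

theorem IsLeading.map_above {f : Module.End ℂ M} {d : L} (hf : IsLeading e ht f d) {h : ℤ} {m : M}
    (hm : m ∈ above e ht h) : f m ∈ above e ht (h + ht d) := by
  refine map_mem_of_mem_span f ?_ hm
  rintro _ ⟨l, hl, rfl⟩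
  obtain ⟨c, -, hc⟩ := hf l
  have hl' : h + ht d < ht (l + d) := by
    rw [map_add]
    exact add_lt_add_left hl _
  rw [← sub_add_cancel (f (e l)) (c • e (l + d))]
  exact add_mem (above_mono hl'.le hc) (Submodule.smul_mem _ _ (mem_above hl'))

theorem IsLeading.one : IsLeading e ht (1 : Module.End ℂ M) 0 := IsShift.one.isLeading

theorem IsLeading.mul {f g : Module.End ℂ M} {d d' : L} (hf : IsLeading e ht f d)
    (hg : IsLeading e ht g d') : IsLeading e ht (f * g) (d + d') := by
  intro l
  obtain ⟨c, hc, h⟩ := hg l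
  obtain ⟨c', hc', h'⟩ := hf (l + d')
  refine ⟨c * c', mul_ne_zero hc hc', ?_⟩
  have h1 := hf.map_above h
  rw [map_sub, map_smul, ← map_add, add_assoc, add_comm d'] at h1
  rw [add_assoc, add_comm d'] at h'
  have : (f * g) (e l) - (c * c') • e (l + (d + d')) = (f (g (e l)) - c • f (e (l + d'))) +
      c • (f (e (l + d')) - c' • e (l + (d + d'))) := by
    rw [Module.End.mul_apply]
    module
  rw [this]
  exact add_mem h1 (Submodule.smul_mem _ _ h')

theorem IsLeading.pow {f : Module.End ℂ M} {d : L} (hf : IsLeading e ht f d) (k : ℕ) :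
    IsLeading e ht (f ^ k) (k • d) := by
  induction k with
  | zero => rw [pow_zero, zero_smul]; exact IsLeading.one
  | succ k ih => rw [pow_succ, succ_nsmul]; exact ih.mul hf

theorem IsLeading.fprod {m : ℕ} {f : Fin m → Module.End ℂ M} {d : Fin m → L}
    (hf : ∀ i, IsLeading e ht (f i) (d i)) : IsLeading e ht (fprod f) (∑ i, d i) := by
  induction m with
  | zero => simpa [QBundle.fprod] using IsLeading.one
  | succ m ih =>
    rw [fprod_succ, Fin.sum_univ_succ]
    exact (hf 0).mul (ih fun i => hf i.succ)

/-- For negative k the degree is (−k)(d' − d), written so that d has the coefficient k in both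
cases. -/
theorem IsLeading.wpow {f g : Module.End ℂ M} {d d' : L} (hf : IsLeading e ht f d)
    (hg : IsLeading e ht g (d' - d)) (k : ℤ) :
    IsLeading e ht (wpow f g k) (k • d + (-k).toNat • d') := by
  cases k with
  | ofNat k =>
    have : (-Int.ofNat k).toNat = 0 := by simp
    rw [this, zero_smul, add_zero, Int.ofNat_eq_natCast, natCast_zsmul]
    exact hf.pow k
  | negSucc k =>
    have : (-Int.negSucc k).toNat = k + 1 := by simp
    rw [this, negSucc_zsmul, neg_add_eq_sub, ← nsmul_sub]
    exact hg.pow (k + 1)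

theorem repr_eq_zero_of_mem_above {h : ℤ} {m : M} (hm : m ∈ above e ht h) {l : L} (hl : ht l ≤ h) :
    e.repr m l = 0 := by
  have := map_mem_of_mem_span (T := ⊥) (e.coord l) (fun y hy => ?_) hm
  · simpa using this
  · obtain ⟨l', hl', rfl⟩ := hy
    rw [Set.mem_ofPred_eq] at hl'
    have : l ≠ l' := fun hh => by subst hh; omega
    simp [this]

/-- Operators with different leading terms are linearly independent. -/
theorem eq_zero_of_isLeading {ι : Type*} {f : ι → Module.End ℂ M} {d : ι → L}
    (hf : ∀ i, IsLeading e ht (f i) (d i)) (hd : Function.Injective d) (a : ι →₀ ℂ)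
    (h : a.sum (fun i c => c • f i (e 0)) = 0) : a = 0 := by
  by_contra ha
  -- Look at the coefficient at a leading degree of minimal height: remainders lie strictly above
  -- the height of their own leading term, and other leading terms sit at other basis vectors.
  obtain ⟨i, hi, hmin⟩ := a.support.exists_min_image (fun i => ht (d i))
    (Finsupp.support_nonempty_iff.2 ha)
  have h1 := congrArg (fun m => e.repr m (d i)) h
  simp only [Finsupp.sum, map_sum, map_smul, Finsupp.coe_finsetSum, Finset.sum_apply,
    Finsupp.smul_apply, map_zero, Finsupp.zero_apply] at h1
  have key : ∀ j, ∃ c : ℂ, c ≠ 0 ∧ (ht (d i) ≤ ht (d j) →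
      e.repr (f j (e 0)) (d i) = c * Finsupp.single (d j) 1 (d i)) := by
    intro j
    obtain ⟨c, hc, h⟩ := hf j 0
    rw [zero_add] at h
    refine ⟨c, hc, fun hij => ?_⟩
    have := repr_eq_zero_of_mem_above h hij
    rw [map_sub, Finsupp.sub_apply, sub_eq_zero] at this
    rw [this, map_smul, e.repr_self, Finsupp.smul_apply, smul_eq_mul]
  rw [Finset.sum_eq_single i] at h1
  · obtain ⟨c, hc, h⟩ := key i
    rw [h le_rfl, Finsupp.single_eq_same, mul_one, smul_eq_mul] at h1
    exact mul_ne_zero (Finsupp.mem_support_iff.1 hi) hc h1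
  · intro j hj hji
    obtain ⟨c, -, h⟩ := key j
    rw [h (hmin j hj), Finsupp.single_eq_of_ne (fun hh => hji (hd hh).symm), mul_zero, smul_zero]
  · exact fun hh => absurd hi hh

end Leading

/-! ### Faithfulness of the representations of the sphere algebra -/

theorem map_fprod {A B : Type*} [Ring A] [Algebra ℂ A] [Ring B] [Algebra ℂ B] (φ : A →ₐ[ℂ] B)
    {m : ℕ} (g : Fin m → A) : φ (fprod g) = fprod fun i => φ (g i) := by
  rw [fprod, fprod, map_list_prod, List.map_ofFn]
  rfl

theorem map_wpow {A B : Type*} [Ring A] [Algebra ℂ A] [Ring B] [Algebra ℂ B] (φ : A →ₐ[ℂ] B)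
    (a b : A) (k : ℤ) : φ (wpow a b k) = wpow (φ a) (φ b) k := by
  cases k with
  | ofNat k => exact map_pow φ a k
  | negSucc k => exact map_pow φ b _

section

variable {q : ℝ} {n : ℕ} {A : Type*} [Ring A] [Algebra ℂ A] {x v : Fin (n + 1) → A}
  {L M : Type*} [AddCommGroup L] [AddCommGroup M] [Module ℂ M] {e : Module.Basis L ℂ M}
  {ht : L →+ ℤ} {φ : A →ₐ[ℂ] Module.End ℂ M} {X B : Fin (n + 1) → L}

/-- Both T_i and T_{i+1} map basis vectors into the range of x_i. Cancelling the injective x_i from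
x_i v_i = T_i − T_{i+1} leaves the contribution of T_i as the lower, leading term. -/
theorem isLeading_of_isShift (hx : ∀ i, IsShift e (φ (x i)) (X i))
    (hB : ∀ k : Fin (n + 1), IsShift e (φ (tailSum (fun l => x l * v l) k)) (B k))
    (hht : StrictMono fun k => ht (B k)) (i : Fin (n + 1)) :
    IsLeading e ht (φ (v i)) (B i - X i) := by
  have hlift : ∀ (k : Fin (n + 1)) l, ∃ c : ℂ, c ≠ 0 ∧
      φ (tailSum (fun l => x l * v l) k) (e l) = φ (x i) (c • e (l + (B k - X i))) := by
    intro k l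
    obtain ⟨c, hc, h⟩ := hB k l
    obtain ⟨c', hc', h'⟩ := hx i (l + (B k - X i))
    refine ⟨c / c', div_ne_zero hc hc', ?_⟩
    rw [map_smul, h', h, smul_smul, div_mul_cancel₀ _ hc', add_assoc, sub_add_cancel]
  intro l
  obtain ⟨c, hc, h⟩ := hlift i l
  refine ⟨c, hc, ?_⟩
  have h1 : φ (x i) (φ (v i) (e l)) = φ (tailSum (fun l => x l * v l) i) (e l) -
      φ (tailSum (fun l => x l * v l) (i + 1)) (e l) := by
    rw [← Module.End.mul_apply, ← map_mul, IsSpherePair.x_mul_v, map_sub, LinearMap.sub_apply]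
  cases i using Fin.lastCases with
  | last =>
    rw [Fin.val_last, tailSum_self, map_zero, LinearMap.zero_apply, sub_zero] at h1
    rw [Fin.val_last] at h
    rw [(hx _).injective (h1.trans h), sub_self]
    exact zero_mem _
  | cast i =>
    obtain ⟨c', -, h'⟩ := hlift i.succ l
    have h2 : φ (x i.castSucc) (φ (v i.castSucc) (e l)) = φ (x i.castSucc)
        (c • e (l + (B i.castSucc - X i.castSucc)) - c' • e (l + (B i.succ - X i.castSucc))) := by
      rw [map_sub, ← h, ← h', h1]
      rfl
    rw [(hx _).injective h2, sub_sub_cancel_left]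
    refine neg_mem (Submodule.smul_mem _ _ (mem_above ?_))
    have : ht (B i.castSucc) < ht (B i.succ) := hht Fin.castSucc_lt_succ
    simp only [map_add, map_sub]
    omega

/-- A representation of the sphere algebra by weighted shifts has a separating vector. -/
theorem IsSpherePair.eq_zero_of_map_eq_zero (h : IsSpherePair q x v) (hq : q ≠ 0)
    (hgen : Algebra.adjoin ℂ (Set.range x ∪ Set.range v) = ⊤)
    (hx : ∀ i, IsShift e (φ (x i)) (X i))
    (hB : ∀ k : Fin (n + 1), IsShift e (φ (tailSum (fun l => x l * v l) k)) (B k))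
    (hht : StrictMono fun k => ht (B k)) (hB0 : B 0 = 0)
    (indep : ∀ (γ : Fin (n + 1) → ℤ) (μ : Fin n → ℤ),
      ∑ i, γ i • X i + ∑ k, μ k • B k.succ = 0 → γ = 0 ∧ μ = 0)
    {a : A} (ha : φ a (e 0) = 0) : a = 0 := by
  have hv := isLeading_of_isShift (ht := ht) hx hB hht
  let d : (Fin n → ℕ) × (Fin (n + 1) → ℤ) → L := fun p =>
    ∑ k, p.1 k • B k.succ + ∑ i, (p.2 i • X i + (-p.2 i).toNat • B i)
  have hmon : ∀ p : (Fin n → ℕ) × (Fin (n + 1) → ℤ),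
      IsLeading e ht (φ (mon x v p.1 p.2)) (d p) := by
    intro p
    rw [mon, map_mul, map_fprod, map_fprod]
    refine IsLeading.mul (IsLeading.fprod fun k => ?_) (IsLeading.fprod fun i => ?_)
    · rw [map_pow]
      have := (hB k.succ).isLeading (ht := ht)
      exact this.pow _
    · rw [map_wpow]
      exact (hx i).isLeading.wpow (hv i) _
  have hd : Function.Injective d := by
    rintro ⟨l, γ⟩ ⟨l', γ'⟩ hp
    have hp' := sub_eq_zero.2 hp
    simp only [d, Finset.sum_add_distrib, Fin.sum_univ_succ (f := fun i => _ • B i), hB0,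
      smul_zero, zero_add, ← natCast_zsmul] at hp'
    -- The X-coordinates of a degree determine γ. Then the contributions of negative exponents
    -- agree, and the B-coordinates determine the powers of the tails.
    have := indep (γ - γ') (fun k => (l k + (-γ k.succ).toNat) - (l' k + (-γ' k.succ).toNat)) (by
      rw [← hp']
      simp only [Pi.sub_apply, sub_smul, add_smul, Finset.sum_sub_distrib, Finset.sum_add_distrib]
      abel)
    have h1 := sub_eq_zero.1 this.1
    subst h1
    refine Prod.ext (funext fun k => ?_) rfl
    have := congrFun this.2 k
    simp only [Pi.zero_apply] at this
    have h3 : (l k : ℤ) = l' k := by linarith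
    exact_mod_cast h3
  have hmem : a ∈ monSpan x v := h.monSpan_eq_top hq hgen ▸ Submodule.mem_top
  obtain ⟨f, rfl⟩ := (Finsupp.mem_span_range_iff_exists_finsupp).1 hmem
  have : f = 0 := by
    refine eq_zero_of_isLeading hmon hd f ?_
    rw [← ha, map_finsuppSum, Finsupp.sum, Finsupp.sum, LinearMap.sum_apply]
    simp only [map_smul, LinearMap.smul_apply]
  rw [this, Finsupp.sum_zero_index]

end

namespace Sphere

variable {q : ℝ}

/-- More than injectivity: the vector `R.e 0` alone separates the sphere, so the sphere algebra can
be recovered from its orbit. -/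
theorem eq_zero_of_shiftRep (hq : q ≠ 0) (n : ℕ) (R : Uq.ShiftRep hq n) {a : Sphere q (n + 1)}
    (ha : R.ρ (toUq hq n a) (R.e 0) = 0) : a = 0 := by
  have hq' : (q : ℂ) ≠ 0 := by exact_mod_cast hq
  have hpair := (isSphereFamily hq (n + 1)).isSpherePair hq
  have hx : ∀ k : Fin (n + 1), toUq hq n ((q : ℂ)⁻¹ ^ (k : ℕ) • v q k.rev) = Uq.t q 0 k := by
    intro k
    rw [map_smul, toUq_v, Fin.rev_rev, smul_smul, ← mul_pow, inv_mul_cancel₀ hq', one_pow, one_smul]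
  have hv : ∀ k : Fin (n + 1), toUq hq n ((q : ℂ)⁻¹ ^ (k : ℕ) • x q k.rev) = Uq.s hq k 0 := by
    intro k
    rw [map_smul, toUq_x, Fin.rev_rev, smul_smul, ← mul_pow, inv_mul_cancel₀ hq', one_pow, one_smul]
  refine hpair.eq_zero_of_map_eq_zero (φ := R.ρ.comp (toUq hq n)) (e := R.e) (X := R.X) (B := R.B)
    (ht := R.ht) hq ?_ (fun i => ?_) (fun k => ?_) R.ht_B R.B_zero R.indep ha
  · refine eq_top_iff.2 ?_
    rw [← adjoin_eq_top]
    have hmem : ∀ {y : Fin (n + 1) → Sphere q (n + 1)} {S : Subalgebra ℂ (Sphere q (n + 1))},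
        (∀ k : Fin (n + 1), (q : ℂ)⁻¹ ^ (k : ℕ) • y k.rev ∈ S) → ∀ k, y k ∈ S := by
      intro y S hy k
      have := S.smul_mem (hy k.rev) ((q : ℂ) ^ (k.rev : ℕ))
      rwa [smul_smul, ← mul_pow, mul_inv_cancel₀ hq', one_pow, one_smul, Fin.rev_rev] at this
    refine Algebra.adjoin_le (Set.union_subset ?_ ?_)
    · rintro _ ⟨k, rfl⟩
      exact hmem (fun k => Algebra.subset_adjoin (Or.inl ⟨k, rfl⟩)) k
    · rintro _ ⟨k, rfl⟩
      exact hmem (fun k => Algebra.subset_adjoin (Or.inr ⟨k, rfl⟩)) k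
  · rw [AlgHom.comp_apply, hx]
    exact R.isShift_t i
  · rw [AlgHom.comp_apply]
    convert R.isShift_tail k
    rw [Uq.tail, tailSum, tailSum, map_sum]
    simp only [map_mul, hx, hv]

theorem toUq_injective (hq : q ≠ 0) (n : ℕ) : Function.Injective (toUq hq n) := by
  obtain ⟨R⟩ := Uq.nonempty_shiftRep hq n
  refine (injective_iff_map_eq_zero _).2 fun a ha => eq_zero_of_shiftRep hq n R ?_
  rw [ha, map_zero, LinearMap.zero_apply]

end Sphere

/-! ### Denominators of coinvariant elements -/

namespace Uq

variable {q : ℝ} {n : ℕ} {hq : q ≠ 0}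

open Filter

theorem tail_mem_sphereSubalgebra (hq : q ≠ 0) (n k : ℕ) : tail hq n k ∈ sphereSubalgebra hq n := by
  rw [tail, tailSum]
  exact sum_mem fun _ _ => mul_mem (t_mem_sphereSubalgebra hq _) (s_mem_sphereSubalgebra hq _)

namespace ShiftRep

variable (R : ShiftRep hq n)

/-- The degrees of the shifts. -/
def degrees : Set R.L := Set.range R.X ∪ Set.range R.B

/-- A strictly positive degree. -/
def posDegree : R.L := ∑ i, R.X i + ∑ k, R.B k

/-- The projection to the basis vectors in the subgroup generated by the degrees. -/
def proj : Module.End ℂ R.M := by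
  classical
  exact R.e.constr ℂ fun l => if l ∈ AddSubgroup.closure R.degrees then R.e l else 0

theorem proj_of_mem {l : R.L} (hl : l ∈ AddSubgroup.closure R.degrees) :
    R.proj (R.e l) = R.e l := by
  rw [proj, Module.Basis.constr_basis, if_pos hl]

theorem proj_of_notMem {l : R.L} (hl : l ∉ AddSubgroup.closure R.degrees) :
    R.proj (R.e l) = 0 := by
  rw [proj, Module.Basis.constr_basis, if_neg hl]

theorem commute_proj_of_isShift {f : Module.End ℂ R.M} {d : R.L}
    (hd : d ∈ AddSubgroup.closure R.degrees) (hf : IsShift R.e f d) : Commute R.proj f := by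
  refine R.e.ext fun l => ?_
  obtain ⟨c, -, h⟩ := hf l
  rw [Module.End.mul_apply, Module.End.mul_apply, h, map_smul]
  by_cases hl : l ∈ AddSubgroup.closure R.degrees
  · rw [R.proj_of_mem hl, R.proj_of_mem (add_mem hl hd), h]
  · rw [R.proj_of_notMem hl, R.proj_of_notMem (fun hh => hl ((add_mem_cancel_right hd).1 hh)),
      map_zero, smul_zero]

theorem X_mem (i : Fin (n + 1)) : R.X i ∈ AddSubgroup.closure R.degrees :=
  AddSubgroup.subset_closure (Or.inl ⟨i, rfl⟩)

theorem B_mem (i : Fin (n + 1)) : R.B i ∈ AddSubgroup.closure R.degrees :=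
  AddSubgroup.subset_closure (Or.inr ⟨i, rfl⟩)

theorem commute_proj_tail {k : ℕ} (hk : k ≤ n + 1) : Commute R.proj (R.ρ (tail hq n k)) := by
  rcases Nat.lt_or_eq_of_le hk with hk | rfl
  · exact R.commute_proj_of_isShift (R.B_mem ⟨k, hk⟩) (R.isShift_tail ⟨k, hk⟩)
  · rw [tail, tailSum_self, map_zero]
    exact Commute.zero_right _

/-- The elements s j 0 are not shifts. But t 0 j s j 0 is a difference of tails and commutes with
the projection, and the injective t 0 j can be cancelled. -/
theorem commute_proj {a : Uq q (n + 1)} (ha : a ∈ sphereSubalgebra hq n) :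
    Commute R.proj (R.ρ a) := by
  have ht : ∀ j, Commute R.proj (R.ρ (t q 0 j)) := fun j =>
    R.commute_proj_of_isShift (R.X_mem j) (R.isShift_t j)
  induction ha using Algebra.adjoin_induction with
  | mem a ha =>
    obtain ⟨j, rfl⟩ | ⟨j, rfl⟩ := ha
    · exact ht j
    · have h1 : t q 0 j * s hq j 0 = tail hq n j - tail hq n (j + 1) :=
        IsSpherePair.x_mul_v (x := fun j => t q 0 j) (v := fun j => s hq j 0) j
      have h2 : Commute R.proj (R.ρ (t q 0 j) * R.ρ (s hq j 0)) := by
        rw [← map_mul, h1, map_sub]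
        exact (R.commute_proj_tail j.2.le).sub_right (R.commute_proj_tail j.2)
      refine LinearMap.ext fun m => (R.isShift_t j).injective ?_
      have h3 := LinearMap.congr_fun h2.eq m
      have h4 := LinearMap.congr_fun (ht j).eq (R.ρ (s hq j 0) m)
      simp only [Module.End.mul_apply] at h3 h4 ⊢
      rw [← h4, h3]
  | algebraMap c => rw [AlgHom.commutes]; exact (Algebra.commutes c _).symm
  | add a b _ _ ha hb => rw [map_add]; exact ha.add_right hb
  | mul a b _ _ ha hb => rw [map_mul]; exact ha.mul_right hb

theorem exists_isShift {l : R.L} (hl : l ∈ AddSubmonoid.closure R.degrees) :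
    ∃ a ∈ sphereSubalgebra hq n, IsShift R.e (R.ρ a) l := by
  induction hl using AddSubmonoid.closure_induction with
  | mem l hl =>
    obtain ⟨j, rfl⟩ | ⟨j, rfl⟩ := hl
    · exact ⟨_, t_mem_sphereSubalgebra hq j, R.isShift_t j⟩
    · exact ⟨_, tail_mem_sphereSubalgebra hq n j, R.isShift_tail j⟩
  | zero => exact ⟨1, one_mem _, by rw [map_one]; exact IsShift.one⟩
  | add l l' _ _ h h' =>
    obtain ⟨a, ha, h⟩ := h
    obtain ⟨a', ha', h'⟩ := h'
    exact ⟨a' * a, mul_mem ha' ha, by rw [map_mul]; exact h'.mul h⟩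

/-- The linear map from the sphere algebra given by the vector of degree zero. -/
def orbit : sphereSubalgebra hq n →ₗ[ℂ] R.M :=
  LinearMap.applyₗ (R.e 0) ∘ₗ R.ρ.toLinearMap ∘ₗ (sphereSubalgebra hq n).val.toLinearMap

theorem orbit_apply (a : sphereSubalgebra hq n) : R.orbit a = R.ρ a (R.e 0) := rfl

theorem orbit_injective : Function.Injective R.orbit := by
  refine (injective_iff_map_eq_zero _).2 fun ⟨a, ha⟩ h => Subtype.ext ?_
  rw [← Sphere.range_toUq] at ha
  obtain ⟨y, rfl⟩ := ha
  have : y = 0 := Sphere.eq_zero_of_shiftRep hq n R h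
  subst this
  exact map_zero _

theorem mem_range_orbit {l : R.L} (hl : l ∈ AddSubmonoid.closure R.degrees) :
    R.e l ∈ LinearMap.range R.orbit := by
  obtain ⟨a, ha, h⟩ := R.exists_isShift hl
  obtain ⟨c, hc, h⟩ := h 0
  refine ⟨c⁻¹ • ⟨a, ha⟩, ?_⟩
  rw [map_smul, orbit_apply, h, zero_add, inv_smul_smul₀ hc]

theorem posDegree_sub_mem {l : R.L} (hl : l ∈ R.degrees) :
    R.posDegree - l ∈ AddSubmonoid.closure R.degrees := by
  have hX : ∀ i, R.X i ∈ AddSubmonoid.closure R.degrees := fun i =>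
    AddSubmonoid.subset_closure (Or.inl ⟨i, rfl⟩)
  have hB : ∀ i, R.B i ∈ AddSubmonoid.closure R.degrees := fun i =>
    AddSubmonoid.subset_closure (Or.inr ⟨i, rfl⟩)
  obtain ⟨i, rfl⟩ | ⟨i, rfl⟩ := hl
  · rw [posDegree, ← Finset.sum_erase_add _ _ (Finset.mem_univ i), add_right_comm,
      add_sub_cancel_right]
    exact add_mem (sum_mem fun i _ => hX i) (sum_mem fun i _ => hB i)
  · rw [posDegree, ← Finset.sum_erase_add _ R.B (Finset.mem_univ i), ← add_assoc,
      add_sub_cancel_right]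
    exact add_mem (sum_mem fun i _ => hX i) (sum_mem fun i _ => hB i)

theorem posDegree_mem : R.posDegree ∈ AddSubmonoid.closure R.degrees :=
  add_mem (sum_mem fun i _ => AddSubmonoid.subset_closure (Or.inl ⟨i, rfl⟩))
    (sum_mem fun i _ => AddSubmonoid.subset_closure (Or.inr ⟨i, rfl⟩))

theorem exists_nsmul_add_mem {d : R.L} (hd : d ∈ AddSubgroup.closure R.degrees) :
    ∃ N : ℕ, N • R.posDegree + d ∈ AddSubmonoid.closure R.degrees := by
  -- Including −d makes the claim stable under negation, as needed for induction over a subgroup.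
  suffices h : (∃ N : ℕ, N • R.posDegree + d ∈ AddSubmonoid.closure R.degrees) ∧
      ∃ N : ℕ, N • R.posDegree - d ∈ AddSubmonoid.closure R.degrees from h.1
  induction hd using AddSubgroup.closure_induction with
  | mem d hd =>
    exact ⟨⟨0, by rw [zero_smul, zero_add]; exact AddSubmonoid.subset_closure hd⟩,
      ⟨1, by rw [one_smul]; exact R.posDegree_sub_mem hd⟩⟩
  | zero =>
    exact ⟨⟨0, by rw [zero_smul, zero_add]; exact zero_mem _⟩,
      ⟨0, by rw [zero_smul, sub_zero]; exact zero_mem _⟩⟩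
  | add d d' _ _ h h' =>
    obtain ⟨⟨N, h1⟩, ⟨K, h2⟩⟩ := h
    obtain ⟨⟨N', h1'⟩, ⟨K', h2'⟩⟩ := h'
    exact ⟨⟨N + N', by rw [add_smul, add_add_add_comm]; exact add_mem h1 h1'⟩,
      ⟨K + K', by rw [add_smul, add_sub_add_comm]; exact add_mem h2 h2'⟩⟩
  | neg d _ h =>
    obtain ⟨⟨N, h1⟩, ⟨K, h2⟩⟩ := h
    exact ⟨⟨K, by rwa [← sub_eq_add_neg]⟩, ⟨N, by rwa [sub_neg_eq_add]⟩⟩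

theorem eventually_nsmul_add_mem {d : R.L} (hd : d ∈ AddSubgroup.closure R.degrees) :
    ∀ᶠ N : ℕ in atTop, N • R.posDegree + d ∈ AddSubmonoid.closure R.degrees := by
  obtain ⟨N, hN⟩ := R.exists_nsmul_add_mem hd
  filter_upwards [eventually_ge_atTop N] with K hK
  obtain ⟨m, rfl⟩ := Nat.exists_eq_add_of_le hK
  rw [add_smul, add_right_comm]
  exact add_mem hN (nsmul_mem R.posDegree_mem m)

/-- The projected action on a vector of large degree. -/
def deep (N : ℕ) : Uq q (n + 1) →ₗ[ℂ] R.M :=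
  R.proj ∘ₗ LinearMap.applyₗ (R.e (N • R.posDegree)) ∘ₗ R.ρ.toLinearMap

theorem deep_apply (N : ℕ) (p : Uq q (n + 1)) :
    R.deep N p = R.proj (R.ρ p (R.e (N • R.posDegree))) := rfl

theorem deep_mul {a : Uq q (n + 1)} (ha : a ∈ sphereSubalgebra hq n) (N : ℕ) (p : Uq q (n + 1)) :
    R.deep N (a * p) = R.ρ a (R.deep N p) := by
  rw [deep_apply, deep_apply, map_mul, Module.End.mul_apply]
  exact LinearMap.congr_fun (R.commute_proj ha).eq _

theorem deep_one (N : ℕ) : R.deep N 1 = R.e (N • R.posDegree) := by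
  rw [deep_apply, map_one, Module.End.one_apply]
  refine R.proj_of_mem (nsmul_mem ?_ N)
  exact (AddSubmonoid.closure_le.2 AddSubgroup.subset_closure :
    _ ≤ (AddSubgroup.closure R.degrees).toAddSubmonoid) R.posDegree_mem

/-- An element moves the vector of degree N·`posDegree` by finitely many translations independent of
N. Those inside the subgroup end in the monoid of degrees for large N, where the orbit reaches every
basis vector; the projection discards the others. -/
theorem eventually_deep_mem (p : Uq q (n + 1)) :
    ∀ᶠ N in atTop, R.deep N p ∈ LinearMap.range R.orbit := by
  obtain ⟨D, hD⟩ := R.isLocal p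
  have h : ∀ᶠ N : ℕ in atTop, ∀ d ∈ D, d ∈ AddSubgroup.closure R.degrees →
      N • R.posDegree + d ∈ AddSubmonoid.closure R.degrees := by
    refine (eventually_all_finset D).2 fun d _ => ?_
    by_cases hd : d ∈ AddSubgroup.closure R.degrees
    · filter_upwards [R.eventually_nsmul_add_mem hd] with N hN _ using hN
    · exact Eventually.of_forall fun N h => absurd h hd
  filter_upwards [h] with N hN
  rw [deep_apply]
  refine map_mem_of_mem_span R.proj ?_ (hD _)
  rintro _ ⟨_, ⟨d, hd, rfl⟩, rfl⟩
  by_cases hl : N • R.posDegree + d ∈ AddSubgroup.closure R.degrees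
  · rw [R.proj_of_mem hl]
    refine R.mem_range_orbit (hN d hd ?_)
    refine (add_mem_cancel_left (nsmul_mem ?_ N)).1 hl
    exact (AddSubmonoid.closure_le.2 AddSubgroup.subset_closure :
      _ ≤ (AddSubgroup.closure R.degrees).toAddSubmonoid) R.posDegree_mem
  · rw [R.proj_of_notMem hl]
    exact zero_mem _

/-- On a form uηw, linearity of E at w yields u · mul(η) · E(w) = 0. Only finitely many w occur in a
given form, so all large N serve. -/
theorem eventually_lTensor_eq_zero {ω : Uq q (n + 1) ⊗[ℂ] Uq q (n + 1)}
    (hω : ω ∈ horizontalForms (sphereSubalgebra hq n)) :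
    ∀ᶠ N in atTop, ∀ E : Module.End ℂ (Uq q (n + 1)),
      (∀ a ∈ sphereSubalgebra hq n, ∀ p, R.deep N p ∈ LinearMap.range R.orbit →
        E (a * p) = a * E p) → LinearMap.mul' ℂ _ (E.lTensor _ ω) = 0 := by
  induction hω using Submodule.span_induction with
  | mem ω hω =>
    obtain ⟨u, w, η, hη, rfl⟩ := hω
    filter_upwards [R.eventually_deep_mem w] with N hN E hE
    have key : ∀ η : sphereSubalgebra hq n ⊗[ℂ] sphereSubalgebra hq n,
        LinearMap.mul' ℂ _ (E.lTensor _ ((u ⊗ₜ[ℂ] (1 : Uq q (n + 1))) *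
          Algebra.TensorProduct.map (sphereSubalgebra hq n).val (sphereSubalgebra hq n).val η *
            ((1 : Uq q (n + 1)) ⊗ₜ[ℂ] w))) =
        u * (LinearMap.mul' ℂ (sphereSubalgebra hq n) η : sphereSubalgebra hq n) * E w := by
      intro η
      induction η using TensorProduct.induction_on with
      | zero => simp
      | tmul a b =>
        simp only [Algebra.TensorProduct.map_tmul, Algebra.TensorProduct.tmul_mul_tmul, one_mul,
          mul_one, LinearMap.lTensor_tmul, LinearMap.mul'_apply, Subalgebra.coe_val,
          MulMemClass.coe_mul]
        rw [hE b b.2 w hN]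
        noncomm_ring
      | add a b ha hb => simp only [map_add, mul_add, add_mul, ha, hb, AddMemClass.coe_add]
    rw [key, LinearMap.mem_ker.1 hη, ZeroMemClass.coe_zero, mul_zero, zero_mul]
  | zero => exact Eventually.of_forall fun N E _ => by simp
  | add ω ω' _ _ h h' =>
    filter_upwards [h, h'] with N hN hN' E hE
    rw [map_add, map_add, hN E hE, hN' E hE, add_zero]
  | smul c ω _ h =>
    filter_upwards [h] with N hN E hE
    rw [map_smul, map_smul, hN E hE, smul_zero]

end ShiftRep

/-- Finitely many coinvariant elements have a common right denominator in the sphere algebra. -/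
theorem exists_mul_mem_sphereSubalgebra (hq : q ≠ 0) (n : ℕ) (T : Finset (Uq q (n + 1)))
    (hT : ∀ b ∈ T, b ∈ coinvariants (coaction hq n)) :
    ∃ a ∈ sphereSubalgebra hq n, a ≠ 0 ∧ ∀ b ∈ T, b * a ∈ sphereSubalgebra hq n := by
  obtain ⟨R⟩ := nonempty_shiftRep hq n
  have h : ∀ᶠ N in atTop, ∀ b ∈ T, R.deep N b ∈ LinearMap.range R.orbit ∧
      ∀ E : Module.End ℂ (Uq q (n + 1)),
      (∀ a ∈ sphereSubalgebra hq n, ∀ p, R.deep N p ∈ LinearMap.range R.orbit →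
        E (a * p) = a * E p) → b * E 1 = E b := by
    refine (eventually_all_finset T).2 fun b hb => (R.eventually_deep_mem b).and ?_
    -- For coinvariant b this difference is in ker χ, hence horizontal over the sphere algebra;
    -- applying E to its second factor gives b E(1) = E(b).
    have hker : b ⊗ₜ[ℂ] (1 : Uq q (n + 1)) - (1 : Uq q (n + 1)) ⊗ₜ[ℂ] b ∈
        LinearMap.ker (bundleMap (coaction hq n)) := by
      have hb' : coaction hq n b = 1 ⊗ₜ[ℂ] b := hT b hb
      rw [LinearMap.mem_ker, map_sub, bundleMap_tmul, bundleMap_tmul, hb', map_one,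
        Algebra.TensorProduct.tmul_mul_tmul, mul_one, mul_one, one_mul, sub_self]
    filter_upwards [R.eventually_lTensor_eq_zero (ker_bundleMap_le hq hker)] with N hN E hE
    have := hN E hE
    rwa [map_sub, map_sub, LinearMap.lTensor_tmul, LinearMap.lTensor_tmul, LinearMap.mul'_apply,
      LinearMap.mul'_apply, one_mul, sub_eq_zero] at this
  obtain ⟨N, hN, h1⟩ := (h.and (R.eventually_deep_mem 1)).exists
  obtain ⟨g, hg⟩ : ∃ g : R.M →ₗ[ℂ] sphereSubalgebra hq n, ∀ a, g (R.orbit a) = a := by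
    obtain ⟨g, hg⟩ := R.orbit.exists_leftInverse_of_injective
      (eq_bot_iff.2 fun a ha => R.orbit_injective ((LinearMap.mem_ker.1 ha).trans (map_zero _).symm))
    exact ⟨g, fun a => LinearMap.congr_fun hg a⟩
  -- E returns the sphere element whose orbit vector is the projected image of p. It is linear over
  -- the sphere algebra wherever that vector lies in the orbit, since the algebra commutes with the
  -- projection.
  let E : Module.End ℂ (Uq q (n + 1)) := (sphereSubalgebra hq n).val.toLinearMap ∘ₗ g ∘ₗ R.deep N
  have hE : ∀ (p : Uq q (n + 1)) (a : sphereSubalgebra hq n), R.deep N p = R.orbit a → E p = a := by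
    intro p a h
    change ((g (R.deep N p) : sphereSubalgebra hq n) : Uq q (n + 1)) = a
    rw [h, hg]
  have hEmul : ∀ a ∈ sphereSubalgebra hq n, ∀ p, R.deep N p ∈ LinearMap.range R.orbit →
      E (a * p) = a * E p := by
    rintro a ha p ⟨b, hb⟩
    rw [hE p b hb.symm, hE (a * p) (⟨a, ha⟩ * b)]
    · rfl
    · rw [R.deep_mul ha, ← hb, R.orbit_apply, R.orbit_apply, MulMemClass.coe_mul, map_mul,
        Module.End.mul_apply]
  obtain ⟨a, ha⟩ := h1
  refine ⟨E 1, ?_, ?_, fun b hb => ?_⟩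
  · rw [hE 1 a ha.symm]
    exact a.2
  · rw [hE 1 a ha.symm]
    intro h0
    have h2 : a = 0 := Subtype.ext h0
    rw [h2, map_zero, R.deep_one] at ha
    exact R.e.ne_zero _ ha.symm
  · obtain ⟨⟨c, hc⟩, h2⟩ := hN b hb
    rw [h2 E hEmul, hE b c hc.symm]
    exact c.2

end Uq

/-! ### Contraction of the second tensor factor -/

section Contract

variable {M V : Type*} [AddCommGroup M] [Module ℂ M] [AddCommGroup V] [Module ℂ V]

variable (M) in
/-- The contraction `x ⊗ y ↦ f(y) x`. -/
def contract (f : V →ₗ[ℂ] ℂ) : M ⊗[ℂ] V →ₗ[ℂ] M :=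
  (TensorProduct.rid ℂ M).toLinearMap ∘ₗ f.lTensor M

theorem contract_tmul (f : V →ₗ[ℂ] ℂ) (x : M) (y : V) : contract M f (x ⊗ₜ y) = f y • x := by
  simp [contract]

theorem eq_of_contract_eq {z z' : M ⊗[ℂ] V} (h : ∀ f : V →ₗ[ℂ] ℂ, contract M f z = contract M f z') :
    z = z' := by
  classical
  let b := Module.Basis.ofVectorSpace ℂ V
  refine (TensorProduct.equivFinsuppOfBasisRight b).injective (Finsupp.ext fun i => ?_)
  rw [TensorProduct.equivFinsuppOfBasisRight_apply, TensorProduct.equivFinsuppOfBasisRight_apply]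
  exact h (b.coord i)

theorem mem_span_of_contract_mem {z : M ⊗[ℂ] V} {S : Submodule ℂ M}
    (h : ∀ f : V →ₗ[ℂ] ℂ, contract M f z ∈ S) :
    z ∈ Submodule.span ℂ {w | ∃ x ∈ S, ∃ y : V, w = x ⊗ₜ y} := by
  classical
  let b := Module.Basis.ofVectorSpace ℂ V
  rw [← (TensorProduct.equivFinsuppOfBasisRight b).symm_apply_apply z,
    TensorProduct.equivFinsuppOfBasisRight_symm_apply]
  refine sum_mem fun i _ => Submodule.subset_span ⟨_, ?_, b i, rfl⟩
  rw [TensorProduct.equivFinsuppOfBasisRight_apply]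
  exact h (b.coord i)

theorem exists_contract_mem_span (z : M ⊗[ℂ] V) :
    ∃ T : Finset M, ∀ f : V →ₗ[ℂ] ℂ, contract M f z ∈ Submodule.span ℂ (T : Set M) := by
  classical
  induction z using TensorProduct.induction_on with
  | zero => exact ⟨∅, fun f => by simp⟩
  | tmul x y =>
    refine ⟨{x}, fun f => ?_⟩
    rw [contract_tmul]
    exact Submodule.smul_mem _ _ (Submodule.subset_span (by simp))
  | add z w hz hw =>
    obtain ⟨T, hT⟩ := hz
    obtain ⟨T', hT'⟩ := hw
    refine ⟨T ∪ T', fun f => ?_⟩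
    rw [map_add]
    exact add_mem (Submodule.span_mono (by simp) (hT f)) (Submodule.span_mono (by simp) (hT' f))

theorem contract_comp_assoc {N : Type*} [AddCommGroup N] [Module ℂ N] (f : V →ₗ[ℂ] ℂ)
    (z : (M ⊗[ℂ] N) ⊗[ℂ] V) : (contract N f).lTensor M (TensorProduct.assoc ℂ M N V z) =
      contract (M ⊗[ℂ] N) f z := by
  have : (contract N f).lTensor M ∘ₗ (TensorProduct.assoc ℂ M N V).toLinearMap =
      contract (M ⊗[ℂ] N) f := by
    ext x y w
    simp [contract_tmul, TensorProduct.tmul_smul]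
  exact LinearMap.congr_fun this z

theorem contract_rTensor {N : Type*} [AddCommGroup N] [Module ℂ N] (f : V →ₗ[ℂ] ℂ) (g : M →ₗ[ℂ] N)
    (z : M ⊗[ℂ] V) : contract N f (g.rTensor V z) = g (contract M f z) := by
  have : contract N f ∘ₗ g.rTensor V = g ∘ₗ contract M f := by
    ext x y
    simp [contract_tmul]
  exact LinearMap.congr_fun this z

theorem contract_lTensor {W : Type*} [AddCommGroup W] [Module ℂ W] (f : V →ₗ[ℂ] ℂ) (g : W →ₗ[ℂ] V)
    (z : M ⊗[ℂ] W) : contract M f (g.lTensor M z) = contract M (f ∘ₗ g) z := by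
  have : contract M f ∘ₗ g.lTensor M = contract M (f ∘ₗ g) := by
    ext x y
    simp [contract_tmul]
  exact LinearMap.congr_fun this z

end Contract

/-! ### The left action of the functionals -/

namespace Uq

variable {q : ℝ} {n : ℕ}

/-- The left action of a functional, `p ↦ f(p₂) p₁`. -/
def act (hq : q ≠ 0) (n : ℕ) (f : Uq q n →ₗ[ℂ] ℂ) : Module.End ℂ (Uq q n) :=
  contract _ f ∘ₗ (comul hq n).toLinearMap

theorem act_apply (hq : q ≠ 0) (f : Uq q n →ₗ[ℂ] ℂ) (p : Uq q n) :
    act hq n f p = contract _ f (comul hq n p) := rfl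

theorem act_act (hq : q ≠ 0) (f g : Uq q n →ₗ[ℂ] ℂ) (p : Uq q n) :
    act hq n f (act hq n g p) = act hq n (f ∘ₗ act hq n g) p := by
  have h := LinearMap.congr_fun (hopf hq n).coassoc p
  have h1 := congrArg (fun z => contract (Uq q n) f ((contract (Uq q n) g).lTensor (Uq q n) z)) h
  simp only [LinearMap.comp_apply, LinearEquiv.coe_coe] at h1
  rw [contract_comp_assoc, contract_rTensor, ← LinearMap.comp_apply (LinearMap.lTensor _ _),
    ← LinearMap.lTensor_comp, contract_lTensor] at h1
  exact h1

theorem act_counit (hq : q ≠ 0) (p : Uq q n) :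
    act hq n (counit hq n).toLinearMap p = p := by
  have h := LinearMap.congr_fun (hopf hq n).counit_right p
  have h1 := congrArg (TensorProduct.rid ℂ (Uq q n)) h
  exact h1.trans (by simp)

theorem act_mem_coinvariants (hq : q ≠ 0) (f : Uq q (n + 1) →ₗ[ℂ] ℂ) {b : Uq q (n + 1)}
    (hb : b ∈ coinvariants (coaction hq n)) :
    act hq (n + 1) f b ∈ coinvariants (coaction hq n) := by
  have hb' : coaction hq n b = 1 ⊗ₜ[ℂ] b := hb
  have hcoassoc : ((Algebra.TensorProduct.assoc ℂ ℂ ℂ (Uq q n) (Uq q (n + 1))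
      (Uq q (n + 1))).toAlgHom.comp ((Algebra.TensorProduct.map (coaction hq n)
        (AlgHom.id ℂ (Uq q (n + 1)))).comp (comul hq (n + 1)))) =
      (Algebra.TensorProduct.map (AlgHom.id ℂ (Uq q n)) (comul hq (n + 1))).comp
        (coaction hq n) := by
    refine algHom_ext hq (A := Uq q n ⊗[ℂ] (Uq q (n + 1) ⊗[ℂ] Uq q (n + 1))) fun i j => ?_
    simp [comul_t, coaction_t, TensorProduct.sum_tmul, TensorProduct.tmul_sum]
    exact Finset.sum_comm
  have h := DFunLike.congr_fun hcoassoc b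
  have h1 := congrArg ((contract (Uq q (n + 1)) f).lTensor (Uq q n)) h
  change coaction hq n (contract _ f (comul hq (n + 1) b)) = 1 ⊗ₜ[ℂ] contract _ f (comul hq (n + 1) b)
  have h2 := contract_comp_assoc f
    ((coaction hq n).toLinearMap.rTensor (Uq q (n + 1)) (comul hq (n + 1) b))
  rw [contract_rTensor] at h2
  refine h2.symm.trans (h1.trans ?_)
  change (contract (Uq q (n + 1)) f).lTensor (Uq q n)
    ((comul hq (n + 1)).toLinearMap.lTensor (Uq q n) (coaction hq n b)) = _
  rw [hb', LinearMap.lTensor_tmul, LinearMap.lTensor_tmul]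
  rfl

/-- Δ leaves the row index of `t` and the column index of `s` in the first factor, so the sphere
algebra is a right subcomodule. -/
theorem act_mem_sphereSubalgebra (hq : q ≠ 0) (f : Uq q (n + 1) →ₗ[ℂ] ℂ) {a : Uq q (n + 1)}
    (ha : a ∈ sphereSubalgebra hq n) : act hq (n + 1) f a ∈ sphereSubalgebra hq n := by
  let φ := Algebra.TensorProduct.map (sphereSubalgebra hq n).val (AlgHom.id ℂ (Uq q (n + 1)))
  have h : comul hq (n + 1) a ∈ φ.range := by
    have hle : sphereSubalgebra hq n ≤ φ.range.comap (comul hq (n + 1)) := by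
      refine Algebra.adjoin_le ?_
      rintro _ (⟨j, rfl⟩ | ⟨j, rfl⟩)
      · rw [SetLike.mem_coe, Subalgebra.mem_comap, comul_t]
        exact sum_mem fun k _ => ⟨⟨_, t_mem_sphereSubalgebra hq k⟩ ⊗ₜ t q k j, by simp [φ]⟩
      · rw [SetLike.mem_coe, Subalgebra.mem_comap, comul_s]
        exact sum_mem fun k _ => ⟨⟨_, s_mem_sphereSubalgebra hq k⟩ ⊗ₜ s hq j k, by simp [φ]⟩
    exact hle ha
  obtain ⟨z, hz⟩ := h
  rw [act_apply, ← hz]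
  change contract (Uq q (n + 1)) f (φ z) ∈ _
  clear hz
  induction z using TensorProduct.induction_on with
  | zero => rw [map_zero, map_zero]; exact zero_mem _
  | tmul a p =>
    rw [Algebra.TensorProduct.map_tmul, contract_tmul]
    exact Subalgebra.smul_mem _ a.2 _
  | add x y hx hy => rw [map_add, map_add]; exact add_mem hx hy

/-! ### The inverse of the antipode -/

/-- The inverse of the antipode. -/
def antipodeInv (hq : q ≠ 0) (n : ℕ) : Module.End ℂ (Uq q n) where
  -- In a Hopf `*`-algebra the antipode is invertible with inverse * ∘ S ∘ *.
  toFun p := conjMap hq (antipode hq n (conjMap hq p))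
  map_add' x y := by simp only [conjMap_add, map_add]
  map_smul' c x := by simp only [conjMap_smul, map_smul, Complex.conj_conj, RingHom.id_apply]

theorem antipodeInv_apply (hq : q ≠ 0) (p : Uq q n) :
    antipodeInv hq n p = conjMap hq (antipode hq n (conjMap hq p)) := rfl

theorem antipodeInv_mul (hq : q ≠ 0) (x y : Uq q n) :
    antipodeInv hq n (x * y) = antipodeInv hq n y * antipodeInv hq n x := by
  simp only [antipodeInv_apply, conjMap_mul, antipode_mul]

theorem antipodeInv_one (hq : q ≠ 0) : antipodeInv hq n 1 = 1 := by
  simp only [antipodeInv_apply, conjMap_one, antipode_one]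

theorem antipodeInv_s (hq : q ≠ 0) (i j : Fin n) : antipodeInv hq n (s hq i j) = t q i j := by
  rw [antipodeInv_apply, conjMap_s, antipode_t, conjMap_s]

theorem sum_antipodeInv_t_mul (hq : q ≠ 0) (l j : Fin n) :
    ∑ k, antipodeInv hq n (t q k j) * t q l k = if l = j then 1 else 0 := by
  have h := congrArg (fun z => antipodeInv hq n z) ((isMatInv hq n).left l j)
  simp only [map_sum, antipodeInv_mul, antipodeInv_s] at h
  rw [h]
  split_ifs
  · exact antipodeInv_one hq
  · exact map_zero _

/-- The map `v ⊗ p ↦ (1 ⊗ S⁻¹(p)) Δ(v)`. -/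
def slide (hq : q ≠ 0) (n : ℕ) : Module.End ℂ (Uq q n ⊗[ℂ] Uq q n) :=
  LinearMap.mul' ℂ (Uq q n ⊗[ℂ] Uq q n) ∘ₗ TensorProduct.map
    ((Algebra.TensorProduct.includeRight : Uq q n →ₐ[ℂ] Uq q n ⊗[ℂ] Uq q n).toLinearMap ∘ₗ
      antipodeInv hq n) (comul hq n).toLinearMap ∘ₗ (TensorProduct.comm ℂ _ _).toLinearMap

theorem slide_tmul (hq : q ≠ 0) (v p : Uq q n) :
    slide hq n (v ⊗ₜ p) = (1 ⊗ₜ antipodeInv hq n p) * comul hq n v := rfl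

theorem slide_mul_tmul (hq : q ≠ 0) (z : Uq q n ⊗[ℂ] Uq q n) (y r : Uq q n) :
    slide hq n (z * (y ⊗ₜ r)) = (1 ⊗ₜ antipodeInv hq n r) * slide hq n z * comul hq n y := by
  induction z using TensorProduct.induction_on with
  | zero => simp
  | tmul x p =>
    rw [Algebra.TensorProduct.tmul_mul_tmul, slide_tmul, slide_tmul, antipodeInv_mul, map_mul,
      ← one_mul (1 : Uq q n), ← Algebra.TensorProduct.tmul_mul_tmul, one_mul]
    noncomm_ring
  | add x y hx hy => rw [add_mul, map_add, map_add, hx, hy, mul_add, add_mul]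

/-- In Sweedler notation v₁ ⊗ S⁻¹(v₃)v₂ = v ⊗ 1. -/
theorem slide_comul (hq : q ≠ 0) (v : Uq q n) : slide hq n (comul hq n v) = v ⊗ₜ 1 := by
  induction v using induction_t_s hq with
  | ht i j =>
    simp only [comul_t, map_sum, slide_tmul, Finset.mul_sum, Algebra.TensorProduct.tmul_mul_tmul,
      one_mul]
    rw [Finset.sum_comm]
    simp only [← TensorProduct.tmul_sum, sum_antipodeInv_t_mul]
    rw [Finset.sum_eq_single j, if_pos rfl]
    · intro l _ hl
      rw [if_neg hl, TensorProduct.tmul_zero]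
    · simp
  | hs i j =>
    simp only [comul_s, map_sum, slide_tmul, Finset.mul_sum, Algebra.TensorProduct.tmul_mul_tmul,
      one_mul, antipodeInv_s]
    rw [Finset.sum_comm]
    simp only [← TensorProduct.tmul_sum, (isMatInv hq n).right]
    rw [Finset.sum_eq_single i, if_pos rfl]
    · intro l _ hl
      rw [if_neg hl.symm, TensorProduct.tmul_zero]
    · simp
  | hc c =>
    rw [AlgHom.commutes, Algebra.algebraMap_eq_smul_one, map_smul, Algebra.TensorProduct.one_def,
      slide_tmul, antipodeInv_one, map_one, Algebra.algebraMap_eq_smul_one, mul_one,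
      TensorProduct.smul_tmul']
  | hadd x y hx hy => rw [map_add, map_add, hx, hy, TensorProduct.add_tmul]
  | hmul x y hx hy =>
    have key : ∀ w, slide hq n (comul hq n x * w) = (x ⊗ₜ 1) * slide hq n w := by
      intro w
      induction w using TensorProduct.induction_on with
      | zero => simp
      | tmul y r =>
        rw [slide_mul_tmul, hx, slide_tmul, Algebra.TensorProduct.tmul_mul_tmul, ← mul_assoc,
          Algebra.TensorProduct.tmul_mul_tmul, one_mul, mul_one, one_mul, mul_one]
      | add w w' h h' => rw [mul_add, map_add, map_add, h, h', mul_add]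
    rw [map_mul, key, hy, Algebra.TensorProduct.tmul_mul_tmul, mul_one]

/-- Replace v ⊗ 1 by v₁ ⊗ S⁻¹(v₃)v₂. Then v a₁ f(a₂) becomes a combination of functionals acting on
products xa with x in V, so multiplication by V can be performed before the action. -/
theorem mul_act_mem (hq : q ≠ 0) {V J : Submodule ℂ (Uq q n)} {v a : Uq q n}
    (hV : ∀ x ∈ V, ∀ f, act hq n f (x * a) ∈ J)
    (hv : ∀ f, act hq n f v ∈ V) (f : Uq q n →ₗ[ℂ] ℂ) :
    v * act hq n f a ∈ J := by
  have h1 : ∀ (p : Uq q n) z, contract (Uq q n) f ((1 ⊗ₜ p) * z) =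
      contract (Uq q n) (f ∘ₗ LinearMap.mulLeft ℂ p) z := by
    intro p z
    induction z using TensorProduct.induction_on with
    | zero => simp
    | tmul x y => simp [contract_tmul]
    | add x y hx hy => rw [mul_add, map_add, map_add, hx, hy]
  have h2 : ∀ z, contract (Uq q n) f ((v ⊗ₜ 1) * z) = v * contract (Uq q n) f z := by
    intro z
    induction z using TensorProduct.induction_on with
    | zero => simp
    | tmul x y => simp [contract_tmul]
    | add x y hx hy => rw [mul_add, map_add, map_add, hx, hy, mul_add]
  rw [act_apply, ← h2, ← slide_comul]
  refine map_mem_of_mem_span (contract (Uq q n) f ∘ₗ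
    LinearMap.mulRight ℂ (comul hq n a) ∘ₗ slide hq n) ?_ (mem_span_of_contract_mem hv)
  rintro _ ⟨x, hx, p, rfl⟩
  simp only [LinearMap.comp_apply, LinearMap.mulRight_apply, slide_tmul]
  rw [mul_assoc, h1, ← map_mul]
  exact hV x hx _

end Uq

/-! ### Unitary comodules -/

namespace Uq

variable {q : ℝ} {n : ℕ} {ι : Type} [Fintype ι] [DecidableEq ι]

/-- A finite family which spans a right subcomodule with unitary matrix coefficients `U`. -/
structure IsFrame (hq : q ≠ 0) (x : ι → Uq q n) (U : ι → ι → Uq q n) : Prop where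
  comul : ∀ a, comul hq n (x a) = ∑ b, x b ⊗ₜ[ℂ] U b a
  antipode : ∀ a b, antipode hq n (U a b) = conjMap hq (U b a)
  unitary : ∀ a b, ∑ k, U a k * conjMap hq (U b k) = if a = b then 1 else 0

/-- The matrix `t` and `detStar` are unitary corepresentations. Sums of elements use direct sums of
frames, and products use tensor products. -/
theorem exists_isFrame (hq : q ≠ 0) (p : Uq q n) :
    ∃ (ι : Type) (_ : Fintype ι) (_ : DecidableEq ι) (x : ι → Uq q n) (U : ι → ι → Uq q n),
      IsFrame hq x U ∧ ∃ c : ι → ℂ, p = ∑ a, c a • x a := by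
  induction p using induction with
  | ht i j =>
    refine ⟨Fin n, inferInstance, inferInstance, fun k => t q i k, t q, ⟨fun k => comul_t hq i k,
      fun a b => ?_, fun a b => ?_⟩, Pi.single j 1, ?_⟩
    · rw [antipode_t, conjMap_t]
    · simp only [conjMap_t, (isMatInv hq n).right]
    · simp [Pi.single_apply]
  | hd =>
    refine ⟨Unit, inferInstance, inferInstance, fun _ => detStar q n, fun _ _ => detStar q n,
      ⟨fun k => ?_, fun a b => ?_, fun a b => ?_⟩, fun _ => 1, ?_⟩
    · simp [comul_detStar]
    · rw [antipode_detStar, conjMap_detStar]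
    · simp [conjMap_detStar, detStar_mul_det]
    · simp
  | hc c =>
    refine ⟨Unit, inferInstance, inferInstance, fun _ => 1, fun _ _ => 1,
      ⟨fun k => ?_, fun a b => ?_, fun a b => ?_⟩, fun _ => c, ?_⟩
    · simp [Algebra.TensorProduct.one_def]
    · rw [antipode_one, conjMap_one]
    · simp [conjMap_one]
    · simp [Algebra.algebraMap_eq_smul_one]
  | hadd p p' h h' =>
    obtain ⟨ι, _, _, x, U, h, c, rfl⟩ := h
    obtain ⟨ι', _, _, x', U', h', c', rfl⟩ := h'
    refine ⟨ι ⊕ ι', inferInstance, inferInstance, Sum.elim x x',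
      Sum.elim (fun a => Sum.elim (U a) 0) (fun a => Sum.elim 0 (U' a)),
      ⟨?_, ?_, ?_⟩, Sum.elim c c', ?_⟩
    · rintro (a | a)
      · simp [h.comul]
      · simp [h'.comul]
    · rintro (a | a) (b | b)
      · exact h.antipode a b
      · exact (map_zero _).trans (conjMap_zero hq).symm
      · exact (map_zero _).trans (conjMap_zero hq).symm
      · exact h'.antipode a b
    · rintro (a | a) (b | b)
      · simp [h.unitary]
      · simp [conjMap_zero]
      · simp [conjMap_zero]
      · simp [h'.unitary]
    · simp
  | hmul p p' h h' =>
    obtain ⟨ι, _, _, x, U, h, c, rfl⟩ := h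
    obtain ⟨ι', _, _, x', U', h', c', rfl⟩ := h'
    refine ⟨ι × ι', inferInstance, inferInstance, fun a => x a.1 * x' a.2,
      fun a b => U a.1 b.1 * U' a.2 b.2, ⟨?_, ?_, ?_⟩, fun a => c a.1 * c' a.2, ?_⟩
    · rintro ⟨a, a'⟩
      rw [map_mul, h.comul, h'.comul, Finset.sum_mul_sum, Fintype.sum_prod_type]
      simp only [Algebra.TensorProduct.tmul_mul_tmul]
    · rintro ⟨a, a'⟩ ⟨b, b'⟩
      rw [antipode_mul, h.antipode, h'.antipode, conjMap_mul]
    · rintro ⟨a, a'⟩ ⟨b, b'⟩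
      have : ∀ k k', U a k * U' a' k' * conjMap hq (U b k * U' b' k') =
          U a k * (U' a' k' * conjMap hq (U' b' k')) * conjMap hq (U b k) := by
        intro k k'
        rw [conjMap_mul]
        noncomm_ring
      simp only [Fintype.sum_prod_type, this, ← Finset.sum_mul, ← Finset.mul_sum, h'.unitary]
      by_cases hb : a' = b'
      · simp [hb, h.unitary]
      · simp [hb]
    · rw [Finset.sum_mul_sum, Fintype.sum_prod_type]
      simp only [smul_mul_smul_comm]

namespace IsFrame

variable {hq : q ≠ 0} {x : ι → Uq q n} {U : ι → ι → Uq q n}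

theorem act_apply (h : IsFrame hq x U) (f : Uq q n →ₗ[ℂ] ℂ) (a : ι) :
    act hq n f (x a) = ∑ b, f (U b a) • x b := by
  rw [Uq.act_apply, h.comul, map_sum]
  simp only [contract_tmul]

theorem comul_conjMap (h : IsFrame hq x U) (a : ι) :
    Uq.comul hq n (conjMap hq (x a)) = ∑ b, conjMap hq (x b) ⊗ₜ[ℂ] conjMap hq (U b a) := by
  let _ := starRingOfHom (starHom hq n) (conjMap_conjMap hq)
  have := starModuleOfHom (starHom hq n) (conjMap_conjMap hq)
  have h1 : Uq.comul hq n (conjMap hq (x a)) = star (Uq.comul hq n (x a)) :=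
    (hopfStar hq n).comul_star (x a)
  rw [h1, h.comul, star_sum]
  exact Finset.sum_congr rfl fun b _ => TensorProduct.star_tmul _ _

theorem eq_sum_counit (h : IsFrame hq x U) (a : ι) : x a = ∑ b, counit hq n (x b) • U b a := by
  have h1 := LinearMap.congr_fun (hopf hq n).counit_left (x a)
  have h2 := congrArg (TensorProduct.lid ℂ (Uq q n)) h1
  have h3 : (hopf hq n).comul.toLinearMap (x a) = ∑ b, x b ⊗ₜ[ℂ] U b a := h.comul a
  rw [LinearMap.comp_apply, h3, map_sum, map_sum] at h2
  simp only [LinearMap.rTensor_tmul, TensorProduct.lid_tmul, TensorProduct.mk_apply,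
    one_smul] at h2
  exact h2.symm

/-- Unitarity gives Δ(z) = z ⊗ 1 for this sum z, and applying the counit to the first factor shows
that z is the scalar ε(z). -/
theorem sum_mul_conjMap (h : IsFrame hq x U) : ∑ a, x a * conjMap hq (x a) =
    algebraMap ℂ _ ((∑ a, Complex.normSq (counit hq n (x a)) : ℝ) : ℂ) := by
  have h1 : Uq.comul hq n (∑ a, x a * conjMap hq (x a)) =
      (∑ a, x a * conjMap hq (x a)) ⊗ₜ[ℂ] 1 := by
    simp only [map_sum, map_mul, h.comul, h.comul_conjMap, Finset.sum_mul_sum,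
      Algebra.TensorProduct.tmul_mul_tmul, TensorProduct.sum_tmul]
    rw [Finset.sum_comm]
    refine Finset.sum_congr rfl fun b _ => ?_
    rw [Finset.sum_comm]
    simp only [← TensorProduct.tmul_sum, h.unitary]
    rw [Finset.sum_eq_single b, if_pos rfl]
    · intro c _ hc
      rw [if_neg hc.symm, TensorProduct.tmul_zero]
    · simp
  have h2 := LinearMap.congr_fun (hopf hq n).counit_left (∑ a, x a * conjMap hq (x a))
  have h3 := congrArg (TensorProduct.lid ℂ (Uq q n)) h2
  have h4 : (hopf hq n).comul.toLinearMap (∑ a, x a * conjMap hq (x a)) =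
    (∑ a, x a * conjMap hq (x a)) ⊗ₜ[ℂ] 1 := h1
  rw [LinearMap.comp_apply, h4, LinearMap.rTensor_tmul, TensorProduct.lid_tmul,
    TensorProduct.mk_apply, TensorProduct.lid_tmul, one_smul] at h3
  rw [← h3, Algebra.algebraMap_eq_smul_one]
  congr 1
  change counit hq n _ = _
  have hstar : ∀ a, counit hq n (conjMap hq (x a)) = conj (counit hq n (x a)) := fun a =>
    (hopfStar hq n).counit_star (x a)
  simp only [map_sum, map_mul, hstar, Complex.mul_conj, Complex.ofReal_sum]

/-- The linear combinations of a family. -/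
def comb (x : ι → Uq q n) : EuclideanSpace ℂ ι →ₗ[ℂ] Uq q n where
  toFun v := ∑ a, v a • x a
  map_add' v w := by simp [add_smul, Finset.sum_add_distrib]
  map_smul' c v := by simp [mul_smul, Finset.smul_sum]

/-- A unitary frame can be projected to a subcomodule. -/
theorem exists_isFrame_mem (h : IsFrame hq x U) {I : Submodule ℂ (Uq q n)}
    (hI : ∀ f, ∀ p ∈ I, act hq n f p ∈ I) (c : ι → ℂ) (hc : ∑ a, c a • x a ∈ I) :
    ∃ y, IsFrame hq y U ∧ (∀ a, y a ∈ I) ∧ ∑ a, c a • x a = ∑ a, c a • y a := by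
  let K : Submodule ℂ (EuclideanSpace ℂ ι) := I.comap (comb x)
  let F : (Uq q n →ₗ[ℂ] ℂ) → Module.End ℂ (EuclideanSpace ℂ ι) := fun f =>
    Matrix.toEuclideanLin (Matrix.of fun a b => f (U a b))
  have hF_apply : ∀ f v a, F f v a = ∑ b, f (U a b) * v b := by
    intro f v a
    rfl
  have hcomb : ∀ f v, comb x (F f v) = act hq n f (comb x v) := by
    intro f v
    change ∑ a, F f v a • x a = act hq n f (∑ a, v a • x a)
    simp only [hF_apply, map_sum, map_smul, h.act_apply, Finset.smul_sum, Finset.sum_smul, smul_smul]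
    rw [Finset.sum_comm]
    simp only [mul_comm]
  have hK : ∀ f, ∀ v ∈ K, F f v ∈ K := by
    intro f v hv
    rw [Submodule.mem_comap, hcomb]
    exact hI f _ hv
  -- By U_{ba} = S(U_{ab})*, adjoints of these operators are again of this type. So the orthogonal
  -- complement of K is invariant and the projection to K commutes with the coaction.
  have hadj : ∀ f, ∃ g, LinearMap.adjoint (F f) = F g := by
    intro f
    refine ⟨{ toFun := fun p => conj (f (conjMap hq (Uq.antipode hq n p)))
              map_add' := fun p r => by simp [conjMap_add]
              map_smul' := fun c p => by simp [conjMap_smul] }, ?_⟩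
    rw [← Matrix.toEuclideanLin_conjTranspose_eq_adjoint]
    congr 1
    ext a b
    change conj (f (U b a)) = conj (f (conjMap hq (Uq.antipode hq n (U a b))))
    rw [h.antipode, conjMap_conjMap]
  have hKo : ∀ f, ∀ v ∈ Kᗮ, F f v ∈ Kᗮ := by
    intro f v hv
    obtain ⟨g, hg⟩ := hadj f
    rw [Submodule.mem_orthogonal]
    intro u hu
    rw [← LinearMap.adjoint_inner_left, hg]
    exact (Submodule.mem_orthogonal K v).1 hv _ (hK g u hu)
  have hcomm : ∀ f v, K.starProjection (F f v) = F f (K.starProjection v) := by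
    intro f v
    refine Submodule.eq_starProjection_of_mem_orthogonal' (hK f _ (K.starProjection_apply_mem v))
      (hKo f _ (Submodule.sub_starProjection_mem_orthogonal v)) ?_
    rw [← map_add, add_sub_cancel]
  let y : ι → Uq q n := fun a => comb x (K.starProjection (EuclideanSpace.single a 1))
  have hsum : ∀ v : EuclideanSpace ℂ ι, comb x (K.starProjection v) = ∑ a, v a • y a := by
    intro v
    have hv : v = ∑ a, v a • EuclideanSpace.single a (1 : ℂ) := by
      ext b
      simp [Pi.single_apply]
    conv_lhs => rw [hv]
    simp only [map_sum, map_smul, y]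
  refine ⟨y, ⟨fun a => eq_of_contract_eq fun f => ?_, h.antipode, h.unitary⟩,
    fun a => K.starProjection_apply_mem _, ?_⟩
  · rw [← Uq.act_apply, ← hcomb, ← hcomm, hsum, map_sum]
    refine Finset.sum_congr rfl fun b _ => ?_
    rw [contract_tmul, hF_apply]
    congr 1
    simp
  · have := hsum (WithLp.toLp 2 c)
    rw [Submodule.starProjection_eq_self_iff.2] at this
    · exact this
    · exact hc

end IsFrame

/-! ### The coinvariants are the sphere algebra. -/

theorem conjMap_mem_sphereSubalgebra (hq : q ≠ 0) {a : Uq q (n + 1)}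
    (ha : a ∈ sphereSubalgebra hq n) : conjMap hq a ∈ sphereSubalgebra hq n := by
  induction ha using Algebra.adjoin_induction with
  | mem a ha =>
    obtain ⟨j, rfl⟩ | ⟨j, rfl⟩ := ha
    · change conjMap hq (t q 0 j) ∈ _
      rw [conjMap_t]; exact s_mem_sphereSubalgebra hq j
    · change conjMap hq (s hq j 0) ∈ _
      rw [conjMap_s]; exact t_mem_sphereSubalgebra hq j
  | algebraMap c => rw [conjMap_algebraMap]; exact Subalgebra.algebraMap_mem _ _
  | add a b _ _ ha hb => rw [conjMap_add]; exact add_mem ha hb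
  | mul a b _ _ ha hb => rw [conjMap_mul]; exact mul_mem hb ha

/-- A nonzero right ideal of the sphere algebra which is a subcomodule contains `1`. -/
theorem one_mem_of_act_mem (hq : q ≠ 0) {I : Submodule ℂ (Uq q (n + 1))}
    (hI : ∀ f, ∀ p ∈ I, act hq (n + 1) f p ∈ I)
    (hIS : ∀ p ∈ I, p ∈ sphereSubalgebra hq n)
    (hmul : ∀ p ∈ I, ∀ a ∈ sphereSubalgebra hq n, p * a ∈ I) {p : Uq q (n + 1)} (hp : p ∈ I)
    (hp0 : p ≠ 0) : 1 ∈ I := by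
  obtain ⟨ι, _, _, x, U, hx, c, rfl⟩ := exists_isFrame hq p
  obtain ⟨y, hy, hyI, hxy⟩ := hx.exists_isFrame_mem hI c hp
  -- The ideal property on the right puts this sum into I, and it is the scalar ∑ |ε(y_a)|². Were it
  -- 0, all ε(y_a) and with them all y_a = ∑ ε(y_b)U_{ba} would vanish, contrary to p ≠ 0.
  have hz : ∑ a, y a * conjMap hq (y a) ∈ I := sum_mem fun a _ =>
    hmul _ (hyI a) _ (conjMap_mem_sphereSubalgebra hq (hIS _ (hyI a)))
  rw [hy.sum_mul_conjMap, Algebra.algebraMap_eq_smul_one] at hz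
  refine (Submodule.smul_mem_iff _ ?_).1 hz
  intro h0
  refine hp0 ?_
  rw [hxy]
  refine Finset.sum_eq_zero fun a _ => ?_
  have h1 : ∀ b, counit hq (n + 1) (y b) = 0 := fun b => by
    have h2 := (Finset.sum_eq_zero_iff_of_nonneg fun a _ =>
      Complex.normSq_nonneg (counit hq (n + 1) (y a))).1 (Complex.ofReal_eq_zero.1 h0) b
      (Finset.mem_univ b)
    exact Complex.normSq_eq_zero.1 h2
  rw [hy.eq_sum_counit a]
  simp [h1]

/-- The coinvariants of the coaction of `U_q(n)` on `U_q(n+1)` belong to the sphere algebra. -/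
theorem coinvariants_le (hq : q ≠ 0) (n : ℕ) :
    coinvariants (coaction hq n) ≤ sphereSubalgebra hq n := by
  intro b hb
  -- The finite-dimensional subcomodule generated by b; it consists of coinvariants because the
  -- functionals act on the other side.
  let V : Submodule ℂ (Uq q (n + 1)) := Submodule.span ℂ (Set.range fun f => act hq (n + 1) f b)
  have hVact : ∀ f, act hq (n + 1) f b ∈ V := fun f => Submodule.subset_span ⟨f, rfl⟩
  obtain ⟨T, hT⟩ := exists_contract_mem_span (comul hq (n + 1) b)
  have hVle : V ≤ Submodule.span ℂ (T : Set (Uq q (n + 1))) := by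
    refine Submodule.span_le.2 ?_
    rintro _ ⟨f, rfl⟩
    exact hT f
  have hVfg : V.FG := by
    have := FiniteDimensional.span_finset ℂ T
    have := Submodule.finiteDimensional_of_le hVle
    exact Module.Finite.iff_fg.1 this
  obtain ⟨W, hW⟩ := hVfg
  have hVcoinv : ∀ v ∈ V, v ∈ coinvariants (coaction hq n) := by
    intro v hv
    refine (Submodule.span_le (p := Subalgebra.toSubmodule (coinvariants (coaction hq n)))).2 ?_ hv
    rintro _ ⟨f, rfl⟩
    exact act_mem_coinvariants hq f hb
  have hVV : ∀ f, ∀ v ∈ V, act hq (n + 1) f v ∈ V := by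
    intro f v hv
    refine map_mem_of_mem_span (act hq (n + 1) f) ?_ hv
    rintro _ ⟨g, rfl⟩
    rw [act_act]
    exact hVact _
  obtain ⟨a, ha, ha0, hWa⟩ := exists_mul_mem_sphereSubalgebra hq n W fun v hv =>
    hVcoinv v (hW ▸ Submodule.subset_span hv)
  let S := Subalgebra.toSubmodule (sphereSubalgebra hq n)
  -- The elements which multiply V into the sphere algebra. A common denominator of a basis of V
  -- makes this right ideal nonzero, and once it contains 1, V itself lies in the sphere algebra.
  let I : Submodule ℂ (Uq q (n + 1)) := S ⊓ ⨅ v : V, S.comap (LinearMap.mulLeft ℂ (v : Uq q (n + 1)))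
  have hmemI : ∀ p, p ∈ I ↔ p ∈ sphereSubalgebra hq n ∧ ∀ v ∈ V, v * p ∈ sphereSubalgebra hq n := by
    intro p
    simp [I, S]
  have haI : a ∈ I := by
    refine (hmemI a).2 ⟨ha, fun v hv => ?_⟩
    rw [← hW] at hv
    exact map_mem_of_mem_span (T := S) (LinearMap.mulRight ℂ a) hWa hv
  have h1 : (1 : Uq q (n + 1)) ∈ I := by
    refine one_mem_of_act_mem hq (fun f p hp => ?_) (fun p hp => ((hmemI p).1 hp).1)
      (fun p hp r hr => ?_) haI ha0
    · obtain ⟨hp1, hp2⟩ := (hmemI p).1 hp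
      exact (hmemI _).2 ⟨act_mem_sphereSubalgebra hq f hp1, fun v hv =>
        mul_act_mem hq (V := V) (J := S)
          (fun x hx g => act_mem_sphereSubalgebra hq g (hp2 x hx)) (fun g => hVV g v hv) f⟩
    · obtain ⟨hp1, hp2⟩ := (hmemI p).1 hp
      refine (hmemI _).2 ⟨mul_mem hp1 hr, fun v hv => ?_⟩
      rw [← mul_assoc]
      exact mul_mem (hp2 v hv) hr
  have hbV : b ∈ V := by
    have := hVact (counit hq (n + 1)).toLinearMap
    rwa [act_counit] at this
  have := ((hmemI 1).1 h1).2 b hbV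
  rwa [mul_one] at this

end Uq

end QBundle

end

open QBundle in
theorem theorem2p5 (q : ℝ) (hq : q ≠ 0) (n : ℕ) :
    ∃ (HP : HopfStarStructure (Uq q (n + 1))) (HA : HopfStarStructure (Uq q n))
      (α : Uq q (n + 1) →ₐ[ℂ] Uq q n) (β : Uq q (n + 1) →ₐ[ℂ] Uq q n ⊗[ℂ] Uq q (n + 1)),
      Uq.IsStandard HP ∧ Uq.IsStandard HA ∧
      IsRestriction α ∧ IsHopfStarHom HP HA α ∧ Function.Surjective α ∧
      β = (Algebra.TensorProduct.map α (AlgHom.id ℂ (Uq q (n + 1)))).comp HP.comul ∧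
      IsQuantumPrincipalBundle HA.toHopfStructure β (coinvariants β) ∧
      ∃ (_ : StarRing (Sphere q (n + 1))) (_ : StarModule ℂ (Sphere q (n + 1))),
        (∀ i : Fin (n + 1), star (Sphere.x q i) = Sphere.v q i) ∧
        ∃ φ : Sphere q (n + 1) ≃ₐ[ℂ] coinvariants β,
          ∀ s, (φ (star s) : Uq q (n + 1)) = HP.starRing.star (φ s : Uq q (n + 1)) := by
  have hrange : (Sphere.toUq hq n).range = coinvariants (Uq.coaction hq n) :=
    (Sphere.range_toUq hq n).trans
      (le_antisymm (Uq.sphereSubalgebra_le hq) (Uq.coinvariants_le hq n))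
  refine ⟨Uq.hopfStar hq (n + 1), Uq.hopfStar hq n, Uq.restrict hq n, Uq.coaction hq n,
    Uq.isStandard_hopfStar hq (n + 1), Uq.isStandard_hopfStar hq n,
    Uq.isRestriction_restrict hq n, Uq.isHopfStarHom_restrict hq n, Uq.restrict_surjective hq n,
    rfl, Uq.isQuantumPrincipalBundle hq n,
    starRingOfHom (Sphere.starHom hq (n + 1)) (Sphere.conjMap_conjMap hq),
    starModuleOfHom (Sphere.starHom hq (n + 1)) (Sphere.conjMap_conjMap hq),
    Sphere.conjMap_x hq,
    (AlgEquiv.ofInjective (Sphere.toUq hq n) (Sphere.toUq_injective hq n)).trans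
      (Subalgebra.equivOfEq _ _ hrange), fun s => ?_⟩
  exact Sphere.toUq_conjMap hq s
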